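/- Fix $\zeta\in\mathbb T$ and write $\mathrm C(\mathbb T^2_\zeta)$ for the universal unital $\mathrm C^*$-algebra generated by unitaries $U,V$ with $VU=\zeta UV$. A $\mathbb T$-$\mathrm C^*$-algebra is a unital $\mathrm C^*$-algebra $X$ with a coaction $\rho^X\colon X\to X\otimes \mathrm C(\mathbb T)=\mathrm C(\mathbb T,X)$, i.e. a unital $*$-homomorphism with $(\rho^X\otimes\mathrm{id})\rho^X=(\mathrm{id}\otimes\Delta_{\mathbb T})\rho^X$ and with $\rho^X(X)(1\otimes \mathrm C(\mathbb T))$ linearly dense; write $\rho^X_z(x)=\rho^X(x)(z)$. For $\mathbb T$-$\mathrm C^*$-algebras $X,Y$ let $j_1\colon X\to X\otimes Y\otimes \mathrm C(\mathbb T^2_\zeta)$ and $j_2\colon Y\to X\otimes Y\otimes \mathrm C(\mathbb T^2_\zeta)$ (minimal tensor products) be the $*$-homomorphisms with $j_1(x)=x\otimes 1\otimes U^k$ if $\rho^X_z(x)=z^kx$ for all $z$, and $j_2(y)=1\otimes y\otimes V^l$ if $\rho^Y_z(y)=z^ly$ for all $z$. The braided tensor product $X\boxtimes_\zeta Y$ is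 the closed linear span of $j_1(X)j_2(Y)$, a $\mathbb T$-$\mathrm C^*$-algebra with the coaction for which $j_1,j_2$ are equivariant. A braided compact quantum group $G$ over $\mathbb T$ is a $\mathbb T$-$\mathrm C^*$-algebra $\mathrm C(G)$ with an equivariant coassociative unital $*$-homomorphism $\Delta_G\colon \mathrm C(G)\to \mathrm C(G)\boxtimes_\zeta \mathrm C(G)$ such that $\Delta_G(\mathrm C(G))\,j_1(\mathrm C(G))$ and $\Delta_G(\mathrm C(G))\,j_2(\mathrm C(G))$ are both linearly dense in $\mathrm C(G)\boxtimes_\zeta\mathrm C(G)$. A finite-dimensional representation of $G$ is a triple $(\mathcal H,V,v)$, where $\mathcal H$ is a finite-dimensional Hilbert space, $V$ is a continuous unitary representation of $\mathbb T$ on $\mathcal H$ and $v\in \mathcal L(\mathcal H)\otimes \mathrm C(G)$ satisfies $(\mathrm{Ad}\,V(z)\otimes\rho_z^{\mathrm C(G)})(v)=v$ for all $z\in\mathbb T$ and $(\mathrm{id}\otimes\Delta_G)(v)=(\mathrm{id}\otimes j_1)(v)(\mathrm{id}\otimes j_2)(v)$; it is unitary if $v$ is. If $(e_1,\dots,e_n)$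 is an orthonormal basis of $\mathcal H$ with $V(z)e_i=z^{d_i}e_i$, $d_i\in\mathbb Z$, and $v=\sum_{i,j} e_{ij}\otimes v_{ij}$, the conjugate representation $(\overline{\mathcal H},\overline V,\overline v_\zeta)$ on the conjugate Hilbert space is given in the basis $(\overline{e_1},\dots,\overline{e_n})$ by the matrix $\overline v_\zeta=(\zeta^{d_i(d_j-d_i)}v_{ij}^*)_{i,j}$. Two representations $(\mathcal H,V,v)$ and $(\mathcal H',V',v')$ are equivalent if $v'=(T\otimes 1)v(T^{-1}\otimes 1)$ for some invertible linear $T\colon\mathcal H\to\mathcal H'$. For $\underline d=(d_1,\dots,d_n)\in\mathbb Z^n$, a matrix $F=(F_{ij})\in \mathrm{GL}(n,\mathbb C)$ with inverse $(F^{ij})$ is called admissible with respect to $\underline d$ if there are $(d_1',\dots,d_n')\in\mathbb Z^n$ and $\delta\in\mathbb Z$ such that $F_{ij}=0=F^{ji}$ whenever $-d_j+\delta\ne d_i'$. Then $\mathrm U_\zeta^+(F)$ denotes the braided compact quantum group whose algebra $\mathrm C(\mathrm U_\zeta^+(F))$ is the universal unital $\mathrm C^*$-algebra with generators $u_{ij}$,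 $1\le i,j\le n$, such that $u=(u_{ij})$ and $F\,\overline u_\zeta F^{-1}$ are unitary, where $\overline u_\zeta=(\zeta^{d_i(d_j-d_i)}u_{ij}^*)_{i,j}$, with $\rho_z(u_{ij})=z^{d_j-d_i}u_{ij}$ and $\Delta(u_{ij})=\sum_k j_1(u_{ik})j_2(u_{kj})$. **Theorem.** Let $G$ be a braided compact quantum group over $\mathbb T$ with parameter $\zeta$, let $(\mathcal H,V,v)$ be a finite-dimensional unitary representation of $G$, and let $(e_1,\dots,e_n)$ be an orthonormal basis of $\mathcal H$ with $V(z)e_i=z^{d_i}e_i$ for all $z\in\mathbb T$ and all $i$. Suppose that $(\overline{\mathcal H},\overline V,\overline v_\zeta)$ is equivalent to a unitary representation $(\mathcal H',V',v')$ of $G$. Then there is an $F\in\mathrm{GL}(n,\mathbb C)$, admissible with respect to $\underline d=(d_1,\dots,d_n)$, for which there is a unique unital $*$-homomorphism $\phi\colon \mathrm C(\mathrm U_\zeta^+(F))\to \mathrm C(G)$ that is $\mathbb T$-equivariant, satisfies $\Delta_G\circ\phi=(\phi\boxtimes_\zeta\phi)\circ\Delta_{\mathrm U_\zeta^+(F)}$,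 and sends $u$ to $v$, i.e. $\phi(u_{ij})=v_{ij}$ for all $i,j$. -/

import Mathlib

open scoped TensorProduct ComplexConjugate InnerProductSpace
open Topology

universe u v w

/-! ### C⋆-seminorms and their completions -/

/-- A C⋆-seminorm on a complex unital ⋆-algebra. -/
structure CStarSeminorm (D : Type u) [Ring D] [StarRing D] [Algebra ℂ D] extends
    Seminorm ℂ D where
  mul_le' : ∀ a b : D, toFun (a * b) ≤ toFun a * toFun b
  star_mul_self' : ∀ a : D, toFun (star a * a) = toFun a * toFun a

namespace CStarSeminorm

section
variable {D : Type u} [Ring D] [StarRing D] [Algebra ℂ D]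

instance : CoeFun (CStarSeminorm D) (fun _ => D → ℝ) := ⟨fun p => p.toFun⟩

theorem nonneg (p : CStarSeminorm D) (a : D) : 0 ≤ p a := apply_nonneg p.toSeminorm a

theorem add_le (p : CStarSeminorm D) (a b : D) : p (a + b) ≤ p a + p b :=
  map_add_le_add p.toSeminorm a b

theorem smul_eq (p : CStarSeminorm D) (c : ℂ) (a : D) : p (c • a) = ‖c‖ * p a :=
  map_smul_eq_mul p.toSeminorm c a

theorem mul_le (p : CStarSeminorm D) (a b : D) : p (a * b) ≤ p a * p b := p.mul_le' a b

theorem star_mul_self (p : CStarSeminorm D) (a : D) : p (star a * a) = p a * p a :=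
  p.star_mul_self' a

theorem le_star (p : CStarSeminorm D) (a : D) : p a ≤ p (star a) := by
  have h := p.mul_le (star a) a
  rw [p.star_mul_self] at h
  rcases (p.nonneg a).eq_or_lt with h0 | h0
  · rw [← h0]; exact p.nonneg _
  · exact le_of_mul_le_mul_right h h0

theorem star_eq (p : CStarSeminorm D) (a : D) : p (star a) = p a :=
  le_antisymm (by simpa using p.le_star (star a)) (p.le_star a)

theorem one_le (p : CStarSeminorm D) : p 1 ≤ 1 := by
  have h := p.star_mul_self 1
  simp only [star_one, mul_one] at h
  by_contra hc
  push Not at hc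
  nlinarith

/-- The supremum of a pointwise bounded family of C⋆-seminorms. -/
noncomputable def sup {ι : Type w} (p : ι → CStarSeminorm D)
    (hb : ∀ a, BddAbove (Set.range fun i => p i a)) : CStarSeminorm D where
  toFun a := ⨆ i, p i a
  map_zero' := by
    have : ∀ i, p i 0 = 0 := fun i => map_zero (p i).toSeminorm
    simp [this]
  add_le' a b := by
    refine Real.iSup_le (fun i => ((p i).add_le a b).trans ?_) ?_
    · exact add_le_add (le_ciSup (hb a) i) (le_ciSup (hb b) i)
    · exact add_nonneg (Real.iSup_nonneg fun i => (p i).nonneg a)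
        (Real.iSup_nonneg fun i => (p i).nonneg b)
  neg' a := by
    have : ∀ i, p i (-a) = p i a := fun i => map_neg_eq_map (p i).toSeminorm a
    simp [this]
  smul' c a := by
    have : ∀ i, p i (c • a) = ‖c‖ * p i a := fun i => (p i).smul_eq c a
    simp only [this]
    exact (Real.mul_iSup_of_nonneg (norm_nonneg c) _).symm
  mul_le' a b := by
    refine Real.iSup_le (fun i => ((p i).mul_le a b).trans ?_) ?_
    · exact mul_le_mul (le_ciSup (hb a) i) (le_ciSup (hb b) i) ((p i).nonneg b)
        (Real.iSup_nonneg fun i => (p i).nonneg a)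
    · exact mul_nonneg (Real.iSup_nonneg fun i => (p i).nonneg a)
        (Real.iSup_nonneg fun i => (p i).nonneg b)
  star_mul_self' a := by
    have h0 : 0 ≤ ⨆ i, p i a := Real.iSup_nonneg fun i => (p i).nonneg a
    refine le_antisymm (Real.iSup_le (fun i => ?_) (mul_nonneg h0 h0)) ?_
    · rw [(p i).star_mul_self]
      exact mul_le_mul (le_ciSup (hb a) i) (le_ciSup (hb a) i) ((p i).nonneg a) h0
    · have hs : 0 ≤ ⨆ i, p i (star a * a) := Real.iSup_nonneg fun i => (p i).nonneg _
      rw [← pow_two, ← Real.le_sqrt h0 hs]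
      refine Real.iSup_le (fun i => ?_) (Real.sqrt_nonneg _)
      rw [Real.le_sqrt ((p i).nonneg a) hs, pow_two, ← (p i).star_mul_self]
      exact le_ciSup (hb (star a * a)) i

theorem le_sup {ι : Type w} (p : ι → CStarSeminorm D)
    (hb : ∀ a, BddAbove (Set.range fun i => p i a)) (i : ι) (a : D) : p i a ≤ sup p hb a :=
  le_ciSup (hb a) i

theorem sup_le {ι : Type w} (p : ι → CStarSeminorm D)
    (hb : ∀ a, BddAbove (Set.range fun i => p i a)) (a : D) (r : ℝ) (hr : 0 ≤ r)
    (h : ∀ i, p i a ≤ r) : sup p hb a ≤ r :=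
  Real.iSup_le h hr

/-- The C⋆-seminorm induced by a ⋆-homomorphism to a C⋆-algebra. -/
noncomputable def ofHom {B : Type v} [CStarAlgebra B] (f : D →⋆ₐ[ℂ] B) : CStarSeminorm D where
  toFun a := ‖f a‖
  map_zero' := by simp
  add_le' a b := by simpa using norm_add_le (f a) (f b)
  neg' a := by simp
  smul' c a := by simp [norm_smul]
  mul_le' a b := by simpa using norm_mul_le (f a) (f b)
  star_mul_self' a := by simp [map_star, CStarRing.norm_star_mul_self]

/-- A ⋆-algebra regarded as a seminormed algebra through a C⋆-seminorm. -/
def Pre (_p : CStarSeminorm D) : Type u := D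

variable (p : CStarSeminorm D)

noncomputable instance : SeminormedRing p.Pre :=
  { p.toSeminorm.toAddGroupSeminorm.toSeminormedAddCommGroup, (inferInstance : Ring D) with
    norm_mul_le := fun a b => p.mul_le a b }

noncomputable instance : StarRing p.Pre where
  star := (star : D → D)
  star_involutive := star_involutive (R := D)
  star_mul := star_mul (R := D)
  star_add := star_add (R := D)

/-- The identity map, as a ring isomorphism. -/
noncomputable def toPre : D ≃+* p.Pre where
  toFun a := a
  invFun a := a
  left_inv _ := rfl
  right_inv _ := rfl
  map_mul' _ _ := rfl
  map_add' _ _ := rfl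

noncomputable instance : NormedAlgebra ℂ p.Pre where
  toAlgebra := RingHom.toAlgebra' ((p.toPre : D →+* p.Pre).comp (algebraMap ℂ D))
    (fun c x => Algebra.commutes (A := D) c x)
  norm_smul_le c a := by
    have h := (p.smul_eq c (p.toPre.symm a)).le
    rw [Algebra.smul_def] at h
    exact h

theorem norm_toPre (a : D) : ‖p.toPre a‖ = p a := rfl

theorem toPre_star (a : D) : p.toPre (star a) = star (p.toPre a) := rfl

theorem toPre_algebraMap (c : ℂ) : p.toPre (algebraMap ℂ D c) = algebraMap ℂ p.Pre c := rfl

instance : NormedStarGroup p.Pre where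
  norm_star_le a := (p.star_eq a).le

instance [StarModule ℂ D] : StarModule ℂ p.Pre where
  star_smul c a := by
    have h : ∀ (c : ℂ) (a : p.Pre), c • a = p.toPre (c • p.toPre.symm a) := fun c a => by
      rw [Algebra.smul_def, Algebra.smul_def, map_mul]; rfl
    rw [h, h, ← toPre_star, star_smul]; rfl

/-- The C⋆-algebra obtained from a ⋆-algebra with a C⋆-seminorm by separation and completion. -/
def Completion : Type u := UniformSpace.Completion p.Pre

noncomputable instance : NormedRing p.Completion :=
  inferInstanceAs (NormedRing (UniformSpace.Completion p.Pre))
instance : CompleteSpace p.Completion :=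
  inferInstanceAs (CompleteSpace (UniformSpace.Completion p.Pre))
noncomputable instance : Algebra ℂ p.Completion :=
  inferInstanceAs (Algebra ℂ (UniformSpace.Completion p.Pre))

noncomputable instance : Star p.Completion where
  star := UniformSpace.Completion.map (star : p.Pre → p.Pre)

theorem uniformContinuous_star_pre : UniformContinuous (star : p.Pre → p.Pre) :=
  (isometry_iff_dist_eq.2 fun a b => by
    rw [dist_eq_norm, dist_eq_norm, ← star_sub, norm_star]).uniformContinuous

/-- The canonical map from the ⋆-algebra to its completion. -/
noncomputable def toComp (a : D) : p.Completion := ((p.toPre a : p.Pre) : UniformSpace.Completion p.Pre)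

theorem norm_toComp (a : D) : ‖p.toComp a‖ = p a := UniformSpace.Completion.norm_coe _

theorem star_toComp (a : D) : star (p.toComp a) = p.toComp (star a) :=
  UniformSpace.Completion.map_coe p.uniformContinuous_star_pre _

theorem continuous_star_completion : Continuous (star : p.Completion → p.Completion) :=
  UniformSpace.Completion.continuous_map

theorem toComp_add (a b : D) : p.toComp (a + b) = p.toComp a + p.toComp b := by
  simp only [toComp, map_add]; exact UniformSpace.Completion.coe_add _ _

theorem toComp_mul (a b : D) : p.toComp (a * b) = p.toComp a * p.toComp b := by
  simp only [toComp, map_mul]; exact UniformSpace.Completion.coe_mul _ _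

theorem denseRange_toComp : DenseRange p.toComp :=
  UniformSpace.Completion.denseRange_coe.comp p.toPre.surjective.denseRange
    (UniformSpace.Completion.continuous_coe _)

theorem toComp_algebraMap (c : ℂ) : p.toComp (algebraMap ℂ D c) = algebraMap ℂ p.Completion c := rfl

theorem completion_induction {P : p.Completion → Prop} (x : p.Completion)
    (hc : IsClosed {x | P x}) (h : ∀ a, P (p.toComp a)) : P x :=
  p.denseRange_toComp.induction_on x hc h

theorem completion_induction₂ {P : p.Completion → p.Completion → Prop} (x y : p.Completion)
    (hc : IsClosed {x : p.Completion × p.Completion | P x.1 x.2})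
    (h : ∀ a b, P (p.toComp a) (p.toComp b)) : P x y :=
  p.denseRange_toComp.induction_on₂ hc h x y

instance : ContinuousStar p.Completion := ⟨p.continuous_star_completion⟩

noncomputable instance : StarRing p.Completion where
  star_involutive x := by
    refine p.completion_induction (P := fun x => star (star x) = x) x
      (isClosed_eq (by fun_prop) (by fun_prop)) fun a => ?_
    rw [star_toComp, star_toComp, star_star]
  star_mul x y := by
    refine p.completion_induction₂ (P := fun x y => star (x * y) = star y * star x) x y
      (isClosed_eq (by fun_prop) (by fun_prop)) fun a b => ?_
    rw [← toComp_mul, star_toComp, star_toComp, star_toComp, star_mul, toComp_mul]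
  star_add x y := by
    refine p.completion_induction₂ (P := fun x y => star (x + y) = star x + star y) x y
      (isClosed_eq (by fun_prop) (by fun_prop)) fun a b => ?_
    rw [← toComp_add, star_toComp, star_toComp, star_toComp, star_add, toComp_add]

noncomputable instance [StarModule ℂ D] : CStarAlgebra p.Completion where
  norm_mul_self_le x := by
    refine p.completion_induction (P := fun x => ‖x‖ * ‖x‖ ≤ ‖star x * x‖) x
      (isClosed_le (by fun_prop) (by fun_prop)) fun a => ?_
    rw [star_toComp, ← toComp_mul, norm_toComp, norm_toComp, p.star_mul_self]
  norm_smul_le c x := by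
    simp_rw [Algebra.smul_def]
    refine p.completion_induction
      (P := fun x => ‖algebraMap ℂ p.Completion c * x‖ ≤ ‖c‖ * ‖x‖) x
      (isClosed_le (by fun_prop) (by fun_prop)) fun a => ?_
    rw [← toComp_algebraMap, ← toComp_mul, ← Algebra.smul_def, norm_toComp, norm_toComp,
        p.smul_eq]
  star_smul c x := by
    simp_rw [Algebra.smul_def]
    refine p.completion_induction (P := fun x => star (algebraMap ℂ p.Completion c * x)
      = algebraMap ℂ p.Completion (star c) * star x) x
      (isClosed_eq (by fun_prop) (by fun_prop)) fun a => ?_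
    rw [← toComp_algebraMap, star_toComp, ← toComp_algebraMap, ← toComp_mul,
        ← toComp_mul, star_toComp, ← Algebra.smul_def, ← Algebra.smul_def, star_smul]

/-- The canonical ⋆-homomorphism from the ⋆-algebra to its completion. -/
noncomputable def toCompHom : D →⋆ₐ[ℂ] p.Completion where
  toFun := p.toComp
  map_one' := rfl
  map_mul' := p.toComp_mul
  map_zero' := rfl
  map_add' := p.toComp_add
  commutes' _ := rfl
  map_star' a := (p.star_toComp a).symm

theorem toCompHom_apply (a : D) : p.toCompHom a = p.toComp a := rfl

end
end CStarSeminorm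

/-- A ⋆-homomorphism defined on a ⋆-algebra with dense image in a C⋆-algebra `B` and bounded by the
norm of `B` extends to `B`. -/
theorem exists_extend_starAlgHom {D : Type*} [Ring D] [StarRing D] [Algebra ℂ D]
    {B : Type*} [CStarAlgebra B] {Z : Type*} [CStarAlgebra Z] (e : D →⋆ₐ[ℂ] B)
    (he : DenseRange e) (f : D →⋆ₐ[ℂ] Z) (hf : ∀ a, ‖f a‖ ≤ ‖e a‖) :
    ∃ g : B →⋆ₐ[ℂ] Z, ∀ a, g (e a) = f a := by
  let e' : D →ₗ[ℂ] B := e.toAlgHom.toLinearMap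
  let f' : D →ₗ[ℂ] Z := f.toAlgHom.toLinearMap
  have he' : DenseRange e' := he
  have hb : ∃ C, ∀ x, ‖f' x‖ ≤ C * ‖e' x‖ := ⟨1, fun x => by simpa [e', f'] using hf x⟩
  let g := f'.extendOfNorm e'
  have hg : ∀ a, g (e a) = f a := fun a => f'.extendOfNorm_eq he' hb a
  have hgc : Continuous g := g.continuous
  refine ⟨{ toFun := g, map_one' := ?_, map_mul' := ?_, map_zero' := map_zero g,
            map_add' := map_add g, commutes' := ?_, map_star' := ?_ }, hg⟩
  · rw [← map_one e, hg, map_one]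
  · intro x y
    refine he.induction_on₂ (p := fun x y => g (x * y) = g x * g y) (isClosed_eq (by fun_prop)
      (by fun_prop)) (fun a b => ?_) x y
    rw [← map_mul, hg, hg, hg, map_mul]
  · intro c
    change g (algebraMap ℂ B c) = _
    rw [← AlgHomClass.commutes e, hg, AlgHomClass.commutes]
  · intro x
    refine he.induction_on (p := fun x => g (star x) = star (g x)) x (isClosed_eq (by fun_prop)
      (by fun_prop)) (fun a => ?_)
    rw [← map_star, hg, hg, map_star]

theorem starAlgHom_continuous {B : Type*} [CStarAlgebra B] {Z : Type*} [CStarAlgebra Z]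
    (g : B →⋆ₐ[ℂ] Z) : Continuous g :=
  AddMonoidHomClass.continuous_of_bound g 1 fun x => by
    simpa using NonUnitalStarAlgHom.norm_apply_le g x

theorem starAlgHom_ext_of_dense {D : Type*} {B : Type*} [CStarAlgebra B] {Z : Type*}
    [CStarAlgebra Z] {e : D → B} (he : DenseRange e) {g h : B →⋆ₐ[ℂ] Z}
    (hgh : ∀ a, g (e a) = h (e a)) : g = h := by
  refine DFunLike.coe_injective (he.equalizer (starAlgHom_continuous g) (starAlgHom_continuous h) ?_)
  funext a; exact hgh a

namespace CStarSeminorm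
variable {D : Type u} [Ring D] [StarRing D] [Algebra ℂ D] [StarModule ℂ D] (p : CStarSeminorm D)

/-- Extension of a ⋆-homomorphism that is bounded by the C⋆-seminorm to the completion. -/
noncomputable def lift {Z : Type v} [CStarAlgebra Z] (f : D →⋆ₐ[ℂ] Z) (hf : ∀ a, ‖f a‖ ≤ p a) :
    p.Completion →⋆ₐ[ℂ] Z :=
  (exists_extend_starAlgHom p.toCompHom p.denseRange_toComp f
    (fun a => (hf a).trans (p.norm_toComp a).ge)).choose

theorem lift_toComp {Z : Type v} [CStarAlgebra Z] (f : D →⋆ₐ[ℂ] Z) (hf : ∀ a, ‖f a‖ ≤ p a) (a : D) :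
    p.lift f hf (p.toComp a) = f a :=
  (exists_extend_starAlgHom p.toCompHom p.denseRange_toComp f
    (fun a => (hf a).trans (p.norm_toComp a).ge)).choose_spec a

theorem hom_ext {Z : Type v} [CStarAlgebra Z] {g h : p.Completion →⋆ₐ[ℂ] Z}
    (hgh : ∀ a, g (p.toComp a) = h (p.toComp a)) : g = h :=
  starAlgHom_ext_of_dense p.denseRange_toComp hgh

end CStarSeminorm

/-! ### The minimal (spatial) tensor product of C⋆-algebras -/

/-- The algebraic tensor product of two Hilbert spaces with its Hilbert space norm. -/
def HilbTensor (H : Type u) (K : Type v) [NormedAddCommGroup H] [InnerProductSpace ℂ H]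
    [NormedAddCommGroup K] [InnerProductSpace ℂ K] : Type (max u v) := H ⊗[ℂ] K

namespace HilbTensor
variable {H : Type u} {K : Type v} [NormedAddCommGroup H] [InnerProductSpace ℂ H]
    [NormedAddCommGroup K] [InnerProductSpace ℂ K]

noncomputable instance : NormedAddCommGroup (HilbTensor H K) :=
  inferInstanceAs (NormedAddCommGroup (H ⊗[ℂ] K))
noncomputable instance : InnerProductSpace ℂ (HilbTensor H K) :=
  inferInstanceAs (InnerProductSpace ℂ (H ⊗[ℂ] K))

/-- The elementary tensor of two vectors. -/
def tmul (h : H) (k : K) : HilbTensor H K := h ⊗ₜ[ℂ] k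

theorem inner_tmul (h h' : H) (k k' : K) :
    ⟪tmul h k, tmul h' k'⟫_ℂ = ⟪h, h'⟫_ℂ * ⟪k, k'⟫_ℂ := rfl

theorem induction {P : HilbTensor H K → Prop} (ξ : HilbTensor H K) (h0 : P 0)
    (ht : ∀ h k, P (tmul h k)) (ha : ∀ a b, P a → P b → P (a + b)) : P ξ :=
  TensorProduct.induction_on (motive := P) ξ h0 ht ha

/-- The operator `S ⊗ T`. -/
noncomputable def map (S : H →L[ℂ] H) (T : K →L[ℂ] K) : HilbTensor H K →L[ℂ] HilbTensor H K :=
  (TensorProduct.mapL S T : H ⊗[ℂ] K →L[ℂ] H ⊗[ℂ] K)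

theorem map_tmul (S : H →L[ℂ] H) (T : K →L[ℂ] K) (h : H) (k : K) :
    map S T (tmul h k) = tmul (S h) (T k) := rfl

theorem norm_map_le (S : H →L[ℂ] H) (T : K →L[ℂ] K) : ‖map S T‖ ≤ ‖S‖ * ‖T‖ :=
  TensorProduct.norm_mapL_le S T

theorem ext_op {A B : HilbTensor H K →L[ℂ] HilbTensor H K}
    (h : ∀ x y, A (tmul x y) = B (tmul x y)) : A = B := by
  ext ξ
  refine induction (P := fun ξ => A ξ = B ξ) ξ (by simp) h fun a b ha hb => by rw [map_add, map_add, ha, hb]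

theorem tmul_add (h : H) (k k' : K) : tmul h (k + k') = tmul h k + tmul h k' :=
  TensorProduct.tmul_add h k k'

theorem add_tmul (h h' : H) (k : K) : tmul (h + h') k = tmul h k + tmul h' k :=
  TensorProduct.add_tmul h h' k

theorem tmul_smul (c : ℂ) (h : H) (k : K) : tmul h (c • k) = c • tmul h k :=
  TensorProduct.tmul_smul c h k

theorem smul_tmul (c : ℂ) (h : H) (k : K) : tmul (c • h) k = c • tmul h k := rfl

theorem tmul_zero (h : H) : tmul h (0 : K) = 0 := TensorProduct.tmul_zero K h

theorem zero_tmul (k : K) : tmul (0 : H) k = 0 := TensorProduct.zero_tmul H k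

end HilbTensor

/-- The C⋆-seminorm of a ⋆-representation by bounded operators on an inner product space. -/
noncomputable def CStarSeminorm.ofRep {D : Type u} [Ring D] [StarRing D] [Algebra ℂ D]
    {E : Type v} [NormedAddCommGroup E] [InnerProductSpace ℂ E] (f : D →ₐ[ℂ] (E →L[ℂ] E))
    (hf : ∀ t ξ η, ⟪f t ξ, η⟫_ℂ = ⟪ξ, f (star t) η⟫_ℂ) : CStarSeminorm D where
  toFun t := ‖f t‖
  map_zero' := by simp
  add_le' a b := by simpa using norm_add_le (f a) (f b)
  neg' a := by simp
  smul' c a := by simp [norm_smul]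
  mul_le' a b := by simpa using norm_mul_le (f a) (f b)
  star_mul_self' t := by
    have key : ∀ t, ‖f t‖ * ‖f t‖ ≤ ‖f (star t * t)‖ := fun t => by
      rw [← pow_two, ← Real.le_sqrt (norm_nonneg _) (norm_nonneg _)]
      refine ContinuousLinearMap.opNorm_le_bound _ (Real.sqrt_nonneg _) fun ξ => ?_
      rw [← abs_of_nonneg (norm_nonneg ξ), ← Real.sqrt_sq_eq_abs,
        ← Real.sqrt_mul (norm_nonneg _)]
      refine Real.le_sqrt_of_sq_le ?_
      have h1 : ‖f t ξ‖ ^ 2 = RCLike.re ⟪ξ, f (star t * t) ξ⟫_ℂ := by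
        rw [map_mul, mul_apply_eq_comp, ← hf, inner_self_eq_norm_sq]
      rw [h1]
      calc RCLike.re ⟪ξ, f (star t * t) ξ⟫_ℂ ≤ ‖⟪ξ, f (star t * t) ξ⟫_ℂ‖ :=
            RCLike.re_le_norm _
        _ ≤ ‖ξ‖ * ‖f (star t * t) ξ‖ := norm_inner_le_norm _ _
        _ ≤ ‖ξ‖ * (‖f (star t * t)‖ * ‖ξ‖) := by
            gcongr; exact ContinuousLinearMap.le_opNorm _ _
        _ = ‖f (star t * t)‖ * ‖ξ‖ ^ 2 := by ring
    have hle : ∀ t, ‖f t‖ ≤ ‖f (star t)‖ := fun t => by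
      have h : ‖f t‖ * ‖f t‖ ≤ ‖f (star t)‖ * ‖f t‖ :=
        (key t).trans (by rw [map_mul]; exact norm_mul_le _ _)
      rcases (norm_nonneg (f t)).eq_or_lt with h0 | h0
      · rw [← h0]; exact norm_nonneg _
      · exact le_of_mul_le_mul_right h h0
    refine le_antisymm ?_ (key t)
    rw [map_mul]
    refine (norm_mul_le _ _).trans ?_
    gcongr
    simpa using hle (star t)

/-- A pair of unital ⋆-representations of `X` and `Y` on Hilbert spaces `H` and `K`. -/
structure RepPair (X : Type u) (Y : Type v) [CStarAlgebra X] [CStarAlgebra Y] where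
  H : Type u
  K : Type v
  [normH : NormedAddCommGroup H]
  [innerH : InnerProductSpace ℂ H]
  [completeH : CompleteSpace H]
  [normK : NormedAddCommGroup K]
  [innerK : InnerProductSpace ℂ K]
  [completeK : CompleteSpace K]
  left : X →⋆ₐ[ℂ] (H →L[ℂ] H)
  right : Y →⋆ₐ[ℂ] (K →L[ℂ] K)

attribute [instance] RepPair.normH RepPair.innerH RepPair.completeH RepPair.normK RepPair.innerK
  RepPair.completeK

namespace RepPair
variable {X X' : Type u} {Y Y' : Type v} [CStarAlgebra X] [CStarAlgebra Y] [CStarAlgebra X']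
  [CStarAlgebra Y']

/-- The representation `x ↦ π(x) ⊗ 1`. -/
noncomputable def leftHom (r : RepPair X Y) :
    X →ₐ[ℂ] (HilbTensor r.H r.K →L[ℂ] HilbTensor r.H r.K) where
  toFun x := HilbTensor.map (r.left x) 1
  map_one' := HilbTensor.ext_op fun h k => by simp [HilbTensor.map_tmul]
  map_mul' x y := HilbTensor.ext_op fun h k => by simp [HilbTensor.map_tmul]
  map_zero' := HilbTensor.ext_op fun h k => by simp [HilbTensor.map_tmul, HilbTensor.zero_tmul]
  map_add' x y := HilbTensor.ext_op fun h k => by simp [HilbTensor.map_tmul, HilbTensor.add_tmul]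
  commutes' c := HilbTensor.ext_op fun h k => by
    simp [HilbTensor.map_tmul, HilbTensor.smul_tmul, Algebra.algebraMap_eq_smul_one]

/-- The representation `y ↦ 1 ⊗ σ(y)`. -/
noncomputable def rightHom (r : RepPair X Y) :
    Y →ₐ[ℂ] (HilbTensor r.H r.K →L[ℂ] HilbTensor r.H r.K) where
  toFun y := HilbTensor.map 1 (r.right y)
  map_one' := HilbTensor.ext_op fun h k => by simp [HilbTensor.map_tmul]
  map_mul' x y := HilbTensor.ext_op fun h k => by simp [HilbTensor.map_tmul]
  map_zero' := HilbTensor.ext_op fun h k => by simp [HilbTensor.map_tmul, HilbTensor.tmul_zero]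
  map_add' x y := HilbTensor.ext_op fun h k => by simp [HilbTensor.map_tmul, HilbTensor.tmul_add]
  commutes' c := HilbTensor.ext_op fun h k => by
    simp [HilbTensor.map_tmul, HilbTensor.tmul_smul, Algebra.algebraMap_eq_smul_one]

theorem commute_left_right (r : RepPair X Y) (x : X) (y : Y) :
    Commute (r.leftHom x) (r.rightHom y) :=
  HilbTensor.ext_op fun h k => by simp [leftHom, rightHom, HilbTensor.map_tmul]

/-- The representation `x ⊗ y ↦ π(x) ⊗ σ(y)` of the algebraic tensor product. -/
noncomputable def toHom (r : RepPair X Y) :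
    X ⊗[ℂ] Y →ₐ[ℂ] (HilbTensor r.H r.K →L[ℂ] HilbTensor r.H r.K) :=
  Algebra.TensorProduct.lift r.leftHom r.rightHom r.commute_left_right

theorem toHom_tmul (r : RepPair X Y) (x : X) (y : Y) :
    r.toHom (x ⊗ₜ y) = HilbTensor.map (r.left x) (r.right y) := by
  rw [toHom, Algebra.TensorProduct.lift_tmul]
  exact HilbTensor.ext_op fun h k => by simp [leftHom, rightHom, HilbTensor.map_tmul]

theorem inner_toHom (r : RepPair X Y) (t : X ⊗[ℂ] Y) (ξ η : HilbTensor r.H r.K) :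
    ⟪r.toHom t ξ, η⟫_ℂ = ⟪ξ, r.toHom (star t) η⟫_ℂ := by
  induction t with
  | zero => simp
  | add a b ha hb => rw [star_add, map_add, map_add, add_apply, add_apply, inner_add_left, inner_add_right, ha, hb]
  | tmul x y =>
    rw [TensorProduct.star_tmul, toHom_tmul, toHom_tmul]
    refine HilbTensor.induction (P := fun ξ => ⟪HilbTensor.map _ _ ξ, η⟫_ℂ = ⟪ξ, _⟫_ℂ) ξ (by simp) (fun h k => ?_)
      fun a b ha hb => by simp only [map_add, inner_add_left, ha, hb]
    refine HilbTensor.induction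
      (P := fun η => ⟪_, η⟫_ℂ = ⟪HilbTensor.tmul h k, HilbTensor.map _ _ η⟫_ℂ) η (by simp) (fun h' k' => ?_)
      fun a b ha hb => by simp only [map_add, inner_add_right, ha, hb]
    simp only [HilbTensor.map_tmul, HilbTensor.inner_tmul, map_star,
          ContinuousLinearMap.star_eq_adjoint, ContinuousLinearMap.adjoint_inner_right]

/-- The C⋆-seminorm of the operator norm in the representation `π ⊗ σ`. -/
noncomputable def seminorm (r : RepPair X Y) : CStarSeminorm (X ⊗[ℂ] Y) :=
  CStarSeminorm.ofRep r.toHom r.inner_toHom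

/-- Pull back along a pair of ⋆-homomorphisms. -/
noncomputable def comap (r : RepPair X' Y') (f : X →⋆ₐ[ℂ] X') (g : Y →⋆ₐ[ℂ] Y') : RepPair X Y where
  H := r.H
  K := r.K
  left := r.left.comp f
  right := r.right.comp g

theorem comap_toHom (r : RepPair X' Y') (f : X →⋆ₐ[ℂ] X') (g : Y →⋆ₐ[ℂ] Y') (t : X ⊗[ℂ] Y) :
    (r.comap f g).toHom t = r.toHom (Algebra.TensorProduct.map f.toAlgHom g.toAlgHom t) := by
  induction t with
  | zero => rw [map_zero, map_zero, map_zero]; rfl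
  | add a b ha hb => rw [map_add, map_add, map_add, ha, hb]; rfl
  | tmul x y =>
    rw [Algebra.TensorProduct.map_tmul]
    exact (toHom_tmul (r.comap f g) x y).trans (toHom_tmul r (f x) (g y)).symm

theorem norm_toHom_tmul_le (r : RepPair X Y) (x : X) (y : Y) :
    ‖r.toHom (x ⊗ₜ y)‖ ≤ ‖x‖ * ‖y‖ := by
  rw [toHom_tmul]
  refine (HilbTensor.norm_map_le _ _).trans ?_
  gcongr
  · exact NonUnitalStarAlgHom.norm_apply_le r.left x
  · exact NonUnitalStarAlgHom.norm_apply_le r.right y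

end RepPair

section MinTensor
variable {X X' X'' : Type u} {Y Y' Y'' : Type v} [CStarAlgebra X] [CStarAlgebra Y] [CStarAlgebra X']
  [CStarAlgebra Y'] [CStarAlgebra X''] [CStarAlgebra Y'']

theorem bddAbove_spatial (t : X ⊗[ℂ] Y) :
    BddAbove (Set.range fun r : RepPair X Y => r.seminorm t) := by
  induction t with
  | zero =>
    refine ⟨0, ?_⟩
    rintro _ ⟨r, rfl⟩
    exact (map_zero r.seminorm.toSeminorm).le
  | add a b ha hb =>
    obtain ⟨A, hA⟩ := ha
    obtain ⟨B, hB⟩ := hb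
    refine ⟨A + B, ?_⟩
    rintro _ ⟨r, rfl⟩
    exact (r.seminorm.add_le a b).trans (add_le_add (hA ⟨r, rfl⟩) (hB ⟨r, rfl⟩))
  | tmul x y =>
    refine ⟨‖x‖ * ‖y‖, ?_⟩
    rintro _ ⟨r, rfl⟩
    exact r.norm_toHom_tmul_le x y

variable (X Y) in
/-- The minimal C⋆-norm on the algebraic tensor product: the supremum of `‖(π ⊗ σ)(t)‖` over all
pairs of ⋆-representations on Hilbert spaces. -/
noncomputable def spatialNorm : CStarSeminorm (X ⊗[ℂ] Y) :=
  CStarSeminorm.sup (fun r : RepPair X Y => r.seminorm) bddAbove_spatial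

variable (X Y) in
/-- The minimal tensor product of two unital C⋆-algebras. -/
abbrev MinTensor : Type (max u v) := (spatialNorm X Y).Completion

namespace MinTensor

/-- The elementary tensor `x ⊗ y` in the minimal tensor product. -/
noncomputable def tmul (x : X) (y : Y) : MinTensor X Y := (spatialNorm X Y).toComp (x ⊗ₜ y)

/-- The embedding `x ↦ x ⊗ 1`. -/
noncomputable def inl : X →⋆ₐ[ℂ] MinTensor X Y where
  toFun x := tmul x 1
  map_one' := rfl
  map_mul' x y := by
    rw [tmul, tmul, tmul, ← CStarSeminorm.toComp_mul, Algebra.TensorProduct.tmul_mul_tmul, mul_one]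
  map_zero' := by rw [tmul, TensorProduct.zero_tmul]; rfl
  map_add' x y := by rw [tmul, tmul, tmul, ← CStarSeminorm.toComp_add, TensorProduct.add_tmul]
  commutes' c := rfl
  map_star' x := by rw [tmul, tmul, CStarSeminorm.star_toComp, TensorProduct.star_tmul, star_one]

/-- The embedding `y ↦ 1 ⊗ y`. -/
noncomputable def inr : Y →⋆ₐ[ℂ] MinTensor X Y where
  toFun y := tmul 1 y
  map_one' := rfl
  map_mul' x y := by
    rw [tmul, tmul, tmul, ← CStarSeminorm.toComp_mul, Algebra.TensorProduct.tmul_mul_tmul, mul_one]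
  map_zero' := by rw [tmul, TensorProduct.tmul_zero]; rfl
  map_add' x y := by rw [tmul, tmul, tmul, ← CStarSeminorm.toComp_add, TensorProduct.tmul_add]
  commutes' c := by
    rw [tmul, ← CStarSeminorm.toComp_algebraMap]
    congr 1
    rw [Algebra.TensorProduct.algebraMap_apply, Algebra.algebraMap_eq_smul_one,
      Algebra.algebraMap_eq_smul_one, TensorProduct.tmul_smul, TensorProduct.smul_tmul']
  map_star' x := by rw [tmul, tmul, CStarSeminorm.star_toComp, TensorProduct.star_tmul, star_one]

theorem inl_mul_inr (x : X) (y : Y) : (inl x : MinTensor X Y) * inr y = tmul x y := by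
  change tmul x 1 * tmul 1 y = _
  rw [tmul, tmul, tmul, ← CStarSeminorm.toComp_mul, Algebra.TensorProduct.tmul_mul_tmul, mul_one,
    one_mul]

theorem inr_mul_inl (x : X) (y : Y) : (inr y : MinTensor X Y) * inl x = tmul x y := by
  change tmul 1 y * tmul x 1 = _
  rw [tmul, tmul, tmul, ← CStarSeminorm.toComp_mul, Algebra.TensorProduct.tmul_mul_tmul, mul_one,
    one_mul]

theorem commute_inl_inr (x : X) (y : Y) : Commute (inl x : MinTensor X Y) (inr y) :=
  (inl_mul_inr x y).trans (inr_mul_inl x y).symm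

theorem hom_ext {Z : Type w} [CStarAlgebra Z] {f g : MinTensor X Y →⋆ₐ[ℂ] Z}
    (hl : ∀ x, f (inl x) = g (inl x)) (hr : ∀ y, f (inr y) = g (inr y)) : f = g := by
  refine CStarSeminorm.hom_ext _ fun t => ?_
  induction t with
  | zero =>
    change f ((spatialNorm X Y).toCompHom 0) = g ((spatialNorm X Y).toCompHom 0)
    simp
  | add a b ha hb => rw [CStarSeminorm.toComp_add, map_add, map_add, ha, hb]
  | tmul x y =>
    change f (tmul x y) = g (tmul x y)
    rw [← inl_mul_inr, map_mul, map_mul, hl, hr]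

/-- The tensor product of two ⋆-homomorphisms, on the algebraic tensor product. -/
noncomputable def algMap (f : X →⋆ₐ[ℂ] X') (g : Y →⋆ₐ[ℂ] Y') : X ⊗[ℂ] Y →⋆ₐ[ℂ] X' ⊗[ℂ] Y' where
  toAlgHom := Algebra.TensorProduct.map f.toAlgHom g.toAlgHom
  map_star' t := by
    change Algebra.TensorProduct.map f.toAlgHom g.toAlgHom _
      = star (Algebra.TensorProduct.map f.toAlgHom g.toAlgHom _)
    induction t with
    | zero => simp
    | add a b ha hb => simp only [star_add, map_add, ha, hb]
    | tmul x y =>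
      rw [TensorProduct.star_tmul, Algebra.TensorProduct.map_tmul, Algebra.TensorProduct.map_tmul,
        TensorProduct.star_tmul]
      exact congrArg₂ _ (map_star f x) (map_star g y)

theorem algMap_le (f : X →⋆ₐ[ℂ] X') (g : Y →⋆ₐ[ℂ] Y') (t : X ⊗[ℂ] Y) :
    spatialNorm X' Y' (algMap f g t) ≤ spatialNorm X Y t := by
  refine CStarSeminorm.sup_le _ _ _ _ ((spatialNorm X Y).nonneg t) fun r => ?_
  refine le_trans (le_of_eq ?_)
    (CStarSeminorm.le_sup (fun r : RepPair X Y => r.seminorm) bddAbove_spatial (r.comap f g) t)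
  exact congrArg norm (r.comap_toHom f g t).symm

/-- The tensor product `f ⊗ g` of two ⋆-homomorphisms. -/
noncomputable def map (f : X →⋆ₐ[ℂ] X') (g : Y →⋆ₐ[ℂ] Y') :
    MinTensor X Y →⋆ₐ[ℂ] MinTensor X' Y' :=
  (spatialNorm X Y).lift ((spatialNorm X' Y').toCompHom.comp (algMap f g)) fun t =>
    ((spatialNorm X' Y').norm_toComp _).trans_le (algMap_le f g t)

theorem map_inl (f : X →⋆ₐ[ℂ] X') (g : Y →⋆ₐ[ℂ] Y') (x : X) : map f g (inl x) = inl (f x) := by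
  refine (CStarSeminorm.lift_toComp _ _ _ _).trans ?_
  change (spatialNorm X' Y').toComp (f x ⊗ₜ g 1) = (spatialNorm X' Y').toComp (f x ⊗ₜ 1)
  rw [map_one]

theorem map_inr (f : X →⋆ₐ[ℂ] X') (g : Y →⋆ₐ[ℂ] Y') (y : Y) : map f g (inr y) = inr (g y) := by
  refine (CStarSeminorm.lift_toComp _ _ _ _).trans ?_
  change (spatialNorm X' Y').toComp (f 1 ⊗ₜ g y) = (spatialNorm X' Y').toComp (1 ⊗ₜ g y)
  rw [map_one]

end MinTensor
end MinTensor

/-! ### Universal C⋆-algebras given by generators and relations -/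

/-- The free complex unital ⋆-algebra on a set of generators; the letter `(i, false)` is the
generator `i` and `(i, true)` is its adjoint. -/
def FreeStarAlg (I : Type u) : Type u := FreeAlgebra ℂ (I × Bool)

namespace FreeStarAlg
variable {I : Type u}

noncomputable instance : Ring (FreeStarAlg I) := inferInstanceAs (Ring (FreeAlgebra ℂ (I × Bool)))
noncomputable instance : Algebra ℂ (FreeStarAlg I) :=
  inferInstanceAs (Algebra ℂ (FreeAlgebra ℂ (I × Bool)))

/-- A letter. -/
noncomputable def letter (x : I × Bool) : FreeStarAlg I := FreeAlgebra.ι ℂ x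

/-- The generator `i`. -/
noncomputable def gen (i : I) : FreeStarAlg I := letter (i, false)

theorem induction {P : FreeStarAlg I → Prop} (a : FreeStarAlg I)
    (hs : ∀ c : ℂ, P (algebraMap ℂ _ c)) (hl : ∀ x, P (letter x))
    (hm : ∀ a b, P a → P b → P (a * b)) (ha : ∀ a b, P a → P b → P (a + b)) : P a :=
  FreeAlgebra.induction ℂ (I × Bool) (motive := P) hs hl hm ha a

/-- The opposite algebra with the conjugate scalar action. -/
def ConjOp (I : Type u) : Type u := (FreeStarAlg I)ᵐᵒᵖ

noncomputable instance : Ring (ConjOp I) := inferInstanceAs (Ring (FreeStarAlg I)ᵐᵒᵖ)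
noncomputable instance : Algebra ℂ (ConjOp I) :=
  RingHom.toAlgebra' ((algebraMap ℂ (FreeStarAlg I)ᵐᵒᵖ).comp (starRingEnd ℂ))
    fun c x => Algebra.commutes (A := (FreeStarAlg I)ᵐᵒᵖ) (starRingEnd ℂ c) x

/-- The involution, as an algebra homomorphism to the conjugate opposite algebra. -/
noncomputable def starHom : FreeStarAlg I →ₐ[ℂ] ConjOp I :=
  FreeAlgebra.lift ℂ (A := ConjOp I)
    fun x => (MulOpposite.op (letter (x.1, !x.2)) : (FreeStarAlg I)ᵐᵒᵖ)

/-- The involution. -/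
noncomputable def starFun (a : FreeStarAlg I) : FreeStarAlg I :=
  MulOpposite.unop (α := FreeStarAlg I) (starHom a)

theorem starFun_letter (x : I × Bool) : starFun (letter x) = letter (x.1, !x.2) :=
  congrArg (MulOpposite.unop (α := FreeStarAlg I)) (FreeAlgebra.lift_ι_apply (A := ConjOp I) _ x)

theorem starFun_mul (a b : FreeStarAlg I) : starFun (a * b) = starFun b * starFun a :=
  congrArg (MulOpposite.unop (α := FreeStarAlg I)) (map_mul starHom a b)

theorem starFun_add (a b : FreeStarAlg I) : starFun (a + b) = starFun a + starFun b :=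
  congrArg (MulOpposite.unop (α := FreeStarAlg I)) (map_add starHom a b)

theorem starFun_algebraMap (c : ℂ) :
    starFun (algebraMap ℂ (FreeStarAlg I) c) = algebraMap ℂ (FreeStarAlg I) (conj c) :=
  congrArg (MulOpposite.unop (α := FreeStarAlg I)) (starHom.commutes c)

noncomputable instance : StarRing (FreeStarAlg I) where
  star := starFun
  star_involutive a := by
    change starFun (starFun a) = a
    refine induction (P := fun a => starFun (starFun a) = a) a (fun c => ?_) (fun x => ?_)
      (fun a b ha hb => ?_) (fun a b ha hb => ?_)
    · rw [starFun_algebraMap, starFun_algebraMap, Complex.conj_conj]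
    · rw [starFun_letter, starFun_letter, Bool.not_not]
    · rw [starFun_mul, starFun_mul, ha, hb]
    · rw [starFun_add, starFun_add, ha, hb]
  star_mul := starFun_mul
  star_add := starFun_add

theorem star_letter (x : I × Bool) : star (letter x) = letter (x.1, !x.2) := starFun_letter x

theorem star_gen (i : I) : star (gen i) = letter (i, true) := starFun_letter (i, false)

theorem star_algebraMap (c : ℂ) :
    star (algebraMap ℂ (FreeStarAlg I) c) = algebraMap ℂ (FreeStarAlg I) (star c) :=
  starFun_algebraMap c

instance : StarModule ℂ (FreeStarAlg I) where
  star_smul c a := by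
    rw [Algebra.smul_def, star_mul, star_algebraMap, Algebra.smul_def, Algebra.commutes]

variable {B : Type v} [Ring B] [StarRing B] [Algebra ℂ B] [StarModule ℂ B]

/-- The value of a letter under an assignment of the generators. -/
def letterVal (f : I → B) (x : I × Bool) : B := if x.2 then star (f x.1) else f x.1

/-- The ⋆-homomorphism determined by the images of the generators. -/
noncomputable def lift (f : I → B) : FreeStarAlg I →⋆ₐ[ℂ] B where
  toAlgHom := (FreeAlgebra.lift ℂ (letterVal f) : FreeAlgebra ℂ (I × Bool) →ₐ[ℂ] B)
  map_star' a := by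
    let g : FreeStarAlg I →ₐ[ℂ] B :=
      (FreeAlgebra.lift ℂ (letterVal f) : FreeAlgebra ℂ (I × Bool) →ₐ[ℂ] B)
    have hg : ∀ x, g (letter x) = letterVal f x := fun x => FreeAlgebra.lift_ι_apply _ x
    change g (star a) = star (g a)
    refine induction (P := fun a => g (star a) = star (g a)) a (fun c => ?_) (fun x => ?_)
      (fun a b ha hb => ?_) (fun a b ha hb => ?_)
    · rw [star_algebraMap, g.commutes, g.commutes, algebraMap_star_comm]
    · rw [star_letter, hg, hg]
      rcases x with ⟨i, b⟩
      cases b <;> simp [letterVal]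
    · rw [star_mul, map_mul, map_mul, star_mul, ha, hb]
    · rw [star_add, map_add, map_add, star_add, ha, hb]

theorem lift_letter (f : I → B) (x : I × Bool) : lift f (letter x) = letterVal f x :=
  FreeAlgebra.lift_ι_apply (letterVal f) x

theorem lift_gen (f : I → B) (i : I) : lift f (gen i) = f i := lift_letter f (i, false)

theorem hom_ext {f g : FreeStarAlg I →⋆ₐ[ℂ] B} (h : ∀ i, f (gen i) = g (gen i)) (a : FreeStarAlg I) :
    f a = g a := by
  refine induction (P := fun a => f a = g a) a (fun c => ?_) (fun x => ?_)
      (fun a b ha hb => ?_) (fun a b ha hb => ?_)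
  · rw [AlgHomClass.commutes, AlgHomClass.commutes]
  · rcases x with ⟨i, b⟩
    cases b
    · exact h i
    · rw [← star_gen, map_star, map_star, h i]
  · rw [map_mul, map_mul, ha, hb]
  · rw [map_add, map_add, ha, hb]

end FreeStarAlg

/-- A C⋆-seminorm on the free ⋆-algebra in which the relations `R` hold, i.e. a C⋆-seminorm on the
universal ⋆-algebra with these generators and relations. -/
def RelSeminorm {I : Type u} (R : Set (FreeStarAlg I)) : Type u :=
  {p : CStarSeminorm (FreeStarAlg I) // ∀ r ∈ R, p r = 0}

/-- The relations bound the generators in all C⋆-seminorms. -/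
def BoundedRel {I : Type u} (R : Set (FreeStarAlg I)) : Prop :=
  ∀ i, ∃ C : ℝ, ∀ p : RelSeminorm R, p.1 (FreeStarAlg.gen i) ≤ C

theorem BoundedRel.bddAbove {I : Type u} {R : Set (FreeStarAlg I)} (hR : BoundedRel R)
    (a : FreeStarAlg I) : BddAbove (Set.range fun p : RelSeminorm R => p.1 a) := by
  refine FreeStarAlg.induction (P := fun a => BddAbove (Set.range fun p : RelSeminorm R => p.1 a)) a
    (fun c => ?_) (fun x => ?_) (fun a b ha hb => ?_) (fun a b ha hb => ?_)
  · refine ⟨‖c‖, ?_⟩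
    rintro _ ⟨p, rfl⟩
    change p.1 _ ≤ _
    rw [Algebra.algebraMap_eq_smul_one, p.1.smul_eq]
    exact mul_le_of_le_one_right (norm_nonneg c) p.1.one_le
  · obtain ⟨C, hC⟩ := hR x.1
    refine ⟨C, ?_⟩
    rintro _ ⟨p, rfl⟩
    rcases x with ⟨i, b⟩
    cases b
    · exact hC p
    · change p.1 _ ≤ _
      rw [← FreeStarAlg.star_gen, p.1.star_eq]
      exact hC p
  · obtain ⟨A, hA⟩ := ha
    obtain ⟨B, hB⟩ := hb
    refine ⟨|A| * |B|, ?_⟩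
    rintro _ ⟨p, rfl⟩
    refine (p.1.mul_le a b).trans (mul_le_mul ((hA ⟨p, rfl⟩).trans (le_abs_self A))
      ((hB ⟨p, rfl⟩).trans (le_abs_self B)) (p.1.nonneg b) (abs_nonneg A))
  · obtain ⟨A, hA⟩ := ha
    obtain ⟨B, hB⟩ := hb
    refine ⟨A + B, ?_⟩
    rintro _ ⟨p, rfl⟩
    exact (p.1.add_le a b).trans (add_le_add (hA ⟨p, rfl⟩) (hB ⟨p, rfl⟩))

/-- The largest C⋆-seminorm on the universal ⋆-algebra with the given generators and relations. -/
noncomputable def maxSeminorm {I : Type u} {R : Set (FreeStarAlg I)} (hR : BoundedRel R) :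
    CStarSeminorm (FreeStarAlg I) :=
  CStarSeminorm.sup (fun p : RelSeminorm R => p.1) hR.bddAbove

/-- The universal unital C⋆-algebra with generators `I` subject to the relations `r = 0` for
`r ∈ R`: the completion of the universal ⋆-algebra in its largest C⋆-seminorm. -/
abbrev UnivCStar {I : Type u} {R : Set (FreeStarAlg I)} (hR : BoundedRel R) : Type u :=
  (maxSeminorm hR).Completion

namespace UnivCStar
variable {I : Type u} {R : Set (FreeStarAlg I)} (hR : BoundedRel R)

/-- The class of an element of the free ⋆-algebra. -/
noncomputable def of : FreeStarAlg I →⋆ₐ[ℂ] UnivCStar hR := (maxSeminorm hR).toCompHom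

/-- The generators. -/
noncomputable def gen (i : I) : UnivCStar hR := of hR (FreeStarAlg.gen i)

theorem of_rel {r : FreeStarAlg I} (hr : r ∈ R) : of hR r = 0 := by
  rw [← norm_le_zero_iff]
  refine ((maxSeminorm hR).norm_toComp r).trans_le ?_
  exact CStarSeminorm.sup_le _ _ _ _ le_rfl fun p => (p.2 r hr).le

variable {B : Type v} [CStarAlgebra B]

/-- The universal property. -/
noncomputable def lift (f : I → B) (hf : ∀ r ∈ R, FreeStarAlg.lift f r = 0) :
    UnivCStar hR →⋆ₐ[ℂ] B :=
  (maxSeminorm hR).lift (FreeStarAlg.lift f) fun a =>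
    CStarSeminorm.le_sup (fun p : RelSeminorm R => p.1) hR.bddAbove
      ⟨CStarSeminorm.ofHom (FreeStarAlg.lift f), fun r hr => by
        change ‖FreeStarAlg.lift f r‖ = 0
        rw [hf r hr, norm_zero]⟩ a

theorem lift_gen (f : I → B) (hf : ∀ r ∈ R, FreeStarAlg.lift f r = 0) (i : I) :
    lift hR f hf (gen hR i) = f i :=
  ((maxSeminorm hR).lift_toComp _ _ _).trans (FreeStarAlg.lift_gen f i)

theorem hom_ext {f g : UnivCStar hR →⋆ₐ[ℂ] B} (h : ∀ i, f (gen hR i) = g (gen hR i)) : f = g :=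
  CStarSeminorm.hom_ext _ fun a =>
    FreeStarAlg.hom_ext (f := f.comp (of hR)) (g := g.comp (of hR)) h a

theorem lift_of (f : I → B) (F : UnivCStar hR →⋆ₐ[ℂ] B) (hF : ∀ i, F (gen hR i) = f i)
    (a : FreeStarAlg I) : F (of hR a) = FreeStarAlg.lift f a :=
  FreeStarAlg.hom_ext (f := F.comp (of hR)) (g := FreeStarAlg.lift f)
    (fun i => (hF i).trans (FreeStarAlg.lift_gen f i).symm) a

theorem denseRange_of : DenseRange (of hR) := (maxSeminorm hR).denseRange_toComp

end UnivCStar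

/-! ### Commuting pairs of ⋆-homomorphisms and functions on the circle -/

theorem exists_square_partition {E : Type v} [NormedAddCommGroup E] (g : C(Circle, E)) {ε : ℝ}
    (hε : 0 < ε) : ∃ (s : Finset Circle) (c : Circle → C(Circle, ℝ)),
      (∀ z, ∑ k ∈ s, c k z * c k z = 1) ∧ ∀ k z, c k z ≠ 0 → ‖g z - g k‖ ≤ ε := by
  classical
  obtain ⟨ρ, hρ⟩ := PartitionOfUnity.exists_isSubordinate (isClosed_univ (X := Circle))
    (fun k : Circle => {z | ‖g z - g k‖ < ε})
    (fun k => isOpen_lt (by fun_prop) continuous_const)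
    (fun z _ => Set.mem_iUnion.2 ⟨z, by simpa using hε⟩)
  have hfin : {k | (Function.support (ρ k)).Nonempty}.Finite :=
    ρ.locallyFinite.finite_nonempty_of_compact
  refine ⟨hfin.toFinset, fun k => ⟨fun z => Real.sqrt (ρ k z), by fun_prop⟩, fun z => ?_,
    fun k z hz => ?_⟩
  · have h1 := ρ.sum_eq_one (Set.mem_univ z)
    rw [finsum_eq_sum_of_support_subset (s := hfin.toFinset)] at h1
    · rw [← h1]
      exact Finset.sum_congr rfl fun k _ => Real.mul_self_sqrt (ρ.nonneg k z)
    · intro k hk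
      simp only [Set.Finite.coe_toFinset, Set.mem_ofPred_eq]
      exact ⟨z, hk⟩
  · have h0 : ρ k z ≠ 0 := fun h => hz (by simp [h])
    exact (hρ k (subset_closure h0)).le

theorem norm_sum_conj_le {Z : Type v} [CStarAlgebra Z] {ι : Type w} (s : Finset ι) (c a : ι → Z)
    (hc : ∀ i ∈ s, star (c i) = c i) (h1 : ∑ i ∈ s, c i * c i = 1) {M : ℝ} (hM : 0 ≤ M)
    (ha : ∀ i ∈ s, ‖a i‖ ≤ M) : ‖∑ i ∈ s, c i * a i * c i‖ ≤ M := by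
  let _ := CStarAlgebra.spectralOrder Z
  have _ := CStarAlgebra.spectralOrderedRing Z
  let y : WithCStarModule Z (s → Z) := (WithCStarModule.equiv Z _).symm fun i => c i
  let x : WithCStarModule Z (s → Z) := (WithCStarModule.equiv Z _).symm fun i => c i * star (a i)
  have hone : ‖(1 : Z)‖ ≤ 1 := by
    have h := CStarRing.norm_star_mul_self (x := (1 : Z))
    simp only [star_one, mul_one] at h
    by_contra hcon
    push Not at hcon
    nlinarith
  have hxy : inner Z x y = ∑ i ∈ s, c i * a i * c i := by
    rw [WithCStarModule.pi_inner, ← Finset.sum_coe_sort s]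
    refine Finset.sum_congr rfl fun i _ => ?_
    change c i * star (c i * star (a i)) = _
    rw [star_mul, star_star, hc i i.2, mul_assoc]
  have hy : ‖y‖ ≤ 1 := by
    rw [← sq_le_one_iff₀ (norm_nonneg y), WithCStarModule.pi_norm_sq]
    have : ∑ i : s, inner Z (y i) (y i) = 1 := by
      rw [← h1, ← Finset.sum_coe_sort s]
      refine Finset.sum_congr rfl fun i _ => ?_
      change c i * star (c i) = _
      rw [hc i i.2]
    rw [this]; exact hone
  have hx : ‖x‖ ≤ M := by
    rw [← sq_le_sq₀ (norm_nonneg x) hM, WithCStarModule.pi_norm_sq]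
    have hterm : ∀ i : s, inner Z (x i) (x i) = c i * (star (a i) * a i) * star (c i) := fun i => by
      change c i * star (a i) * star (c i * star (a i)) = _
      rw [star_mul, star_star]; simp only [mul_assoc]
    have hle : ∑ i : s, inner Z (x i) (x i) ≤ (M ^ 2) • (1 : Z) := by
      calc ∑ i : s, inner Z (x i) (x i) ≤ ∑ i : s, (M ^ 2) • (c i * star (c i)) := by
            refine Finset.sum_le_sum fun i _ => ?_
            rw [hterm]
            refine (CStarAlgebra.star_right_conjugate_le_norm_smul
              (IsSelfAdjoint.star_mul_self (a i))).trans ?_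
            refine smul_le_smul_of_nonneg_right ?_ (mul_star_self_nonneg _)
            rw [CStarRing.norm_star_mul_self, ← pow_two]
            exact pow_le_pow_left₀ (norm_nonneg _) (ha i i.2) 2
        _ = (M ^ 2) • (1 : Z) := by
            rw [← Finset.smul_sum, ← h1, ← Finset.sum_coe_sort s]
            congr 1
            refine Finset.sum_congr rfl fun i _ => ?_
            rw [hc i i.2]
    have hnn : 0 ≤ ∑ i : s, inner Z (x i) (x i) :=
      Finset.sum_nonneg fun i _ => mul_star_self_nonneg (x i : Z)
    refine (CStarAlgebra.norm_le_norm_of_nonneg_of_le hnn hle).trans ?_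
    rw [norm_smul, Real.norm_of_nonneg (by positivity)]
    exact mul_le_of_le_one_right (by positivity) hone
  rw [← hxy]
  refine (CStarModule.norm_inner_le _).trans ?_
  calc ‖x‖ * ‖y‖ ≤ M * 1 := mul_le_mul hx hy (norm_nonneg y) hM
    _ = M := mul_one M

/-- The coordinate function `z` on the circle. -/
def circleCoord : C(Circle, ℂ) := ⟨fun z => (z : ℂ), continuous_subtype_val⟩

theorem adjoin_circleCoord_dense :
    (StarAlgebra.adjoin ℂ {circleCoord}).topologicalClosure = ⊤ := by
  refine ContinuousMap.starSubalgebra_topologicalClosure_eq_top_of_separatesPoints _ ?_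
  intro x y hxy
  refine ⟨circleCoord, ⟨circleCoord, StarAlgebra.subset_adjoin ℂ _ rfl, rfl⟩, ?_⟩
  exact fun h => hxy (Circle.ext h)

theorem starAlgHom_ext_of_adjoin {B : Type u} [CStarAlgebra B] {Z : Type v} [CStarAlgebra Z]
    {S : Set B} (hS : (StarAlgebra.adjoin ℂ S).topologicalClosure = ⊤) {f g : B →⋆ₐ[ℂ] Z}
    (h : ∀ x ∈ S, f x = g x) : f = g := by
  have hcl : IsClosed ((StarAlgHom.equalizer f g : StarSubalgebra ℂ B) : Set B) :=
    isClosed_eq (starAlgHom_continuous f) (starAlgHom_continuous g)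
  have hle : (StarAlgebra.adjoin ℂ S).topologicalClosure ≤ StarAlgHom.equalizer f g :=
    StarSubalgebra.topologicalClosure_minimal (StarAlgHom.adjoin_le_equalizer f g h) hcl
  ext x
  have hx : x ∈ (StarAlgebra.adjoin ℂ S).topologicalClosure := by rw [hS]; trivial
  exact hle hx

theorem circle_hom_ext {Z : Type v} [CStarAlgebra Z] {f g : C(Circle, ℂ) →⋆ₐ[ℂ] Z}
    (h : f circleCoord = g circleCoord) : f = g :=
  starAlgHom_ext_of_adjoin adjoin_circleCoord_dense (by rintro x rfl; exact h)

/-- The unique ⋆-homomorphism `C(𝕋) → Z` that sends `z` to the unitary `W`. -/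
theorem exists_circleHom {Z : Type v} [CStarAlgebra Z] (W : unitary Z) :
    ∃ f : C(Circle, ℂ) →⋆ₐ[ℂ] Z, f circleCoord = W := by
  have hW : IsStarNormal (W : Z) := inferInstance
  have hs : ∀ z : spectrum ℂ (W : Z), (z : ℂ) ∈ Submonoid.unitSphere ℂ := fun z =>
    Unitary.spectrum_subset_circle W z.2
  let r : C(spectrum ℂ (W : Z), Circle) :=
    ⟨fun z => (⟨z, hs z⟩ : Submonoid.unitSphere ℂ), by
      exact Continuous.subtype_mk continuous_subtype_val _⟩
  refine ⟨(cfcHom hW).comp (ContinuousMap.compStarAlgHom' ℂ ℂ r), ?_⟩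
  exact cfcHom_id hW

/-- The unique ⋆-homomorphism `C(𝕋) → Z` that sends `z` to the unitary `W`. -/
noncomputable def circleHom {Z : Type v} [CStarAlgebra Z] (W : unitary Z) : C(Circle, ℂ) →⋆ₐ[ℂ] Z :=
  (exists_circleHom W).choose

theorem circleHom_coord {Z : Type v} [CStarAlgebra Z] (W : unitary Z) :
    circleHom W circleCoord = W := (exists_circleHom W).choose_spec

/-- The ⋆-homomorphism on the algebraic tensor product given by a commuting pair. -/
noncomputable def tensorLift {X : Type u} {Y : Type v} {Z : Type w} [CStarAlgebra X]
    [CStarAlgebra Y] [CStarAlgebra Z] (f : X →⋆ₐ[ℂ] Z) (g : Y →⋆ₐ[ℂ] Z)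
    (h : ∀ x y, Commute (f x) (g y)) : X ⊗[ℂ] Y →⋆ₐ[ℂ] Z where
  toAlgHom := Algebra.TensorProduct.lift f.toAlgHom g.toAlgHom h
  map_star' t := by
    change Algebra.TensorProduct.lift f.toAlgHom g.toAlgHom h _
      = star (Algebra.TensorProduct.lift f.toAlgHom g.toAlgHom h _)
    induction t with
    | zero => simp
    | add a b ha hb => simp only [star_add, map_add, ha, hb]
    | tmul x y =>
      have h1 : ∀ a b, Algebra.TensorProduct.lift f.toAlgHom g.toAlgHom h (a ⊗ₜ b) = f a * g b :=
        fun a b => Algebra.TensorProduct.lift_tmul f.toAlgHom g.toAlgHom h a b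
      rw [TensorProduct.star_tmul, h1, h1, star_mul, map_star, map_star]
      have := h (star x) (star y)
      rw [map_star, map_star] at this
      exact this.eq

theorem tensorLift_tmul {X : Type u} {Y : Type v} {Z : Type w} [CStarAlgebra X]
    [CStarAlgebra Y] [CStarAlgebra Z] (f : X →⋆ₐ[ℂ] Z) (g : Y →⋆ₐ[ℂ] Z)
    (h : ∀ x y, Commute (f x) (g y)) (x : X) (y : Y) : tensorLift f g h (x ⊗ₜ y) = f x * g y :=
  Algebra.TensorProduct.lift_tmul f.toAlgHom g.toAlgHom h x y

theorem exists_extend_tensor {X Q B Z : Type*} [CStarAlgebra X] [CStarAlgebra Q] [CStarAlgebra B]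
    [CStarAlgebra Z] (e : X ⊗[ℂ] Q →⋆ₐ[ℂ] B) (he : DenseRange e) (f : X ⊗[ℂ] Q →⋆ₐ[ℂ] Z)
    (hf : ∀ a, ‖f a‖ ≤ ‖e a‖) : ∃ g : B →⋆ₐ[ℂ] Z, ∀ a, g (e a) = f a :=
  exists_extend_starAlgHom e he f hf

section PairHom
variable {X : Type u} [CStarAlgebra X]

variable (X) in
/-- The embedding of `X` in `C(𝕋, X) = X ⊗ C(𝕋)` as constant functions. -/
noncomputable def constHom : X →⋆ₐ[ℂ] C(Circle, X) where
  toFun x := ContinuousMap.const _ x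
  map_one' := rfl
  map_mul' _ _ := rfl
  map_zero' := rfl
  map_add' _ _ := rfl
  commutes' _ := rfl
  map_star' _ := rfl

variable (X) in
/-- The embedding of `C(𝕋)` in `C(𝕋, X) = X ⊗ C(𝕋)` as scalar functions. -/
noncomputable def scalarHom : C(Circle, ℂ) →⋆ₐ[ℂ] C(Circle, X) where
  toFun f := ⟨fun z => algebraMap ℂ X (f z), (continuous_algebraMap ℂ X).comp f.continuous⟩
  map_one' := by ext; simp
  map_mul' _ _ := by ext; simp
  map_zero' := by ext; simp
  map_add' _ _ := by ext; simp
  commutes' _ := by ext; simp [Algebra.algebraMap_eq_smul_one]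
  map_star' f := by ext z; exact algebraMap_star_comm (f z)

theorem commute_const_scalar (x : X) (f : C(Circle, ℂ)) :
    Commute (constHom X x) (scalarHom X f) := by
  ext z; exact (Algebra.commutes (f z) x).symm

/-- The map `X ⊙ C(𝕋) → C(𝕋, X)`. -/
noncomputable def toCircleMap : X ⊗[ℂ] C(Circle, ℂ) →⋆ₐ[ℂ] C(Circle, X) :=
  tensorLift (constHom X) (scalarHom X) commute_const_scalar

theorem toCircleMap_tmul (x : X) (f : C(Circle, ℂ)) :
    toCircleMap (x ⊗ₜ f) = constHom X x * scalarHom X f :=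
  tensorLift_tmul _ _ commute_const_scalar _ _

theorem toCircleMap_tmul_apply (x : X) (f : C(Circle, ℂ)) (z : Circle) :
    toCircleMap (x ⊗ₜ f) z = f z • x := by
  rw [toCircleMap_tmul, Algebra.smul_def, Algebra.commutes]
  rfl

/-- The complex valued function `c²`. -/
noncomputable def sqFun (c : C(Circle, ℝ)) : C(Circle, ℂ) :=
  ⟨fun z => ((c z * c z : ℝ) : ℂ), by fun_prop⟩

theorem norm_sub_partition_le {E : Type v} [NormedAddCommGroup E] [NormedSpace ℂ E]
    (g : C(Circle, E)) {ε : ℝ} {s : Finset Circle} {c : Circle → C(Circle, ℝ)}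
    (h1 : ∀ z, ∑ k ∈ s, c k z * c k z = 1) (hc : ∀ k z, c k z ≠ 0 → ‖g z - g k‖ ≤ ε)
    (z : Circle) : ‖g z - ∑ k ∈ s, sqFun (c k) z • g k‖ ≤ ε := by
  have h2 : ∑ k ∈ s, sqFun (c k) z • g z = g z := by
    rw [← Finset.sum_smul]
    have : ∑ k ∈ s, sqFun (c k) z = 1 := by
      simp only [sqFun, ContinuousMap.coe_mk]
      rw [← Complex.ofReal_sum, h1, Complex.ofReal_one]
    rw [this, one_smul]
  have h3 : g z - ∑ k ∈ s, sqFun (c k) z • g k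
      = ∑ k ∈ s, (sqFun (c k) z • g z - sqFun (c k) z • g k) := by
    rw [Finset.sum_sub_distrib, h2]
  rw [h3]
  refine (norm_sum_le _ _).trans ?_
  calc ∑ k ∈ s, ‖sqFun (c k) z • g z - sqFun (c k) z • g k‖
      ≤ ∑ k ∈ s, (c k z * c k z) * ε := by
        refine Finset.sum_le_sum fun k _ => ?_
        rw [← smul_sub, norm_smul]
        have : ‖sqFun (c k) z‖ = c k z * c k z := by
          simp only [sqFun, ContinuousMap.coe_mk, Complex.norm_real]
          exact Real.norm_of_nonneg (mul_self_nonneg _)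
        rw [this]
        by_cases h0 : c k z = 0
        · simp [h0]
        · exact mul_le_mul_of_nonneg_left (hc k z h0) (mul_self_nonneg _)
    _ = ε := by rw [← Finset.sum_mul, h1, one_mul]

theorem denseRange_toCircleMap : DenseRange (toCircleMap (X := X)) := by
  intro g
  rw [Metric.mem_closure_iff]
  intro ε hε
  obtain ⟨s, c, h1, hc⟩ := exists_square_partition g (half_pos hε)
  refine ⟨_, ⟨∑ k ∈ s, g k ⊗ₜ sqFun (c k), rfl⟩, ?_⟩
  rw [dist_eq_norm]
  refine lt_of_le_of_lt ?_ (half_lt_self hε)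
  rw [ContinuousMap.norm_le _ (half_pos hε).le]
  intro z
  have := norm_sub_partition_le g h1 hc z
  rw [map_sum, ContinuousMap.sub_apply, ContinuousMap.sum_apply]
  simpa only [toCircleMap_tmul_apply] using this

theorem norm_pair_le {Z : Type v} [CStarAlgebra Z] (f : X →⋆ₐ[ℂ] Z) (g : C(Circle, ℂ) →⋆ₐ[ℂ] Z)
    (h : ∀ x y, Commute (f x) (g y)) (t : X ⊗[ℂ] C(Circle, ℂ)) :
    ‖tensorLift f g h t‖ ≤ ‖toCircleMap t‖ := by
  obtain ⟨S, hS⟩ := TensorProduct.exists_finset t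
  refine le_of_forall_pos_le_add fun ε hε => ?_
  set N : ℝ := ∑ i ∈ S, ‖i.1‖ with hN
  have hN0 : 0 ≤ N := Finset.sum_nonneg fun i _ => norm_nonneg _
  obtain ⟨δ, hδ, hδN⟩ : ∃ δ : ℝ, 0 < δ ∧ N * δ ≤ ε :=
    ⟨ε / (N + 1), by positivity, by
      rw [mul_div_assoc', div_le_iff₀ (by positivity)]; nlinarith⟩
  let G : C(Circle, S → ℂ) := ⟨fun z i => i.1.2 z, by fun_prop⟩
  obtain ⟨s, c, h1, hc⟩ := exists_square_partition G hδ
  let cc : Circle → C(Circle, ℂ) := fun k => ⟨fun z => ((c k z : ℝ) : ℂ), by fun_prop⟩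
  have hsq : ∀ k, sqFun (c k) = cc k * cc k := fun k => by
    ext z; simp [sqFun, cc]
  have hsum : ∑ k ∈ s, sqFun (c k) = 1 := by
    ext z
    rw [ContinuousMap.sum_apply]
    simp only [sqFun, ContinuousMap.coe_mk, ContinuousMap.one_apply]
    rw [← Complex.ofReal_sum, h1, Complex.ofReal_one]
  set m : Z := ∑ k ∈ s, g (cc k) * f (toCircleMap t k) * g (cc k) with hm
  have hmle : ‖m‖ ≤ ‖toCircleMap t‖ := by
    refine norm_sum_conj_le s _ _ (fun k _ => ?_) ?_ (norm_nonneg _) fun k _ => ?_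
    · rw [← map_star]; congr 1; ext z; simp [cc]
    · simp only [← map_mul, ← hsq]
      rw [← map_sum, hsum, map_one]
    · exact (NonUnitalStarAlgHom.norm_apply_le f _).trans (ContinuousMap.norm_coe_le_norm _ k)
  have hm' : m = ∑ i ∈ S, f i.1 * g (∑ k ∈ s, i.2 k • sqFun (c k)) := by
    rw [hm]
    have : ∀ k, g (cc k) * f (toCircleMap t k) * g (cc k)
        = ∑ i ∈ S, f i.1 * g (i.2 k • sqFun (c k)) := fun k => by
      have h2 : toCircleMap t k = ∑ i ∈ S, i.2 k • i.1 := by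
        rw [hS, map_sum, ContinuousMap.sum_apply]
        simp only [toCircleMap_tmul_apply]
      rw [h2, map_sum, Finset.mul_sum, Finset.sum_mul]
      refine Finset.sum_congr rfl fun i _ => ?_
      rw [← (h _ _).eq, mul_assoc, ← map_mul, ← hsq, map_smul, map_smul, smul_mul_assoc,
        mul_smul_comm]
    simp only [this]
    rw [Finset.sum_comm]
    refine Finset.sum_congr rfl fun i _ => ?_
    rw [map_sum, Finset.mul_sum]
  have hdiff : ‖tensorLift f g h t - m‖ ≤ N * δ := by
    have : tensorLift f g h t = ∑ i ∈ S, f i.1 * g i.2 := by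
      conv_lhs => rw [hS]
      rw [map_sum]
      simp only [tensorLift_tmul]
    rw [this, hm', ← Finset.sum_sub_distrib, hN, Finset.sum_mul]
    refine (norm_sum_le _ _).trans (Finset.sum_le_sum fun i hi => ?_)
    rw [← mul_sub, ← map_sub]
    refine (norm_mul_le _ _).trans (mul_le_mul (NonUnitalStarAlgHom.norm_apply_le f _)
      ((NonUnitalStarAlgHom.norm_apply_le g _).trans ?_) (norm_nonneg _) (norm_nonneg _))
    rw [ContinuousMap.norm_le _ hδ.le]
    intro z
    have h3 := norm_sub_partition_le i.2 (ε := δ) h1 (fun k z hk =>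
      (norm_le_pi_norm (G z - G k) ⟨i, hi⟩).trans (hc k z hk)) z
    rw [ContinuousMap.sub_apply, ContinuousMap.sum_apply]
    simpa [mul_comm] using h3
  calc ‖tensorLift f g h t‖ ≤ ‖m‖ + ‖tensorLift f g h t - m‖ := by
        have := norm_add_le m (tensorLift f g h t - m); simpa using this
    _ ≤ ‖toCircleMap t‖ + ε := add_le_add hmle (hdiff.trans hδN)

variable {Z : Type v} [CStarAlgebra Z]

theorem exists_pairHom (f : X →⋆ₐ[ℂ] Z) (g : C(Circle, ℂ) →⋆ₐ[ℂ] Z)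
    (h : ∀ x y, Commute (f x) (g y)) :
    ∃ F : C(Circle, X) →⋆ₐ[ℂ] Z, ∀ t, F (toCircleMap t) = tensorLift f g h t :=
  exists_extend_tensor toCircleMap denseRange_toCircleMap (tensorLift f g h) (norm_pair_le f g h)

/-- The ⋆-homomorphism `X ⊗ C(𝕋) = C(𝕋, X) → Z`, `x ⊗ p ↦ f(x) g(p)`, given by a commuting pair of
⋆-homomorphisms. -/
noncomputable def pairHom (f : X →⋆ₐ[ℂ] Z) (g : C(Circle, ℂ) →⋆ₐ[ℂ] Z)
    (h : ∀ x y, Commute (f x) (g y)) : C(Circle, X) →⋆ₐ[ℂ] Z := (exists_pairHom f g h).choose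

theorem pairHom_const (f : X →⋆ₐ[ℂ] Z) (g : C(Circle, ℂ) →⋆ₐ[ℂ] Z)
    (h : ∀ x y, Commute (f x) (g y)) (x : X) : pairHom f g h (constHom X x) = f x := by
  have := (exists_pairHom f g h).choose_spec (x ⊗ₜ 1)
  rw [tensorLift_tmul, toCircleMap_tmul, map_one, map_one, mul_one, mul_one] at this
  exact this

theorem pairHom_scalar (f : X →⋆ₐ[ℂ] Z) (g : C(Circle, ℂ) →⋆ₐ[ℂ] Z)
    (h : ∀ x y, Commute (f x) (g y)) (p : C(Circle, ℂ)) : pairHom f g h (scalarHom X p) = g p := by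
  have := (exists_pairHom f g h).choose_spec (1 ⊗ₜ p)
  rw [tensorLift_tmul, toCircleMap_tmul, map_one, map_one, one_mul, one_mul] at this
  exact this

theorem circleMap_hom_ext {F G : C(Circle, X) →⋆ₐ[ℂ] Z}
    (h1 : ∀ x, F (constHom X x) = G (constHom X x))
    (h2 : F (scalarHom X circleCoord) = G (scalarHom X circleCoord)) : F = G := by
  have h3 : F.comp (scalarHom X) = G.comp (scalarHom X) := circle_hom_ext h2
  refine starAlgHom_ext_of_dense denseRange_toCircleMap fun t => ?_
  induction t with
  | zero => simp
  | add a b ha hb => simp only [map_add, ha, hb]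
  | tmul x p =>
    rw [toCircleMap_tmul, map_mul, map_mul, h1]
    congr 1
    exact DFunLike.congr_fun h3 p

end PairHom

/-! ### Circle actions -/

/-- The evaluation `C(𝕋, X) → X` at a point of the circle. -/
noncomputable def evalAt (X : Type u) [CStarAlgebra X] (z : Circle) : C(Circle, X) →⋆ₐ[ℂ] X where
  toFun f := f z
  map_one' := rfl
  map_mul' _ _ := rfl
  map_zero' := rfl
  map_add' _ _ := rfl
  commutes' _ := rfl
  map_star' _ := rfl

/-- A continuous action of the circle on the unital C⋆-algebra `X`, given as a coaction
`X → X ⊗ C(𝕋) = C(𝕋, X)`. -/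
class CircleAction (X : Type u) [CStarAlgebra X] where
  /-- The coaction `ρ`; the value of `ρ(x)` at `z` is `ρ_z(x)`. -/
  coact : X →⋆ₐ[ℂ] C(Circle, X)
  /-- `(ρ ⊗ id) ρ = (id ⊗ Δ_𝕋) ρ`. -/
  coassoc : ∀ (x : X) (z w : Circle), coact (coact x w) z = coact x (z * w)
  /-- `ρ(X)(1 ⊗ C(𝕋))` has dense linear span in `X ⊗ C(𝕋)`. -/
  podles : (Submodule.span ℂ
    {y | ∃ (x : X) (p : C(Circle, ℂ)), y = coact x * scalarHom X p}).topologicalClosure = ⊤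

namespace CircleAction
variable {X : Type u} [CStarAlgebra X]

/-- A coaction from a ⋆-homomorphism `ρ` with `ρ_z ρ_w = ρ_{zw}` and `ρ_1 = id`. -/
@[reducible] noncomputable def ofCoact (c : X →⋆ₐ[ℂ] C(Circle, X))
    (h : ∀ (x : X) (z w : Circle), c (c x w) z = c x (z * w)) (h1 : ∀ x, c x 1 = x) :
    CircleAction X where
  coact := c
  coassoc := h
  podles := by
    rw [Submodule.eq_top_iff']
    intro g
    have hcont : Continuous c := starAlgHom_continuous c
    let g' : C(Circle, X) := ⟨fun z => c (g z) z⁻¹,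
      (ContinuousEval.continuous_eval.comp
        ((hcont.comp g.continuous).prodMk continuous_inv))⟩
    refine Metric.mem_closure_iff.2 fun ε hε => ?_
    obtain ⟨s, p, hp1, hp⟩ := exists_square_partition g' (half_pos hε)
    refine ⟨∑ k ∈ s, c (g' k) * scalarHom X (sqFun (p k)),
      Submodule.sum_mem _ fun k _ => Submodule.subset_span ⟨_, _, rfl⟩, ?_⟩
    rw [dist_eq_norm]
    refine lt_of_le_of_lt ?_ (half_lt_self hε)
    rw [ContinuousMap.norm_le _ (half_pos hε).le]
    intro z
    have hz := norm_sub_partition_le g' hp1 hp z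
    have e1 : c (g' z) z = g z := by
      change c (c (g z) z⁻¹) z = g z
      rw [h, mul_inv_cancel, h1]
    have e2 : (g - ∑ k ∈ s, c (g' k) * scalarHom X (sqFun (p k))) z
        = (evalAt X z).comp c (g' z - ∑ k ∈ s, sqFun (p k) z • g' k) := by
      rw [map_sub, map_sum, ContinuousMap.sub_apply, ContinuousMap.sum_apply]
      congr 1
      · exact e1.symm
      · refine Finset.sum_congr rfl fun k _ => ?_
        rw [map_smul, Algebra.smul_def, Algebra.commutes]
        rfl
    rw [e2]
    exact (NonUnitalStarAlgHom.norm_apply_le _ _).trans hz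

variable [CircleAction X]

/-- The ⋆-homomorphism `ρ_z`. -/
noncomputable def act (X : Type u) [CStarAlgebra X] [CircleAction X] (z : Circle) : X →⋆ₐ[ℂ] X :=
  (evalAt X z).comp coact

theorem coact_apply (x : X) (z : Circle) : coact x z = act X z x := rfl

theorem act_act (z w : Circle) (x : X) : act X z (act X w x) = act X (z * w) x := coassoc x z w

theorem continuous_act (x : X) : Continuous fun z => act X z x := (coact x).continuous

theorem act_one (x : X) : act X 1 x = x := by
  have hcl : IsClosed {y : X | act X 1 y = y} :=
    isClosed_eq (starAlgHom_continuous _) continuous_id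
  let S : Submodule ℂ C(Circle, X) :=
    { carrier := {f | act X 1 (f 1) = f 1}
      add_mem' := fun {a b} ha hb => by
        change act X 1 (a 1 + b 1) = a 1 + b 1
        rw [map_add]; exact congrArg₂ _ ha hb
      zero_mem' := map_zero (act X 1)
      smul_mem' := fun t a ha => by
        change act X 1 (t • a 1) = t • a 1
        rw [map_smul]; exact congrArg _ ha }
  have hS : IsClosed (S : Set C(Circle, X)) :=
    hcl.preimage (ContinuousEvalConst.continuous_eval_const (1 : Circle))
  have hle : (Submodule.span ℂ
      {y | ∃ (x : X) (p : C(Circle, ℂ)), y = coact x * scalarHom X p}).topologicalClosure ≤ S := by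
    refine Submodule.topologicalClosure_minimal _ (Submodule.span_le.2 ?_) hS
    rintro _ ⟨y, p, rfl⟩
    change act X 1 (act X 1 y * algebraMap ℂ X (p 1)) = act X 1 y * algebraMap ℂ X (p 1)
    rw [map_mul, act_act, AlgHomClass.commutes, mul_one]
  rw [podles] at hle
  exact hle (Submodule.mem_top : constHom X x ∈ ⊤)

theorem act_star (z : Circle) (x : X) : act X z (star x) = star (act X z x) := map_star _ _

end CircleAction

open CircleAction

/-- A ⋆-homomorphism between circle actions is equivariant. -/
def IsEquivariant {X : Type u} {Y : Type v} [CStarAlgebra X] [CStarAlgebra Y] [CircleAction X]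
    [CircleAction Y] (f : X →⋆ₐ[ℂ] Y) : Prop := ∀ (z : Circle) (x : X), act Y z (f x) = f (act X z x)

/-- `x` is homogeneous of degree `k`: `ρ(x) = x ⊗ z^k`. -/
def IsHomogeneous {X : Type u} [CStarAlgebra X] [CircleAction X] (x : X) (k : ℤ) : Prop :=
  ∀ z : Circle, act X z x = ((z : ℂ) ^ k) • x

/-- Left composition with a ⋆-homomorphism: `f ⊗ id` on `X ⊗ C(𝕋)`. -/
noncomputable def postComp {X : Type u} {Y : Type v} [CStarAlgebra X] [CStarAlgebra Y]
    (f : X →⋆ₐ[ℂ] Y) : C(Circle, X) →⋆ₐ[ℂ] C(Circle, Y) where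
  toFun g := ⟨fun z => f (g z), (starAlgHom_continuous f).comp g.continuous⟩
  map_one' := by ext; simp
  map_mul' _ _ := by ext; simp
  map_zero' := by ext; simp
  map_add' _ _ := by ext; simp
  commutes' c := by ext z; exact AlgHomClass.commutes f c
  map_star' g := by ext z; exact map_star f (g z)

/-! ### The noncommutative torus -/

namespace NCTorus

/-- The two generators. -/
inductive Gen where
  | U
  | V

/-- The relations: `U` and `V` are unitary and `V U = ζ U V`. -/
noncomputable def rel (ζ : Circle) : Set (FreeStarAlg Gen) :=
  {r | (∃ i, r = star (FreeStarAlg.gen i) * FreeStarAlg.gen i - 1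
      ∨ r = FreeStarAlg.gen i * star (FreeStarAlg.gen i) - 1)
    ∨ r = FreeStarAlg.gen Gen.V * FreeStarAlg.gen Gen.U
      - (ζ : ℂ) • (FreeStarAlg.gen Gen.U * FreeStarAlg.gen Gen.V)}

theorem le_one_of_rel {D : Type u} [Ring D] [StarRing D] [Algebra ℂ D] (p : CStarSeminorm D) {a : D}
    (h : p (star a * a - 1) = 0) : p a ≤ 1 := by
  have h1 : p (star a * a) ≤ 1 := by
    have := p.add_le (star a * a - 1) 1
    rw [sub_add_cancel, h, zero_add] at this
    exact this.trans p.one_le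
  rw [p.star_mul_self] at h1
  nlinarith [p.nonneg a]

theorem bounded (ζ : Circle) : BoundedRel (rel ζ) := by
  intro i
  refine ⟨1, fun p => le_one_of_rel p.1 ?_⟩
  exact p.2 _ (Or.inl ⟨i, Or.inl rfl⟩)

end NCTorus

/-- The algebra `C(𝕋²_ζ)` of the noncommutative torus. -/
abbrev NCTorus (ζ : Circle) : Type := UnivCStar (NCTorus.bounded ζ)

namespace NCTorus
variable (ζ : Circle)

/-- A generator, as a unitary. -/
noncomputable def gen (i : Gen) : unitary (NCTorus ζ) :=
  ⟨UnivCStar.gen (bounded ζ) i, by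
    have h1 : UnivCStar.of (bounded ζ) (star (FreeStarAlg.gen i) * FreeStarAlg.gen i - 1) = 0 :=
      UnivCStar.of_rel _ (Or.inl ⟨i, Or.inl rfl⟩)
    have h2 : UnivCStar.of (bounded ζ) (FreeStarAlg.gen i * star (FreeStarAlg.gen i) - 1) = 0 :=
      UnivCStar.of_rel _ (Or.inl ⟨i, Or.inr rfl⟩)
    rw [map_sub, map_mul, map_star, map_one, sub_eq_zero] at h1 h2
    exact ⟨h1, h2⟩⟩

theorem gen_comm : (gen ζ .V : NCTorus ζ) * gen ζ .U = (ζ : ℂ) • ((gen ζ .U : NCTorus ζ) * gen ζ .V) := by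
  have h : UnivCStar.of (bounded ζ) (FreeStarAlg.gen .V * FreeStarAlg.gen .U
     - (ζ : ℂ) • (FreeStarAlg.gen .U * FreeStarAlg.gen .V)) = 0 :=
    UnivCStar.of_rel _ (Or.inr rfl)
  rw [map_sub, map_smul, map_mul, map_mul, sub_eq_zero] at h
  exact h

end NCTorus

/-! ### The braided tensor product -/

theorem pairHom_natural {X X' : Type u} {Z : Type v} {Z' : Type w} [CStarAlgebra X] [CStarAlgebra X']
    [CStarAlgebra Z] [CStarAlgebra Z'] {f : X →⋆ₐ[ℂ] Z} {g : C(Circle, ℂ) →⋆ₐ[ℂ] Z}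
    {h : ∀ x y, Commute (f x) (g y)} {f' : X' →⋆ₐ[ℂ] Z'} {g' : C(Circle, ℂ) →⋆ₐ[ℂ] Z'}
    {h' : ∀ x y, Commute (f' x) (g' y)} (F : Z →⋆ₐ[ℂ] Z') (π : X →⋆ₐ[ℂ] X')
    (hf : ∀ x, F (f x) = f' (π x)) (hg : F (g circleCoord) = g' circleCoord) (c : C(Circle, X)) :
    F (pairHom f g h c) = pairHom f' g' h' (postComp π c) := by
  have key : F.comp (pairHom f g h) = (pairHom f' g' h').comp (postComp π) := by
    refine circleMap_hom_ext (fun x => ?_) ?_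
    · have e : postComp π (constHom X x) = constHom X' (π x) := rfl
      rw [StarAlgHom.comp_apply, StarAlgHom.comp_apply, e, pairHom_const, pairHom_const, hf]
    · have e : postComp π (scalarHom X circleCoord) = scalarHom X' circleCoord := by
        ext z; exact AlgHomClass.commutes π _
      rw [StarAlgHom.comp_apply, StarAlgHom.comp_apply, e, pairHom_scalar, pairHom_scalar, hg]
  exact DFunLike.congr_fun key c

theorem IsEquivariant.coact_apply {X : Type u} {Y : Type v} [CStarAlgebra X] [CStarAlgebra Y]
    [CircleAction X] [CircleAction Y] {f : X →⋆ₐ[ℂ] Y} (hf : IsEquivariant f) (x : X) :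
    postComp f (coact x) = coact (f x) := by
  ext z; exact (hf z x).symm

theorem isEquivariant_act {X : Type u} [CStarAlgebra X] [CircleAction X] (w : Circle) :
    IsEquivariant (act X w) := fun z x => by rw [act_act, act_act, mul_comm]

theorem MinTensor.commute_comp {P Q X Y : Type*} [CStarAlgebra P] [CStarAlgebra Q] [CStarAlgebra X]
    [CStarAlgebra Y] (f : P →⋆ₐ[ℂ] X) (g : Q →⋆ₐ[ℂ] Y) (p : P) (q : Q) :
    Commute (((MinTensor.inl (Y := Y)).comp f) p) (((MinTensor.inr (X := X)).comp g) q) :=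
  MinTensor.commute_inl_inr _ _

section Ambient
variable (ζ : Circle) (X : Type u) (Y : Type v) [CStarAlgebra X] [CStarAlgebra Y]

/-- The algebra `X ⊗ Y ⊗ C(𝕋²_ζ)`. -/
abbrev Ambient : Type (max u v) := MinTensor (MinTensor X Y) (NCTorus ζ)

namespace Ambient
variable [CircleAction X] [CircleAction Y]

/-- The composite `X → X ⊗ C(𝕋) → X ⊗ Y ⊗ C(𝕋) → X ⊗ Y ⊗ C(𝕋²_ζ)`; it sends a homogeneous `x` of
degree `k` to `x ⊗ 1 ⊗ U^k`. -/
noncomputable def j₁ : X →⋆ₐ[ℂ] Ambient ζ X Y :=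
  (pairHom ((MinTensor.inl (Y := NCTorus ζ)).comp (MinTensor.inl (X := X) (Y := Y)))
    ((MinTensor.inr (X := MinTensor X Y)).comp (circleHom (NCTorus.gen ζ .U)))
    (MinTensor.commute_comp _ _)).comp coact

/-- The composite `Y → Y ⊗ C(𝕋) → X ⊗ Y ⊗ C(𝕋) → X ⊗ Y ⊗ C(𝕋²_ζ)`; it sends a homogeneous `y` of
degree `l` to `1 ⊗ y ⊗ V^l`. -/
noncomputable def j₂ : Y →⋆ₐ[ℂ] Ambient ζ X Y :=
  (pairHom ((MinTensor.inl (Y := NCTorus ζ)).comp (MinTensor.inr (X := X) (Y := Y)))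
    ((MinTensor.inr (X := MinTensor X Y)).comp (circleHom (NCTorus.gen ζ .V)))
    (MinTensor.commute_comp _ _)).comp coact

end Ambient
end Ambient

section
set_option linter.unusedSectionVars false
variable (ζ : Circle) {X X' : Type u} {Y Y' : Type v} [CStarAlgebra X] [CStarAlgebra Y]
  [CStarAlgebra X'] [CStarAlgebra Y'] [CircleAction X] [CircleAction Y] [CircleAction X']
  [CircleAction Y']

namespace Ambient

/-- `f ⊗ g ⊗ id`. -/
noncomputable def map (f : X →⋆ₐ[ℂ] X') (g : Y →⋆ₐ[ℂ] Y') : Ambient ζ X Y →⋆ₐ[ℂ] Ambient ζ X' Y' :=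
  MinTensor.map (MinTensor.map f g) (StarAlgHom.id ℂ _)

theorem map_j₁ {f : X →⋆ₐ[ℂ] X'} (hf : IsEquivariant f) (g : Y →⋆ₐ[ℂ] Y') (x : X) :
    map ζ f g (j₁ ζ X Y x) = j₁ ζ X' Y' (f x) := by
  rw [j₁, j₁, StarAlgHom.comp_apply, StarAlgHom.comp_apply, ← hf.coact_apply]
  refine pairHom_natural (map ζ f g) f (fun x => ?_) ?_ _
  · rw [map, StarAlgHom.comp_apply, StarAlgHom.comp_apply, MinTensor.map_inl, MinTensor.map_inl]
  · rw [map, StarAlgHom.comp_apply, StarAlgHom.comp_apply, MinTensor.map_inr]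
    rfl

theorem map_j₂ (f : X →⋆ₐ[ℂ] X') {g : Y →⋆ₐ[ℂ] Y'} (hg : IsEquivariant g) (y : Y) :
    map ζ f g (j₂ ζ X Y y) = j₂ ζ X' Y' (g y) := by
  rw [j₂, j₂, StarAlgHom.comp_apply, StarAlgHom.comp_apply, ← hg.coact_apply]
  refine pairHom_natural (map ζ f g) g (fun x => ?_) ?_ _
  · rw [map, StarAlgHom.comp_apply, StarAlgHom.comp_apply, MinTensor.map_inl, MinTensor.map_inr]
  · rw [map, StarAlgHom.comp_apply, StarAlgHom.comp_apply, MinTensor.map_inr]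
    rfl

end Ambient

variable (X Y) in
/-- The closed linear span of `j₁(X) j₂(Y)`, which is the C⋆-algebra generated by `j₁(X)` and
`j₂(Y)`. -/
noncomputable def braidedSubalgebra : StarSubalgebra ℂ (Ambient ζ X Y) :=
  (StarAlgebra.adjoin ℂ (Set.range (Ambient.j₁ ζ X Y) ∪ Set.range (Ambient.j₂ ζ X Y))).topologicalClosure

instance : IsClosed (braidedSubalgebra ζ X Y : Set (Ambient ζ X Y)) :=
  StarSubalgebra.isClosed_topologicalClosure _

variable (X Y) in
/-- The braided tensor product `X ⊠_ζ Y`. -/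
def BraidedTensor : Type (max u v) := braidedSubalgebra ζ X Y

namespace BraidedTensor

noncomputable instance : CStarAlgebra (BraidedTensor ζ X Y) :=
  inferInstanceAs (CStarAlgebra (braidedSubalgebra ζ X Y))

/-- The inclusion in `X ⊗ Y ⊗ C(𝕋²_ζ)`. -/
noncomputable def val : BraidedTensor ζ X Y →⋆ₐ[ℂ] Ambient ζ X Y := (braidedSubalgebra ζ X Y).subtype

theorem val_injective : Function.Injective (val ζ (X := X) (Y := Y)) := Subtype.val_injective

theorem isClosedEmbedding_val : IsClosedEmbedding (val ζ (X := X) (Y := Y)) :=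
  IsClosed.isClosedEmbedding_subtypeVal (inferInstanceAs
    (IsClosed (braidedSubalgebra ζ X Y : Set (Ambient ζ X Y))))

theorem j₁_mem (x : X) : Ambient.j₁ ζ X Y x ∈ braidedSubalgebra ζ X Y :=
  StarSubalgebra.le_topologicalClosure _ (StarAlgebra.subset_adjoin ℂ _ (Or.inl ⟨x, rfl⟩))

theorem j₂_mem (y : Y) : Ambient.j₂ ζ X Y y ∈ braidedSubalgebra ζ X Y :=
  StarSubalgebra.le_topologicalClosure _ (StarAlgebra.subset_adjoin ℂ _ (Or.inr ⟨y, rfl⟩))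

/-- A ⋆-homomorphism to `X ⊗ Y ⊗ C(𝕋²_ζ)` with values in `X ⊠_ζ Y`. -/
noncomputable def codRestrict {Z : Type w} [CStarAlgebra Z] (f : Z →⋆ₐ[ℂ] Ambient ζ X Y)
    (hf : ∀ z, f z ∈ braidedSubalgebra ζ X Y) : Z →⋆ₐ[ℂ] BraidedTensor ζ X Y :=
  StarAlgHom.codRestrict f (braidedSubalgebra ζ X Y) hf

theorem val_codRestrict {Z : Type w} [CStarAlgebra Z] (f : Z →⋆ₐ[ℂ] Ambient ζ X Y)
    (hf : ∀ z, f z ∈ braidedSubalgebra ζ X Y) (z : Z) : val ζ (codRestrict ζ f hf z) = f z := rfl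

variable (Y) in
/-- The embedding `j₁ : X → X ⊠_ζ Y`. -/
noncomputable def j₁ : X →⋆ₐ[ℂ] BraidedTensor ζ X Y := codRestrict ζ (Ambient.j₁ ζ X Y) (j₁_mem ζ)

variable (X) in
/-- The embedding `j₂ : Y → X ⊠_ζ Y`. -/
noncomputable def j₂ : Y →⋆ₐ[ℂ] BraidedTensor ζ X Y := codRestrict ζ (Ambient.j₂ ζ X Y) (j₂_mem ζ)

theorem mem_of_closed (S : StarSubalgebra ℂ (BraidedTensor ζ X Y))
    (hS : IsClosed (S : Set (BraidedTensor ζ X Y))) (h1 : ∀ x, j₁ ζ Y x ∈ S) (h2 : ∀ y, j₂ ζ X y ∈ S)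
    (t : BraidedTensor ζ X Y) : t ∈ S := by
  have hcl : IsClosed ((S.map (val ζ) : StarSubalgebra ℂ (Ambient ζ X Y)) : Set (Ambient ζ X Y)) :=
    (isClosedEmbedding_val ζ).isClosedMap _ hS
  have hle : braidedSubalgebra ζ X Y ≤ S.map (val ζ) := by
    refine StarSubalgebra.topologicalClosure_minimal (StarAlgebra.adjoin_le ?_) hcl
    rintro _ (⟨x, rfl⟩ | ⟨y, rfl⟩)
    · exact ⟨j₁ ζ Y x, h1 x, rfl⟩
    · exact ⟨j₂ ζ X y, h2 y, rfl⟩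
  obtain ⟨s, hs, hst⟩ := hle t.2
  have : s = t := val_injective ζ hst
  exact this ▸ hs

theorem hom_ext {Z : Type w} [CStarAlgebra Z] {f g : BraidedTensor ζ X Y →⋆ₐ[ℂ] Z}
    (h1 : ∀ x, f (j₁ ζ Y x) = g (j₁ ζ Y x)) (h2 : ∀ y, f (j₂ ζ X y) = g (j₂ ζ X y)) : f = g := by
  ext t
  exact mem_of_closed ζ (StarAlgHom.equalizer f g)
    (isClosed_eq (starAlgHom_continuous f) (starAlgHom_continuous g)) h1 h2 t

theorem map_mem {f : X →⋆ₐ[ℂ] X'} {g : Y →⋆ₐ[ℂ] Y'} (hf : IsEquivariant f) (hg : IsEquivariant g)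
    (t : BraidedTensor ζ X Y) : Ambient.map ζ f g (val ζ t) ∈ braidedSubalgebra ζ X' Y' := by
  refine mem_of_closed ζ (StarSubalgebra.comap ((Ambient.map ζ f g).comp (val ζ))
    (braidedSubalgebra ζ X' Y')) ?_ (fun x => ?_) (fun y => ?_) t
  · have hcl : IsClosed (braidedSubalgebra ζ X' Y' : Set (Ambient ζ X' Y')) := inferInstance
    exact IsClosed.preimage (starAlgHom_continuous ((Ambient.map ζ f g).comp (val ζ))) hcl
  · change Ambient.map ζ f g (Ambient.j₁ ζ X Y x) ∈ braidedSubalgebra ζ X' Y'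
    rw [Ambient.map_j₁ ζ hf]
    exact j₁_mem ζ _
  · change Ambient.map ζ f g (Ambient.j₂ ζ X Y y) ∈ braidedSubalgebra ζ X' Y'
    rw [Ambient.map_j₂ ζ f hg]
    exact j₂_mem ζ _

/-- The morphism `f ⊠_ζ g` given by equivariant `f` and `g`. -/
noncomputable def map (f : X →⋆ₐ[ℂ] X') (g : Y →⋆ₐ[ℂ] Y') (hf : IsEquivariant f)
    (hg : IsEquivariant g) : BraidedTensor ζ X Y →⋆ₐ[ℂ] BraidedTensor ζ X' Y' :=
  codRestrict ζ ((Ambient.map ζ f g).comp (val ζ)) (map_mem ζ hf hg)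

theorem map_j₁ {f : X →⋆ₐ[ℂ] X'} {g : Y →⋆ₐ[ℂ] Y'} (hf : IsEquivariant f) (hg : IsEquivariant g)
    (x : X) : map ζ f g hf hg (j₁ ζ Y x) = j₁ ζ Y' (f x) :=
  val_injective ζ (Ambient.map_j₁ ζ hf g x)

theorem map_j₂ {f : X →⋆ₐ[ℂ] X'} {g : Y →⋆ₐ[ℂ] Y'} (hf : IsEquivariant f) (hg : IsEquivariant g)
    (y : Y) : map ζ f g hf hg (j₂ ζ X y) = j₂ ζ X' (g y) :=
  val_injective ζ (Ambient.map_j₂ ζ f hg y)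

/-- The map `ρ_z ⊠ ρ_z`. -/
noncomputable def actAt (z : Circle) : BraidedTensor ζ X Y →⋆ₐ[ℂ] BraidedTensor ζ X Y :=
  map ζ (act X z) (act Y z) (isEquivariant_act z) (isEquivariant_act z)

theorem actAt_j₁ (z : Circle) (x : X) : actAt ζ z (j₁ ζ Y x) = j₁ ζ Y (act X z x) := map_j₁ _ _ _ _

theorem actAt_j₂ (z : Circle) (y : Y) : actAt ζ z (j₂ ζ X y) = j₂ ζ X (act Y z y) := map_j₂ _ _ _ _

theorem continuous_actAt (t : BraidedTensor ζ X Y) : Continuous fun z => actAt ζ z t := by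
  let S : StarSubalgebra ℂ (BraidedTensor ζ X Y) :=
    { carrier := {t | Continuous fun z => actAt ζ z t}
      mul_mem' := fun {a b} ha hb => by
        simp only [Set.mem_ofPred_eq, map_mul] at *
        exact ha.mul hb
      one_mem' := by simpa only [Set.mem_ofPred_eq, map_one] using continuous_const
      add_mem' := fun {a b} ha hb => by
        simp only [Set.mem_ofPred_eq, map_add] at *
        exact ha.add hb
      zero_mem' := by simpa only [Set.mem_ofPred_eq, map_zero] using continuous_const
      algebraMap_mem' := fun r => by
        simpa only [Set.mem_ofPred_eq, AlgHomClass.commutes] using continuous_const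
      star_mem' := fun {a} ha => by
        simp only [Set.mem_ofPred_eq, map_star] at *
        exact ha.star }
  refine mem_of_closed ζ S ?_ (fun x => ?_) (fun y => ?_) t
  · refine isClosed_of_closure_subset fun t ht => ?_
    refine continuous_of_uniform_approx_of_continuous fun w hw => ?_
    obtain ⟨ε, hε, hεw⟩ := Metric.mem_uniformity_dist.1 hw
    obtain ⟨s, hs, hst⟩ := Metric.mem_closure_iff.1 ht ε hε
    refine ⟨fun z => actAt ζ z s, hs, fun z => hεw ?_⟩
    rw [dist_eq_norm] at hst ⊢
    rw [← map_sub]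
    exact (NonUnitalStarAlgHom.norm_apply_le (actAt ζ z) _).trans_lt hst
  · change Continuous fun z => actAt ζ z (j₁ ζ Y x)
    simp only [actAt_j₁]
    exact (starAlgHom_continuous (j₁ ζ Y)).comp (continuous_act x)
  · change Continuous fun z => actAt ζ z (j₂ ζ X y)
    simp only [actAt_j₂]
    exact (starAlgHom_continuous (j₂ ζ X)).comp (continuous_act y)

/-- The coaction on `X ⊠_ζ Y` for which `j₁` and `j₂` are equivariant. -/
noncomputable def coactHom : BraidedTensor ζ X Y →⋆ₐ[ℂ] C(Circle, BraidedTensor ζ X Y) where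
  toFun t := ⟨fun z => actAt ζ z t, continuous_actAt ζ t⟩
  map_one' := ContinuousMap.ext fun z => map_one (actAt ζ z)
  map_mul' a b := ContinuousMap.ext fun z => map_mul (actAt ζ z) a b
  map_zero' := ContinuousMap.ext fun z => map_zero (actAt ζ z)
  map_add' a b := ContinuousMap.ext fun z => map_add (actAt ζ z) a b
  commutes' c := ContinuousMap.ext fun z => AlgHomClass.commutes (actAt ζ z) c
  map_star' a := ContinuousMap.ext fun z => map_star (actAt ζ z) a

theorem actAt_actAt (z w : Circle) (t : BraidedTensor ζ X Y) :
    actAt ζ z (actAt ζ w t) = actAt ζ (z * w) t := by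
  have h : (actAt ζ z).comp (actAt ζ w) = actAt ζ (X := X) (Y := Y) (z * w) := by
    refine hom_ext ζ (fun x => ?_) fun y => ?_
    · rw [StarAlgHom.comp_apply, actAt_j₁, actAt_j₁, actAt_j₁, act_act]
    · rw [StarAlgHom.comp_apply, actAt_j₂, actAt_j₂, actAt_j₂, act_act]
  exact DFunLike.congr_fun h t

theorem actAt_one (t : BraidedTensor ζ X Y) : actAt ζ 1 t = t := by
  have h : actAt ζ 1 = StarAlgHom.id ℂ (BraidedTensor ζ X Y) := by
    refine hom_ext ζ (fun x => ?_) fun y => ?_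
    · rw [actAt_j₁, act_one]; rfl
    · rw [actAt_j₂, act_one]; rfl
  exact DFunLike.congr_fun h t

noncomputable instance : CircleAction (BraidedTensor ζ X Y) :=
  ofCoact (coactHom ζ) (fun t z w => actAt_actAt ζ z w t) (actAt_one ζ)

theorem isEquivariant_j₁ : IsEquivariant (j₁ ζ (X := X) Y) := fun z x => actAt_j₁ ζ z x

theorem isEquivariant_j₂ : IsEquivariant (j₂ ζ X (Y := Y)) := fun z x => actAt_j₂ ζ z x

theorem isEquivariant_map {f : X →⋆ₐ[ℂ] X'} {g : Y →⋆ₐ[ℂ] Y'} (hf : IsEquivariant f)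
    (hg : IsEquivariant g) : IsEquivariant (map ζ f g hf hg) := fun z t => by
  have h : (act _ z).comp (map ζ f g hf hg) = (map ζ f g hf hg).comp (act (BraidedTensor ζ X Y) z) := by
    refine hom_ext ζ (fun x => ?_) fun y => ?_
    · rw [StarAlgHom.comp_apply, StarAlgHom.comp_apply, map_j₁, isEquivariant_j₁, isEquivariant_j₁,
        map_j₁, hf]
    · rw [StarAlgHom.comp_apply, StarAlgHom.comp_apply, map_j₂, isEquivariant_j₂, isEquivariant_j₂,
        map_j₂, hg]
  exact DFunLike.congr_fun h t

end BraidedTensor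
end

/-! ### Homogeneous elements -/

section
variable {X : Type u} [CStarAlgebra X] [CircleAction X]

theorem IsHomogeneous.star {x : X} {k : ℤ} (h : IsHomogeneous x k) : IsHomogeneous (star x) (-k) := by
  intro z
  rw [act_star, h z, star_smul, zpow_neg, ← inv_zpow, star_zpow₀]
  congr 2
  rw [← Circle.coe_inv, Circle.coe_inv_eq_conj]; rfl

/-- The coordinate function as a unitary of `C(𝕋)`. -/
noncomputable def coordUnitary : unitary C(Circle, ℂ) :=
  ⟨circleCoord, by
    constructor
    · ext z
      change conj (z : ℂ) * z = 1
      rw [← Circle.coe_inv_eq_conj, ← Circle.coe_mul, inv_mul_cancel, Circle.coe_one]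
    · ext z
      change (z : ℂ) * conj (z : ℂ) = 1
      rw [← Circle.coe_inv_eq_conj, ← Circle.coe_mul, mul_inv_cancel, Circle.coe_one]⟩

theorem map_unitary_zpow {P Q : Type*} [CStarAlgebra P] [CStarAlgebra Q] (f : P →⋆ₐ[ℂ] Q)
    {W : unitary P} {W' : unitary Q} (h : f W = W') (k : ℤ) :
    f ((W ^ k : unitary P) : P) = ((W' ^ k : unitary Q) : Q) := by
  let F : unitary P →* unitary Q :=
    { toFun := fun W => ⟨f W.1, by
        rw [Unitary.mem_iff, ← map_star, ← map_mul, ← map_mul f, Unitary.star_mul_self_of_mem W.2,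
          Unitary.mul_star_self_of_mem W.2, map_one]
        exact ⟨rfl, rfl⟩⟩
      map_one' := Subtype.ext (map_one f)
      map_mul' := fun a b => Subtype.ext (map_mul f a.1 b.1) }
  have h1 : F W = W' := Subtype.ext h
  have h2 := map_zpow F W k
  rw [h1] at h2
  exact congrArg (fun t : unitary Q => (t : Q)) h2

theorem coordUnitary_zpow_apply (k : ℤ) (z : Circle) :
    ((coordUnitary ^ k : unitary C(Circle, ℂ)) : C(Circle, ℂ)) z = (z : ℂ) ^ k := by
  have hz : (z : ℂ) ∈ unitary ℂ := by
    rw [Unitary.mem_iff]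
    constructor
    · change conj (z : ℂ) * z = 1
      rw [← Circle.coe_inv_eq_conj, ← Circle.coe_mul, inv_mul_cancel, Circle.coe_one]
    · change (z : ℂ) * conj (z : ℂ) = 1
      rw [← Circle.coe_inv_eq_conj, ← Circle.coe_mul, mul_inv_cancel, Circle.coe_one]
  exact (map_unitary_zpow (evalAt ℂ z) (W' := ⟨z, hz⟩) rfl k).trans (Unitary.coe_zpow _ _)

theorem circleHom_zpow {Z : Type v} [CStarAlgebra Z] (W : unitary Z) (k : ℤ) :
    circleHom W ((coordUnitary ^ k : unitary C(Circle, ℂ)) : C(Circle, ℂ)) = (W ^ k : unitary Z) :=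
  map_unitary_zpow _ (circleHom_coord W) k

theorem IsHomogeneous.coact {x : X} {k : ℤ} (h : IsHomogeneous x k) :
    coact x = constHom X x * scalarHom X ((coordUnitary ^ k : unitary C(Circle, ℂ)) : C(Circle, ℂ)) := by
  ext z
  refine (h z).trans ?_
  rw [← coordUnitary_zpow_apply, Algebra.smul_def, Algebra.commutes]
  rfl

end

section
variable {X : Type u} {Y : Type v} [CStarAlgebra X] [CStarAlgebra Y]

variable (Y) in
/-- Rotation of functions on the circle. -/
noncomputable def rot (w : Circle) : C(Circle, Y) →⋆ₐ[ℂ] C(Circle, Y) where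
  toFun f := ⟨fun z => f (z * w), by fun_prop⟩
  map_one' := rfl
  map_mul' _ _ := rfl
  map_zero' := rfl
  map_add' _ _ := rfl
  commutes' _ := rfl
  map_star' _ := rfl

theorem pairHom_mul_unitary {Z : Type w} [CStarAlgebra Z] (f : X →⋆ₐ[ℂ] Z) (g : C(Circle, ℂ) →⋆ₐ[ℂ] Z)
    (h : ∀ x y, Commute (f x) (g y)) (T : unitary Z) (hT : ∀ x, f x * T = T * f x) (c : Circle)
    (hc : g circleCoord * T = (c : ℂ) • ((T : Z) * g circleCoord)) (t : C(Circle, X)) :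
    pairHom f g h t * T = T * pairHom f g h (rot X c t) := by
  have key : ((Unitary.conjStarAlgAut ℂ Z T : Z ≃⋆ₐ[ℂ] Z) : Z →⋆ₐ[ℂ] Z).comp
      ((pairHom f g h).comp (rot X c)) = pairHom f g h := by
    refine circleMap_hom_ext (fun x => ?_) ?_
    · change (T : Z) * pairHom f g h (constHom X x) * star (T : Z) = pairHom f g h (constHom X x)
      rw [pairHom_const, ← hT, mul_assoc, Unitary.mul_star_self_of_mem T.2, mul_one]
    · have e : rot X c (scalarHom X circleCoord) = (c : ℂ) • scalarHom X circleCoord := by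
        ext z
        change algebraMap ℂ X ((z * c : Circle) : ℂ) = (c : ℂ) • algebraMap ℂ X (z : ℂ)
        rw [Circle.coe_mul, map_mul, Algebra.smul_def, ← map_mul, ← map_mul, mul_comm]
      change (T : Z) * pairHom f g h (rot X c (scalarHom X circleCoord)) * star (T : Z)
        = pairHom f g h (scalarHom X circleCoord)
      rw [e, map_smul, pairHom_scalar, mul_smul_comm, ← hc, mul_assoc, 
        Unitary.mul_star_self_of_mem T.2, mul_one]
  have h2 : (T : Z) * pairHom f g h (rot X c t) * star (T : Z) = pairHom f g h t :=
    DFunLike.congr_fun key t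
  rw [← h2, mul_assoc, Unitary.star_mul_self_of_mem T.2, mul_one]

theorem commute_pairHom {Z : Type w} [CStarAlgebra Z] (f : X →⋆ₐ[ℂ] Z) (g : C(Circle, ℂ) →⋆ₐ[ℂ] Z)
    (h : ∀ x y, Commute (f x) (g y)) {a : Z} (hf : ∀ x, Commute a (f x)) (hg : ∀ p, Commute a (g p))
    (t : C(Circle, X)) : Commute a (pairHom f g h t) := by
  have hcont : Continuous (pairHom f g h) := starAlgHom_continuous _
  refine denseRange_toCircleMap.induction_on (p := fun t => Commute a (pairHom f g h t)) t
    (isClosed_eq (continuous_const.mul hcont) (hcont.mul continuous_const)) fun s => ?_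
  induction s with
  | zero => rw [map_zero, map_zero]; exact Commute.zero_right a
  | add s t hs ht => rw [map_add, map_add]; exact hs.add_right ht
  | tmul x p =>
    rw [toCircleMap_tmul, map_mul, pairHom_const, pairHom_scalar]
    exact (hf x).mul_right (hg p)

end

theorem NCTorus.zpow_comm (ζ : Circle) (k l : ℤ) :
    ((gen ζ .V ^ l : unitary (NCTorus ζ)) : NCTorus ζ) * (gen ζ .U ^ k : unitary (NCTorus ζ))
      = ((ζ : ℂ) ^ (l * k)) • (((gen ζ .U ^ k : unitary (NCTorus ζ)) : NCTorus ζ)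
          * (gen ζ .V ^ l : unitary (NCTorus ζ))) := by
  let φ : ℂ →⋆ₐ[ℂ] NCTorus ζ :=
    { toAlgHom := Algebra.ofId ℂ _, map_star' := fun c => algebraMap_star_comm c }
  let zu : unitary ℂ := ⟨ζ, by
    rw [Unitary.mem_iff]
    constructor
    · change conj (ζ : ℂ) * ζ = 1
      rw [← Circle.coe_inv_eq_conj, ← Circle.coe_mul, inv_mul_cancel, Circle.coe_one]
    · change (ζ : ℂ) * conj (ζ : ℂ) = 1
      rw [← Circle.coe_inv_eq_conj, ← Circle.coe_mul, mul_inv_cancel, Circle.coe_one]⟩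
  have hφ : algebraMap ℂ (NCTorus ζ) ζ ∈ unitary (NCTorus ζ) := by
    rw [Unitary.mem_iff, ← algebraMap_star_comm, ← map_mul, ← map_mul,
      (Unitary.mem_iff.1 zu.2).1, (Unitary.mem_iff.1 zu.2).2, map_one]
    exact ⟨rfl, rfl⟩
  let c : unitary (NCTorus ζ) := ⟨_, hφ⟩
  have hc : ∀ t : unitary (NCTorus ζ), Commute c t := fun t =>
    Subtype.ext (Algebra.commutes (ζ : ℂ) (t : NCTorus ζ))
  have hcz : ∀ m : ℤ, ((c ^ m : unitary (NCTorus ζ)) : NCTorus ζ) = algebraMap ℂ _ ((ζ : ℂ) ^ m) := by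
    intro m
    have h2 : ((zu ^ m : unitary ℂ) : ℂ) = (ζ : ℂ) ^ m := Unitary.coe_zpow _ _
    rw [← h2]
    exact (map_unitary_zpow φ (W := zu) (W' := c) rfl m).symm
  set U := gen ζ .U
  set V := gen ζ .V
  have h1 : SemiconjBy V U (c * U) := by
    refine Subtype.ext ?_
    change (V : NCTorus ζ) * U = algebraMap ℂ _ (ζ : ℂ) * (U : NCTorus ζ) * V
    rw [mul_assoc, ← Algebra.smul_def]
    exact gen_comm ζ
  have h2 : V * U ^ k = c ^ k * U ^ k * V := by
    have := (h1.zpow_right k).eq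
    rwa [(hc U).mul_zpow] at this
  have h3 : SemiconjBy (U ^ k) V ((c ^ k)⁻¹ * V) := by
    change U ^ k * V = (c ^ k)⁻¹ * V * U ^ k
    rw [mul_assoc, h2, mul_assoc, inv_mul_cancel_left]
  have h4 : U ^ k * V ^ l = (c ^ (l * k))⁻¹ * (V ^ l * U ^ k) := by
    have := (h3.zpow_right l).eq
    rw [(((hc V).zpow_left k).inv_left).mul_zpow, inv_zpow, ← zpow_mul, mul_comm k l, mul_assoc] at this
    exact this
  have h5 : V ^ l * U ^ k = c ^ (l * k) * (U ^ k * V ^ l) := by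
    rw [h4, mul_inv_cancel_left]
  have h6 := congrArg (fun t : unitary (NCTorus ζ) => (t : NCTorus ζ)) h5
  change ((V ^ l : unitary (NCTorus ζ)) : NCTorus ζ) * (U ^ k : unitary (NCTorus ζ))
    = ((c ^ (l * k) : unitary (NCTorus ζ)) : NCTorus ζ)
      * (((U ^ k : unitary (NCTorus ζ)) : NCTorus ζ) * (V ^ l : unitary (NCTorus ζ))) at h6
  rw [hcz, ← Algebra.smul_def] at h6
  exact h6

section
set_option linter.unusedSectionVars false
variable (ζ : Circle) {X : Type u} {Y : Type v} [CStarAlgebra X] [CStarAlgebra Y] [CircleAction X]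
  [CircleAction Y]

theorem Ambient.j₁_of_homogeneous {x : X} {k : ℤ} (h : IsHomogeneous x k) :
    Ambient.j₁ ζ X Y x = MinTensor.inl (MinTensor.inl x)
      * MinTensor.inr ((NCTorus.gen ζ .U ^ k : unitary (NCTorus ζ)) : NCTorus ζ) := by
  rw [Ambient.j₁, StarAlgHom.comp_apply, h.coact, map_mul, pairHom_const, pairHom_scalar,
    StarAlgHom.comp_apply, StarAlgHom.comp_apply, circleHom_zpow]

theorem Ambient.j₂_of_homogeneous {y : Y} {l : ℤ} (h : IsHomogeneous y l) :
    Ambient.j₂ ζ X Y y = MinTensor.inl (MinTensor.inr y)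
      * MinTensor.inr ((NCTorus.gen ζ .V ^ l : unitary (NCTorus ζ)) : NCTorus ζ) := by
  rw [Ambient.j₂, StarAlgHom.comp_apply, h.coact, map_mul, pairHom_const, pairHom_scalar,
    StarAlgHom.comp_apply, StarAlgHom.comp_apply, circleHom_zpow]

theorem coact_act (w : Circle) (y : Y) : coact (act Y w y) = rot Y w (coact y) := by
  ext z; exact act_act z w y

namespace BraidedTensor

theorem j₂_mul_j₁ {x : X} {y : Y} {k l : ℤ} (hx : IsHomogeneous x k) (hy : IsHomogeneous y l) :
    j₂ ζ X y * j₁ ζ Y x = ((ζ : ℂ) ^ (l * k)) • (j₁ ζ Y x * j₂ ζ X y) := by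
  refine val_injective ζ ?_
  rw [map_smul, map_mul, map_mul]
  change Ambient.j₂ ζ X Y y * Ambient.j₁ ζ X Y x
    = ((ζ : ℂ) ^ (l * k)) • (Ambient.j₁ ζ X Y x * Ambient.j₂ ζ X Y y)
  rw [Ambient.j₁_of_homogeneous ζ hx, Ambient.j₂_of_homogeneous ζ hy]
  set a : Ambient ζ X Y := MinTensor.inl (MinTensor.inl x)
  set b : Ambient ζ X Y := MinTensor.inl (MinTensor.inr y)
  set p := ((NCTorus.gen ζ .U ^ k : unitary (NCTorus ζ)) : NCTorus ζ)
  set q := ((NCTorus.gen ζ .V ^ l : unitary (NCTorus ζ)) : NCTorus ζ)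
  have hab : b * a = a * b := by
    rw [← map_mul, ← map_mul, (MinTensor.commute_inl_inr x y).eq]
  have h1 : MinTensor.inr q * a = a * MinTensor.inr q := (MinTensor.commute_inl_inr _ _).eq.symm
  have h2 : MinTensor.inr p * b = b * MinTensor.inr p := (MinTensor.commute_inl_inr _ _).eq.symm
  have h3 : (MinTensor.inr q * MinTensor.inr p : Ambient ζ X Y)
      = ((ζ : ℂ) ^ (l * k)) • (MinTensor.inr p * MinTensor.inr q) := by
    rw [← map_mul, NCTorus.zpow_comm, map_smul, map_mul]
  calc b * MinTensor.inr q * (a * MinTensor.inr p)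
      = b * (MinTensor.inr q * a) * MinTensor.inr p := by simp only [mul_assoc]
    _ = (b * a) * (MinTensor.inr q * MinTensor.inr p) := by rw [h1]; simp only [mul_assoc]
    _ = ((ζ : ℂ) ^ (l * k)) • (a * (b * MinTensor.inr p) * MinTensor.inr q) := by
        rw [hab, h3, mul_smul_comm]; simp only [mul_assoc]
    _ = _ := by rw [← h2]; simp only [mul_assoc]

theorem inr_coord_V_mul (k : ℤ) :
    ((MinTensor.inr (X := MinTensor X Y)).comp (circleHom (NCTorus.gen ζ .V))) circleCoord
        * MinTensor.inr ((NCTorus.gen ζ .U ^ k : unitary (NCTorus ζ)) : NCTorus ζ)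
      = ((ζ ^ k : Circle) : ℂ) • (MinTensor.inr ((NCTorus.gen ζ .U ^ k : unitary (NCTorus ζ)) : NCTorus ζ)
        * ((MinTensor.inr (X := MinTensor X Y)).comp (circleHom (NCTorus.gen ζ .V))) circleCoord) := by
  have := NCTorus.zpow_comm ζ k 1
  rw [zpow_one, one_mul] at this
  rw [StarAlgHom.comp_apply, circleHom_coord, ← map_mul, this, map_smul, map_mul, Circle.coe_zpow]

theorem inr_coord_U_mul (l : ℤ) :
    ((MinTensor.inr (X := MinTensor X Y)).comp (circleHom (NCTorus.gen ζ .U))) circleCoord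
        * MinTensor.inr ((NCTorus.gen ζ .V ^ l : unitary (NCTorus ζ)) : NCTorus ζ)
      = ((ζ ^ (-l) : Circle) : ℂ) • (MinTensor.inr ((NCTorus.gen ζ .V ^ l : unitary (NCTorus ζ)) : NCTorus ζ)
        * ((MinTensor.inr (X := MinTensor X Y)).comp (circleHom (NCTorus.gen ζ .U))) circleCoord) := by
  have := NCTorus.zpow_comm ζ 1 l
  rw [zpow_one, mul_one] at this
  rw [StarAlgHom.comp_apply, circleHom_coord, ← map_mul, ← map_mul, this, map_smul, smul_smul,
    ← Circle.coe_zpow, ← Circle.coe_mul, ← zpow_add, neg_add_cancel, zpow_zero, Circle.coe_one,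
    one_smul]

/-- The image of a unitary of `C(𝕋²_ζ)` in `X ⊗ Y ⊗ C(𝕋²_ζ)`. -/
noncomputable def inrUnitary (X : Type u) (Y : Type v) [CStarAlgebra X] [CStarAlgebra Y]
    (W : unitary (NCTorus ζ)) : unitary (Ambient ζ X Y) :=
  ⟨MinTensor.inr (W : NCTorus ζ), by
    rw [Unitary.mem_iff, ← map_star, ← map_mul, ← map_mul, Unitary.star_mul_self_of_mem W.2,
      Unitary.mul_star_self_of_mem W.2, map_one]
    exact ⟨rfl, rfl⟩⟩

theorem commute_inl_x (x : X) (y : Y) : Commute (MinTensor.inl (MinTensor.inl x) : Ambient ζ X Y)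
    (((MinTensor.inl (Y := NCTorus ζ)).comp (MinTensor.inr (X := X) (Y := Y))) y) := by
  change MinTensor.inl (MinTensor.inl x) * MinTensor.inl (MinTensor.inr y)
    = MinTensor.inl (MinTensor.inr y) * MinTensor.inl (MinTensor.inl x)
  rw [← map_mul, ← map_mul, (MinTensor.commute_inl_inr x y).eq]

theorem commute_inl_y (y : Y) (x : X) : Commute (MinTensor.inl (MinTensor.inr y) : Ambient ζ X Y)
    (((MinTensor.inl (Y := NCTorus ζ)).comp (MinTensor.inl (X := X) (Y := Y))) x) :=
  (commute_inl_x ζ x y).symm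

/-- `j₂(y) j₁(x) = j₁(x) j₂(ρ_{ζ^k}(y))` for `x` of degree `k`. -/
theorem j₂_mul_j₁_act {x : X} {k : ℤ} (hx : IsHomogeneous x k) (y : Y) :
    j₂ ζ X y * j₁ ζ Y x = j₁ ζ Y x * j₂ ζ X (act Y (ζ ^ k) y) := by
  refine val_injective ζ ?_
  rw [map_mul, map_mul]
  change Ambient.j₂ ζ X Y y * Ambient.j₁ ζ X Y x
    = Ambient.j₁ ζ X Y x * Ambient.j₂ ζ X Y (act Y (ζ ^ k) y)
  have hcomm : Commute (MinTensor.inl (MinTensor.inl x)) (Ambient.j₂ ζ X Y y) :=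
    commute_pairHom ((MinTensor.inl (Y := NCTorus ζ)).comp (MinTensor.inr (X := X) (Y := Y)))
      ((MinTensor.inr (X := MinTensor X Y)).comp (circleHom (NCTorus.gen ζ .V)))
      (MinTensor.commute_comp _ _) (commute_inl_x ζ x)
      (fun p => MinTensor.commute_inl_inr _ _) (coact y)
  have h := pairHom_mul_unitary ((MinTensor.inl (Y := NCTorus ζ)).comp (MinTensor.inr (X := X) (Y := Y)))
    ((MinTensor.inr (X := MinTensor X Y)).comp (circleHom (NCTorus.gen ζ .V)))
    (MinTensor.commute_comp _ _) (inrUnitary ζ X Y (NCTorus.gen ζ .U ^ k))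
    (fun y => MinTensor.commute_inl_inr _ _) (ζ ^ k) (inr_coord_V_mul ζ k) (coact y)
  rw [← coact_act] at h
  change Ambient.j₂ ζ X Y y * MinTensor.inr _ = MinTensor.inr _ * Ambient.j₂ ζ X Y (act Y (ζ ^ k) y) at h
  rw [Ambient.j₁_of_homogeneous ζ hx, ← mul_assoc, ← hcomm.eq, mul_assoc, mul_assoc]
  exact congrArg _ h

/-- `j₁(x) j₂(y) = j₂(y) j₁(ρ_{ζ^{-l}}(x))` for `y` of degree `l`. -/
theorem j₁_mul_j₂_act {y : Y} {l : ℤ} (hy : IsHomogeneous y l) (x : X) :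
    j₁ ζ Y x * j₂ ζ X y = j₂ ζ X y * j₁ ζ Y (act X (ζ ^ (-l)) x) := by
  refine val_injective ζ ?_
  rw [map_mul, map_mul]
  change Ambient.j₁ ζ X Y x * Ambient.j₂ ζ X Y y
    = Ambient.j₂ ζ X Y y * Ambient.j₁ ζ X Y (act X (ζ ^ (-l)) x)
  have hcomm : Commute (MinTensor.inl (MinTensor.inr y)) (Ambient.j₁ ζ X Y x) :=
    commute_pairHom ((MinTensor.inl (Y := NCTorus ζ)).comp (MinTensor.inl (X := X) (Y := Y)))
      ((MinTensor.inr (X := MinTensor X Y)).comp (circleHom (NCTorus.gen ζ .U)))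
      (MinTensor.commute_comp _ _) (commute_inl_y ζ y)
      (fun p => MinTensor.commute_inl_inr _ _) (coact x)
  have h := pairHom_mul_unitary ((MinTensor.inl (Y := NCTorus ζ)).comp (MinTensor.inl (X := X) (Y := Y)))
    ((MinTensor.inr (X := MinTensor X Y)).comp (circleHom (NCTorus.gen ζ .U)))
    (MinTensor.commute_comp _ _) (inrUnitary ζ X Y (NCTorus.gen ζ .V ^ l))
    (fun y => MinTensor.commute_inl_inr _ _) (ζ ^ (-l)) (inr_coord_U_mul ζ l) (coact x)
  rw [← coact_act] at h
  change Ambient.j₁ ζ X Y x * MinTensor.inr _ = MinTensor.inr _ * Ambient.j₁ ζ X Y (act X (ζ ^ (-l)) x) at h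
  rw [Ambient.j₂_of_homogeneous ζ hy, ← mul_assoc, ← hcomm.eq, mul_assoc, mul_assoc]
  exact congrArg _ h

end BraidedTensor
end

/-! ### Braided compact quantum groups -/

section
variable (ζ : Circle) (X : Type u) (Y : Type v) (Z : Type w) [CStarAlgebra X] [CStarAlgebra Y]
  [CStarAlgebra Z] [CircleAction X] [CircleAction Y] [CircleAction Z]

/-- The graph of the canonical identification `(X ⊠ Y) ⊠ Z ≅ X ⊠ (Y ⊠ Z)`, that is the closed
⋆-subalgebra generated by the pairs of corresponding copies of the elements of `X`, `Y`, `Z`. -/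
noncomputable def associatorGraph : StarSubalgebra ℂ
    (BraidedTensor ζ (BraidedTensor ζ X Y) Z × BraidedTensor ζ X (BraidedTensor ζ Y Z)) :=
  (StarAlgebra.adjoin ℂ
    (Set.range (fun x : X => (BraidedTensor.j₁ ζ Z (BraidedTensor.j₁ ζ Y x),
        BraidedTensor.j₁ ζ (BraidedTensor ζ Y Z) x)) ∪
     Set.range (fun y : Y => (BraidedTensor.j₁ ζ Z (BraidedTensor.j₂ ζ X y),
        BraidedTensor.j₂ ζ X (BraidedTensor.j₁ ζ Z y))) ∪
     Set.range (fun z : Z => (BraidedTensor.j₂ ζ (BraidedTensor ζ X Y) z,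
        BraidedTensor.j₂ ζ X (BraidedTensor.j₂ ζ Y z))))).topologicalClosure

theorem associatorGraph_mem₁ (x : X) : (BraidedTensor.j₁ ζ Z (BraidedTensor.j₁ ζ Y x),
    BraidedTensor.j₁ ζ (BraidedTensor ζ Y Z) x) ∈ associatorGraph ζ X Y Z :=
  StarSubalgebra.le_topologicalClosure _ (StarAlgebra.subset_adjoin ℂ _ (Or.inl (Or.inl ⟨x, rfl⟩)))

theorem associatorGraph_mem₂ (y : Y) : (BraidedTensor.j₁ ζ Z (BraidedTensor.j₂ ζ X y),
    BraidedTensor.j₂ ζ X (BraidedTensor.j₁ ζ Z y)) ∈ associatorGraph ζ X Y Z :=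
  StarSubalgebra.le_topologicalClosure _ (StarAlgebra.subset_adjoin ℂ _ (Or.inl (Or.inr ⟨y, rfl⟩)))

theorem associatorGraph_mem₃ (z : Z) : (BraidedTensor.j₂ ζ (BraidedTensor ζ X Y) z,
    BraidedTensor.j₂ ζ X (BraidedTensor.j₂ ζ Y z)) ∈ associatorGraph ζ X Y Z :=
  StarSubalgebra.le_topologicalClosure _ (StarAlgebra.subset_adjoin ℂ _ (Or.inr ⟨z, rfl⟩))

end

theorem isEquivariant_id (X : Type u) [CStarAlgebra X] [CircleAction X] :
    IsEquivariant (StarAlgHom.id ℂ X) := fun _ _ => rfl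

/-- The closed linear span of the products `f(a) g(b)`. -/
noncomputable def spanProd {X : Type u} {Z : Type v} [CStarAlgebra X] [CStarAlgebra Z] (f g : X →⋆ₐ[ℂ] Z) :
    Submodule ℂ Z := (Submodule.span ℂ {t | ∃ a b, t = f a * g b}).topologicalClosure

/-- A braided compact quantum group over `𝕋` with parameter `ζ`. -/
structure BraidedCQG (ζ : Circle) where
  /-- The algebra `C(G)`. -/
  Alg : Type u
  [cstar : CStarAlgebra Alg]
  [action : CircleAction Alg]
  /-- The comultiplication. -/
  Δ : Alg →⋆ₐ[ℂ] BraidedTensor ζ Alg Alg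
  equivariant : IsEquivariant Δ
  /-- `(Δ ⊠ id) Δ = (id ⊠ Δ) Δ`. -/
  coassociative : ∀ x,
    (BraidedTensor.map ζ Δ (StarAlgHom.id ℂ Alg) equivariant (isEquivariant_id Alg) (Δ x),
      BraidedTensor.map ζ (StarAlgHom.id ℂ Alg) Δ (isEquivariant_id Alg) equivariant (Δ x))
      ∈ associatorGraph ζ Alg Alg Alg
  simplifiable_right : spanProd Δ (BraidedTensor.j₂ ζ Alg) = ⊤
  simplifiable_left : spanProd Δ (BraidedTensor.j₁ ζ Alg) = ⊤

attribute [instance] BraidedCQG.cstar BraidedCQG.action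

/-- `φ` is a `𝕋`-equivariant Hopf ⋆-homomorphism `C(G) → C(K)`: it is equivariant and
`Δ_K φ = (φ ⊠ φ) Δ_G`. -/
def IsHopfHom {ζ : Circle} {G K : BraidedCQG.{u} ζ} (φ : G.Alg →⋆ₐ[ℂ] K.Alg) : Prop :=
  ∃ h : IsEquivariant φ, ∀ x, K.Δ (φ x) = BraidedTensor.map ζ φ φ h h (G.Δ x)

/-! ### Finite-dimensional representations -/

/-- A strongly continuous unitary representation of the circle. -/
structure CircleRep (H : Type v) [NormedAddCommGroup H] [InnerProductSpace ℂ H] where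
  /-- The unitary operators. -/
  op : Circle →* (H ≃ₗᵢ[ℂ] H)
  continuous_op : ∀ x, Continuous fun z => op z x

section
variable {H : Type v} [NormedAddCommGroup H] [InnerProductSpace ℂ H]

/-- The action `x ↦ U(z) x U(z)*` of the circle on `L(H)`. -/
noncomputable def CircleRep.ad (U : CircleRep H) (z : Circle) : Module.End ℂ H →ₗ[ℂ] Module.End ℂ H :=
  ((U.op z).toLinearEquiv.conj : Module.End ℂ H ≃ₗ[ℂ] Module.End ℂ H).toLinearMap

/-- The map `id ⊗ f` on `L(H) ⊗ X`. -/
noncomputable def legMap (H : Type v) [NormedAddCommGroup H] [InnerProductSpace ℂ H] {X : Type u}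
    {Z : Type w} [CStarAlgebra X] [CStarAlgebra Z] (f : X →⋆ₐ[ℂ] Z) :
    Module.End ℂ H ⊗[ℂ] X →ₗ[ℂ] Module.End ℂ H ⊗[ℂ] Z :=
  LinearMap.lTensor (Module.End ℂ H) f.toAlgHom.toLinearMap

/-- A representation `(H, U, u)` of a braided compact quantum group on a finite-dimensional Hilbert
space. -/
structure FinRep {ζ : Circle} (G : BraidedCQG.{u} ζ) (H : Type v) [NormedAddCommGroup H]
    [InnerProductSpace ℂ H] [FiniteDimensional ℂ H] where
  /-- The representation of the circle on `H`. -/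
  U : CircleRep H
  /-- The element of `L(H) ⊗ C(G)`. -/
  u : Module.End ℂ H ⊗[ℂ] G.Alg
  invariant : ∀ z, TensorProduct.map (U.ad z) (act G.Alg z).toAlgHom.toLinearMap u = u
  corep : legMap H G.Δ u
    = legMap H (BraidedTensor.j₁ ζ G.Alg) u * legMap H (BraidedTensor.j₂ ζ G.Alg) u

/-- The representation is unitary. -/
def FinRep.IsUnitary {ζ : Circle} {G : BraidedCQG.{u} ζ} [FiniteDimensional ℂ H] (v : FinRep G H) :
    Prop := v.u ∈ unitary (Module.End ℂ H ⊗[ℂ] G.Alg)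

/-- Two representations are equivalent: there is an invertible `T` with `w = (T ⊗ 1) v (T⁻¹ ⊗ 1)`. -/
def FinRep.Equivalent {ζ : Circle} {G : BraidedCQG.{u} ζ} [FiniteDimensional ℂ H] {K : Type w}
    [NormedAddCommGroup K] [InnerProductSpace ℂ K] [FiniteDimensional ℂ K] (v : FinRep G H)
    (v' : FinRep G K) : Prop :=
  ∃ T : H ≃ₗ[ℂ] K, v'.u = LinearMap.rTensor G.Alg
    (T.conj : Module.End ℂ H ≃ₗ[ℂ] Module.End ℂ K).toLinearMap v.u

end

/-! ### The conjugate Hilbert space -/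

/-- The conjugate Hilbert space. -/
def ConjSpace (H : Type v) : Type v := H

namespace ConjSpace
variable {H : Type v} [NormedAddCommGroup H] [InnerProductSpace ℂ H]

noncomputable instance : NormedAddCommGroup (ConjSpace H) := inferInstanceAs (NormedAddCommGroup H)

/-- The identity map from `H` to its conjugate. -/
def bar : H ≃+ ConjSpace H := AddEquiv.refl H

noncomputable instance : Module ℂ (ConjSpace H) where
  smul c x := bar (conj c • bar.symm x)
  one_smul x := by
    change bar (conj (1 : ℂ) • bar.symm x) = x
    simp
  mul_smul a b x := by
    change bar (conj (a * b) • bar.symm x) = bar (conj a • conj b • bar.symm x)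
    rw [map_mul, mul_smul]
  smul_zero a := by
    change bar (conj a • (0 : H)) = 0
    rw [smul_zero]; rfl
  smul_add a x y := by
    change bar (conj a • (bar.symm x + bar.symm y)) = _
    rw [smul_add]; rfl
  add_smul a b x := by
    change bar (conj (a + b) • bar.symm x) = _
    rw [map_add, add_smul]; rfl
  zero_smul x := by
    change bar (conj (0 : ℂ) • bar.symm x) = 0
    simp

theorem smul_bar (c : ℂ) (x : H) : c • bar x = bar (conj c • x) := rfl

noncomputable instance : NormedSpace ℂ (ConjSpace H) where
  norm_smul_le c x := by
    change ‖conj c • bar.symm x‖ ≤ _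
    rw [norm_smul, RCLike.norm_conj]; rfl

/-- The inner product is `⟪x̄, ȳ⟫ = ⟪y, x⟫`. -/
noncomputable instance : InnerProductSpace ℂ (ConjSpace H) where
  inner x y := ⟪bar.symm y, bar.symm x⟫_ℂ
  norm_sq_eq_re_inner x := norm_sq_eq_re_inner (𝕜 := ℂ) (bar.symm x)
  conj_inner_symm x y := inner_conj_symm (𝕜 := ℂ) (bar.symm y) (bar.symm x)
  add_left x y z := inner_add_right (𝕜 := ℂ) (bar.symm z) (bar.symm x) (bar.symm y)
  smul_left x y c := inner_smul_right (𝕜 := ℂ) (bar.symm y) (bar.symm x) (conj c)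

theorem inner_bar (x y : H) : ⟪bar x, bar y⟫_ℂ = ⟪y, x⟫_ℂ := rfl

instance [FiniteDimensional ℂ H] : FiniteDimensional ℂ (ConjSpace H) := by
  obtain ⟨s, hs⟩ := (Module.finite_def.1 (inferInstance : Module.Finite ℂ H))
  classical
  refine ⟨s.image bar, ?_⟩
  rw [Submodule.eq_top_iff'] at hs ⊢
  intro x
  rw [Finset.coe_image]
  refine Submodule.span_induction (p := fun x _ => bar x ∈ Submodule.span ℂ (bar '' (s : Set H)))
    (fun x hx => Submodule.subset_span ⟨x, hx, rfl⟩) ?_ (fun x y _ _ hx hy => ?_) (fun c x _ hx => ?_) (hs x)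
  · exact Submodule.zero_mem _
  · exact Submodule.add_mem _ hx hy
  · have := Submodule.smul_mem _ (conj c) hx
    rw [smul_bar, Complex.conj_conj] at this
    exact this

/-- The conjugate `x̄ ↦ \overline{T x}` of an isometry. -/
noncomputable def barIso (T : H ≃ₗᵢ[ℂ] H) : ConjSpace H ≃ₗᵢ[ℂ] ConjSpace H where
  toFun x := bar (T (bar.symm x))
  invFun x := bar (T.symm (bar.symm x))
  left_inv x := T.symm_apply_apply (bar.symm x)
  right_inv x := T.apply_symm_apply (bar.symm x)
  map_add' x y := map_add T (bar.symm x) (bar.symm y)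
  map_smul' c x := map_smul T (conj c) (bar.symm x)
  norm_map' x := T.norm_map (bar.symm x)

theorem barIso_bar (T : H ≃ₗᵢ[ℂ] H) (x : H) : barIso T (bar x) = bar (T x) := rfl

/-- The conjugate of a basis. -/
noncomputable def basis {n : ℕ} (b : Module.Basis (Fin n) ℂ H) : Module.Basis (Fin n) ℂ (ConjSpace H) :=
  Module.Basis.ofEquivFun
    { toFun := fun x i => conj (b.repr (bar.symm x) i)
      invFun := fun c => bar (b.equivFun.symm fun i => conj (c i))
      left_inv := fun x => by
        simp only [Complex.conj_conj]
        exact b.equivFun.symm_apply_apply (bar.symm x)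
      right_inv := fun c => by
        funext i
        have h := congrFun (b.equivFun.apply_symm_apply fun i => conj (c i)) i
        change conj (b.equivFun (b.equivFun.symm fun i => conj (c i)) i) = c i
        rw [h, Complex.conj_conj]
      map_add' := fun x y => by
        funext i
        change conj (b.repr (bar.symm x + bar.symm y) i) = _
        rw [map_add, Finsupp.add_apply, map_add]; rfl
      map_smul' := fun c x => by
        funext i
        change conj (b.repr (conj c • bar.symm x) i) = _
        rw [map_smul, Finsupp.smul_apply, smul_eq_mul, map_mul, Complex.conj_conj]; rfl }

theorem basis_apply {n : ℕ} (b : Module.Basis (Fin n) ℂ H) (i : Fin n) : basis b i = bar (b i) := by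
  refine (basis b).repr.injective ?_
  ext j
  rw [Module.Basis.repr_self]
  change _ = conj (b.repr (b i) j)
  rw [Module.Basis.repr_self, Finsupp.single_apply]
  split <;> simp

end ConjSpace

/-- The conjugate representation of the circle. -/
noncomputable def CircleRep.bar {H : Type v} [NormedAddCommGroup H] [InnerProductSpace ℂ H]
    (U : CircleRep H) : CircleRep (ConjSpace H) where
  op :=
    { toFun := fun z => ConjSpace.barIso (U.op z)
      map_one' := by
        rw [map_one]; rfl
      map_mul' := fun z w => by
        rw [map_mul]; rfl }
  continuous_op x := U.continuous_op (ConjSpace.bar.symm x)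

/-! ### Matrices over C⋆-algebras -/

section
variable {n : ℕ}

/-- The matrix `w̄_ζ` with entries `ζ^{d_i (d_j - d_i)} w_ij^*`. -/
noncomputable def conjMatrix {B : Type u} [Ring B] [StarRing B] [Algebra ℂ B] (ζ : Circle)
    (d : Fin n → ℤ) (w : Matrix (Fin n) (Fin n) B) : Matrix (Fin n) (Fin n) B :=
  Matrix.of fun i j => ((ζ : ℂ) ^ (d i * (d j - d i))) • star (w i j)

/-- A scalar matrix, with entries in `B`. -/
noncomputable def scalarMatrix (B : Type u) [Ring B] [Algebra ℂ B]
    (F : Matrix (Fin n) (Fin n) ℂ) : Matrix (Fin n) (Fin n) B := F.map (algebraMap ℂ B)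

/-- The matrix `F w̄_ζ F⁻¹`. -/
noncomputable def twistedMatrix {B : Type u} [Ring B] [StarRing B] [Algebra ℂ B] (ζ : Circle)
    (d : Fin n → ℤ) (F : GL (Fin n) ℂ) (w : Matrix (Fin n) (Fin n) B) : Matrix (Fin n) (Fin n) B :=
  scalarMatrix B (F : Matrix (Fin n) (Fin n) ℂ) * conjMatrix ζ d w
    * scalarMatrix B ((F⁻¹ : GL (Fin n) ℂ) : Matrix (Fin n) (Fin n) ℂ)

section
set_option linter.unusedSectionVars false
variable {B : Type u} {B' : Type v} [Ring B] [StarRing B] [Algebra ℂ B] [Ring B'] [StarRing B']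
  [Algebra ℂ B'] (f : B →⋆ₐ[ℂ] B') (ζ : Circle) (d : Fin n → ℤ)

theorem map_conjMatrix (w : Matrix (Fin n) (Fin n) B) :
    (conjMatrix ζ d w).map f = conjMatrix ζ d (w.map f) := by
  ext i j
  simp only [conjMatrix, Matrix.map_apply, Matrix.of_apply]
  rw [map_smul, map_star]

theorem map_scalarMatrix (F : Matrix (Fin n) (Fin n) ℂ) :
    (scalarMatrix B F).map f = scalarMatrix B' F := by
  ext i j
  exact AlgHomClass.commutes f _

theorem map_mul_matrix (w w' : Matrix (Fin n) (Fin n) B) : (w * w').map f = w.map f * w'.map f := by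
  ext i j
  simp only [Matrix.map_apply, Matrix.mul_apply]
  rw [map_sum]
  exact Finset.sum_congr rfl fun k _ => map_mul f _ _

theorem map_star_matrix (w : Matrix (Fin n) (Fin n) B) : (star w).map f = star (w.map f) := by
  ext i j
  exact map_star f _

theorem map_one_matrix : (1 : Matrix (Fin n) (Fin n) B).map f = 1 :=
  Matrix.map_one _ (map_zero f) (map_one f)

theorem map_twistedMatrix (F : GL (Fin n) ℂ) (w : Matrix (Fin n) (Fin n) B) :
    (twistedMatrix ζ d F w).map f = twistedMatrix ζ d F (w.map f) := by
  rw [twistedMatrix, map_mul_matrix, map_mul_matrix, map_conjMatrix, map_scalarMatrix,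
    map_scalarMatrix, twistedMatrix]

theorem map_mem_unitary {w : Matrix (Fin n) (Fin n) B} (hw : w ∈ unitary (Matrix (Fin n) (Fin n) B)) :
    w.map f ∈ unitary (Matrix (Fin n) (Fin n) B') := by
  rw [Unitary.mem_iff] at hw ⊢
  rw [← map_star_matrix, ← map_mul_matrix, ← map_mul_matrix, hw.1, hw.2, map_one_matrix]
  exact ⟨rfl, rfl⟩

variable (B) in
theorem scalarMatrix_mul_inv (F : GL (Fin n) ℂ) :
    scalarMatrix B (F : Matrix (Fin n) (Fin n) ℂ)
      * scalarMatrix B ((F⁻¹ : GL (Fin n) ℂ) : Matrix (Fin n) (Fin n) ℂ) = 1 := by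
  rw [scalarMatrix, scalarMatrix, ← Matrix.map_mul, ← Units.val_mul, mul_inv_cancel, Units.val_one]
  exact Matrix.map_one _ (map_zero _) (map_one _)

variable (B) in
theorem scalarMatrix_inv_mul (F : GL (Fin n) ℂ) :
    scalarMatrix B ((F⁻¹ : GL (Fin n) ℂ) : Matrix (Fin n) (Fin n) ℂ)
      * scalarMatrix B (F : Matrix (Fin n) (Fin n) ℂ) = 1 := by
  rw [scalarMatrix, scalarMatrix, ← Matrix.map_mul, ← Units.val_mul, inv_mul_cancel, Units.val_one]
  exact Matrix.map_one _ (map_zero _) (map_one _)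

end

theorem norm_entry_le {Z : Type u} [CStarAlgebra Z] {w : Matrix (Fin n) (Fin n) Z}
    (hw : star w * w = 1) (i j : Fin n) : ‖w i j‖ ≤ 1 := by
  let _ := CStarAlgebra.spectralOrder Z
  have _ := CStarAlgebra.spectralOrderedRing Z
  have h1 : ∑ k, star (w k j) * w k j = 1 := by
    have := congrFun (congrFun hw j) j
    rw [Matrix.mul_apply, Matrix.one_apply_eq] at this
    exact this
  have h2 : star (w i j) * w i j ≤ 1 := by
    rw [← h1]
    exact Finset.single_le_sum (f := fun k => star (w k j) * w k j)
      (fun k _ => star_mul_self_nonneg _) (Finset.mem_univ i)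
  have h3 := CStarAlgebra.norm_le_norm_of_nonneg_of_le (star_mul_self_nonneg _) h2
  rw [CStarRing.norm_star_mul_self] at h3
  have hone : ‖(1 : Z)‖ ≤ 1 := by
    have h := CStarRing.norm_star_mul_self (x := (1 : Z))
    simp only [star_one, mul_one] at h
    by_contra hcon
    push Not at hcon
    nlinarith
  nlinarith [norm_nonneg (w i j)]

/-- Conjugating by a diagonal unitary scalar matrix. -/
theorem diag_mem_unitary {Z : Type u} [CStarAlgebra Z] {w w' : Matrix (Fin n) (Fin n) Z}
    (hw : w ∈ unitary (Matrix (Fin n) (Fin n) Z)) (d : Fin n → ℤ) (z : Circle)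
    (h : ∀ i j, w' i j = ((z : ℂ) ^ (d j - d i)) • w i j) : w' ∈ unitary (Matrix (Fin n) (Fin n) Z) := by
  have hstar : ∀ k : ℤ, star ((z : ℂ) ^ k) = (z : ℂ) ^ (-k) := fun k => by
    rw [star_zpow₀, zpow_neg, ← inv_zpow]
    congr 1
    rw [← Circle.coe_inv, Circle.coe_inv_eq_conj]; rfl
  have hz : (z : ℂ) ≠ 0 := Circle.coe_ne_zero z
  rw [Unitary.mem_iff] at hw ⊢
  constructor
  · ext i j
    have h1 := congrFun (congrFun hw.1 i) j
    rw [Matrix.mul_apply] at h1 ⊢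
    have h2 : ∀ k, star w' i k * w' k j = ((z : ℂ) ^ (d j - d i)) • (star w i k * w k j) := fun k => by
      change star (w' k i) * w' k j = _ • (star (w k i) * w k j)
      rw [h, h, star_smul, hstar, smul_mul_smul_comm, ← zpow_add₀ hz]
      congr 2; ring
    simp only [h2]
    rw [← Finset.smul_sum, h1]
    by_cases hij : i = j
    · subst hij; simp
    · rw [Matrix.one_apply_ne hij, smul_zero]
  · ext i j
    have h1 := congrFun (congrFun hw.2 i) j
    rw [Matrix.mul_apply] at h1 ⊢
    have h2 : ∀ k, w' i k * star w' k j = ((z : ℂ) ^ (d j - d i)) • (w i k * star w k j) := fun k => by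
      change w' i k * star (w' j k) = _ • (w i k * star (w j k))
      rw [h, h, star_smul, hstar, smul_mul_smul_comm, ← zpow_add₀ hz]
      congr 2; ring
    simp only [h2]
    rw [← Finset.smul_sum, h1]
    by_cases hij : i = j
    · subst hij; simp
    · rw [Matrix.one_apply_ne hij, smul_zero]

/-- The conjugate of a product of copies of a matrix with homogeneous entries. -/
theorem conjMatrix_mul (ζ : Circle) {X : Type u} {Y : Type v} [CStarAlgebra X] [CStarAlgebra Y]
    [CircleAction X] [CircleAction Y] (d : Fin n → ℤ) {w : Matrix (Fin n) (Fin n) X}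
    {w' : Matrix (Fin n) (Fin n) Y} (hw : ∀ i j, IsHomogeneous (w i j) (d j - d i))
    (hw' : ∀ i j, IsHomogeneous (w' i j) (d j - d i)) :
    conjMatrix ζ d (w.map (BraidedTensor.j₁ ζ Y) * w'.map (BraidedTensor.j₂ ζ X))
      = (conjMatrix ζ d w).map (BraidedTensor.j₁ ζ Y) * (conjMatrix ζ d w').map (BraidedTensor.j₂ ζ X) := by
  ext i j
  simp only [conjMatrix, Matrix.of_apply, Matrix.mul_apply, Matrix.map_apply]
  rw [star_sum, Finset.smul_sum]
  refine Finset.sum_congr rfl fun k _ => ?_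
  rw [star_mul, ← map_star, ← map_star, BraidedTensor.j₂_mul_j₁ ζ (hw i k).star (hw' k j).star,
    map_smul, map_smul, smul_mul_smul_comm, smul_smul, ← zpow_add₀ (Circle.coe_ne_zero ζ),
    ← zpow_add₀ (Circle.coe_ne_zero ζ)]
  congr 2
  ring

theorem twistedMatrix_mul (ζ : Circle) {X : Type u} {Y : Type v} [CStarAlgebra X] [CStarAlgebra Y]
    [CircleAction X] [CircleAction Y] (d : Fin n → ℤ) (F : GL (Fin n) ℂ) {w : Matrix (Fin n) (Fin n) X}
    {w' : Matrix (Fin n) (Fin n) Y} (hw : ∀ i j, IsHomogeneous (w i j) (d j - d i))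
    (hw' : ∀ i j, IsHomogeneous (w' i j) (d j - d i)) :
    twistedMatrix ζ d F (w.map (BraidedTensor.j₁ ζ Y) * w'.map (BraidedTensor.j₂ ζ X))
      = (twistedMatrix ζ d F w).map (BraidedTensor.j₁ ζ Y)
        * (twistedMatrix ζ d F w').map (BraidedTensor.j₂ ζ X) := by
  rw [twistedMatrix, conjMatrix_mul ζ d hw hw', twistedMatrix, twistedMatrix, map_mul_matrix,
    map_mul_matrix, map_mul_matrix, map_mul_matrix, map_scalarMatrix, map_scalarMatrix,
    map_scalarMatrix, map_scalarMatrix]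
  set P := scalarMatrix (BraidedTensor ζ X Y) (F : Matrix (Fin n) (Fin n) ℂ)
  set Q := scalarMatrix (BraidedTensor ζ X Y) ((F⁻¹ : GL (Fin n) ℂ) : Matrix (Fin n) (Fin n) ℂ)
  have h : Q * P = 1 := scalarMatrix_inv_mul _ F
  set a := (conjMatrix ζ d w).map (BraidedTensor.j₁ ζ Y)
  set b := (conjMatrix ζ d w').map (BraidedTensor.j₂ ζ X)
  calc P * (a * b) * Q = P * a * 1 * b * Q := by rw [mul_one]; simp only [mul_assoc]
    _ = _ := by rw [← h]; simp only [mul_assoc]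

end

/-! ### The braided free unitary quantum group -/

/-- `F ∈ GL(n, ℂ)` is admissible, with the integers `d_1, …, d_n` in the rôle of the degrees. -/
def IsAdmissible {n : ℕ} (d : Fin n → ℤ) (F : GL (Fin n) ℂ) : Prop :=
  ∃ (d' : Fin n → ℤ) (δ : ℤ), ∀ i j, -d j + δ ≠ d' i →
    (F : Matrix (Fin n) (Fin n) ℂ) i j = 0
      ∧ ((F⁻¹ : GL (Fin n) ℂ) : Matrix (Fin n) (Fin n) ℂ) j i = 0

namespace UPlus
variable (ζ : Circle) {n : ℕ} (d : Fin n → ℤ) (F : GL (Fin n) ℂ)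

/-- The index set of the generators. -/
abbrev Idx (n : ℕ) : Type u := ULift.{u} (Fin n × Fin n)

/-- The matrix of free generators. -/
noncomputable def freeMatrix (n : ℕ) : Matrix (Fin n) (Fin n) (FreeStarAlg (Idx.{u} n)) :=
  Matrix.of fun i j => FreeStarAlg.gen ⟨(i, j)⟩

/-- The relations: the entries of `u* u - 1`, `u u* - 1`, `u'* u' - 1`, `u' u'* - 1`, where
`u' = F ū_ζ F⁻¹`. -/
noncomputable def rel : Set (FreeStarAlg (Idx.{u} n)) :=
  {r | ∃ w ∈ ({freeMatrix n, twistedMatrix ζ d F (freeMatrix n)} :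
      Set (Matrix (Fin n) (Fin n) (FreeStarAlg (Idx.{u} n)))),
    ∃ i j, r = (star w * w - 1) i j ∨ r = (w * star w - 1) i j}

theorem unitary_of_rel {B : Type v} [CStarAlgebra B] (f : FreeStarAlg (Idx.{u} n) →⋆ₐ[ℂ] B)
    (h : ∀ r ∈ rel ζ d F, f r = 0) {w : Matrix (Fin n) (Fin n) (FreeStarAlg (Idx.{u} n))}
    (hw : w ∈ ({freeMatrix n, twistedMatrix ζ d F (freeMatrix n)} :
      Set (Matrix (Fin n) (Fin n) (FreeStarAlg (Idx.{u} n))))) :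
    w.map f ∈ unitary (Matrix (Fin n) (Fin n) B) := by
  rw [Unitary.mem_iff, ← map_star_matrix, ← map_mul_matrix, ← map_mul_matrix, ← map_one_matrix f]
  constructor
  · ext i j
    have := h _ ⟨w, hw, i, j, Or.inl rfl⟩
    rw [Matrix.sub_apply, map_sub, sub_eq_zero] at this
    exact this
  · ext i j
    have := h _ ⟨w, hw, i, j, Or.inr rfl⟩
    rw [Matrix.sub_apply, map_sub, sub_eq_zero] at this
    exact this

theorem rel_of_unitary {B : Type v} [CStarAlgebra B] (f : FreeStarAlg (Idx.{u} n) →⋆ₐ[ℂ] B)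
    (h1 : (freeMatrix n).map f ∈ unitary (Matrix (Fin n) (Fin n) B))
    (h2 : twistedMatrix ζ d F ((freeMatrix n).map f) ∈ unitary (Matrix (Fin n) (Fin n) B)) :
    ∀ r ∈ rel ζ d F, f r = 0 := by
  rintro r ⟨w, hw, i, j, hr⟩
  have hwu : w.map f ∈ unitary (Matrix (Fin n) (Fin n) B) := by
    rcases hw with rfl | hw
    · exact h1
    · rw [Set.mem_singleton_iff] at hw
      rw [hw, map_twistedMatrix]; exact h2
  rw [Unitary.mem_iff, ← map_star_matrix, ← map_mul_matrix, ← map_mul_matrix, ← map_one_matrix f] at hwu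
  rcases hr with rfl | rfl
  · rw [Matrix.sub_apply, map_sub, sub_eq_zero]
    exact congrFun (congrFun hwu.1 i) j
  · rw [Matrix.sub_apply, map_sub, sub_eq_zero]
    exact congrFun (congrFun hwu.2 i) j

theorem bounded : BoundedRel (rel.{u} ζ d F) := by
  rintro ⟨i, j⟩
  refine ⟨1, fun p => ?_⟩
  have h := unitary_of_rel ζ d F p.1.toCompHom (fun r hr => by
    rw [← norm_le_zero_iff]
    exact ((p.1.norm_toComp r).trans (p.2 r hr)).le) (w := freeMatrix n) (Or.inl rfl)
  exact (p.1.norm_toComp _).ge.trans (norm_entry_le (Unitary.mem_iff.1 h).1 i j)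

end UPlus

/-- The algebra `C(U_ζ^+(F))`: the universal unital C⋆-algebra with generators `u_ij` such that `u` and
`F ū_ζ F⁻¹` are unitary. -/
abbrev UPlus (ζ : Circle) {n : ℕ} (d : Fin n → ℤ) (F : GL (Fin n) ℂ) : Type u :=
  UnivCStar (UPlus.bounded.{u} ζ d F)

namespace UPlus
variable (ζ : Circle) {n : ℕ} (d : Fin n → ℤ) (F : GL (Fin n) ℂ)

/-- The fundamental matrix `u`. -/
noncomputable def fund : Matrix (Fin n) (Fin n) (UPlus.{u} ζ d F) :=
  Matrix.of fun i j => UnivCStar.gen (bounded ζ d F) ⟨(i, j)⟩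

theorem fund_mem : fund ζ d F ∈ unitary (Matrix (Fin n) (Fin n) (UPlus.{u} ζ d F)) :=
  unitary_of_rel ζ d F (UnivCStar.of (bounded ζ d F)) (fun _ hr => UnivCStar.of_rel _ hr)
    (w := freeMatrix n) (Or.inl rfl)

theorem twisted_mem :
    twistedMatrix ζ d F (fund ζ d F) ∈ unitary (Matrix (Fin n) (Fin n) (UPlus.{u} ζ d F)) := by
  have h := unitary_of_rel ζ d F (UnivCStar.of (bounded ζ d F)) (fun _ hr => UnivCStar.of_rel _ hr)
    (w := twistedMatrix ζ d F (freeMatrix n)) (Or.inr rfl)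
  rw [map_twistedMatrix] at h
  exact h

section
variable {B : Type v} [CStarAlgebra B]

/-- The universal property. -/
noncomputable def lift (w : Matrix (Fin n) (Fin n) B) (h1 : w ∈ unitary (Matrix (Fin n) (Fin n) B))
    (h2 : twistedMatrix ζ d F w ∈ unitary (Matrix (Fin n) (Fin n) B)) : UPlus.{u} ζ d F →⋆ₐ[ℂ] B :=
  UnivCStar.lift (bounded ζ d F) (fun i => w i.down.1 i.down.2) (by
    have h : (freeMatrix n).map (FreeStarAlg.lift (fun i : Idx.{u} n => w i.down.1 i.down.2)) = w := by
      ext i j; exact FreeStarAlg.lift_gen _ _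
    exact rel_of_unitary ζ d F _ (by rw [h]; exact h1) (by rw [h]; exact h2))

theorem lift_fund (w : Matrix (Fin n) (Fin n) B) (h1 : w ∈ unitary (Matrix (Fin n) (Fin n) B))
    (h2 : twistedMatrix ζ d F w ∈ unitary (Matrix (Fin n) (Fin n) B)) (i j : Fin n) :
    lift.{u} ζ d F w h1 h2 (fund ζ d F i j) = w i j := UnivCStar.lift_gen _ _ _ _

theorem hom_ext {f g : UPlus.{u} ζ d F →⋆ₐ[ℂ] B} (h : ∀ i j, f (fund ζ d F i j) = g (fund ζ d F i j)) :
    f = g := UnivCStar.hom_ext _ fun i => h i.down.1 i.down.2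

theorem mem_of_closed (S : StarSubalgebra ℂ (UPlus.{u} ζ d F)) (hS : IsClosed (S : Set (UPlus.{u} ζ d F)))
    (h : ∀ i j, fund ζ d F i j ∈ S) (x : UPlus.{u} ζ d F) : x ∈ S := by
  refine (UnivCStar.denseRange_of (bounded ζ d F)).induction_on (p := fun x => x ∈ S) x hS fun a => ?_
  refine FreeStarAlg.induction (P := fun a => UnivCStar.of (bounded ζ d F) a ∈ S) a (fun c => ?_)
    (fun x => ?_) (fun a b ha hb => ?_) (fun a b ha hb => ?_)
  · rw [AlgHomClass.commutes]; exact S.algebraMap_mem c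
  · rcases x with ⟨⟨i, j⟩, b⟩
    cases b
    · exact h i j
    · rw [← FreeStarAlg.star_gen, map_star]
      exact star_mem (h i j)
  · rw [map_mul]; exact mul_mem ha hb
  · rw [map_add]; exact add_mem ha hb

end

end UPlus

section
variable {n : ℕ} {X : Type u} [CStarAlgebra X]

theorem star_zpow_circle (z : Circle) (k : ℤ) : star ((z : ℂ) ^ k) = (z : ℂ) ^ (-k) := by
  rw [star_zpow₀, zpow_neg, ← inv_zpow]
  congr 1
  rw [← Circle.coe_inv, Circle.coe_inv_eq_conj]; rfl

theorem unitary_of_eval {w : Matrix (Fin n) (Fin n) C(Circle, X)}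
    (h : ∀ z, w.map (evalAt X z) ∈ unitary (Matrix (Fin n) (Fin n) X)) :
    w ∈ unitary (Matrix (Fin n) (Fin n) C(Circle, X)) := by
  rw [Unitary.mem_iff]
  constructor
  · ext i j z
    have hz := (Unitary.mem_iff.1 (h z)).1
    rw [← map_star_matrix, ← map_mul_matrix, ← map_one_matrix (evalAt X z)] at hz
    exact congrFun (congrFun hz i) j
  · ext i j z
    have hz := (Unitary.mem_iff.1 (h z)).2
    rw [← map_star_matrix, ← map_mul_matrix, ← map_one_matrix (evalAt X z)] at hz
    exact congrFun (congrFun hz i) j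

theorem pair_double_sum {P : Type u} {Q : Type v} [Ring P] [Ring Q] (a : Fin n → P)
    (b : Fin n → Fin n → P) (c : Fin n → P) (a' : Fin n → Q) (b' : Fin n → Fin n → Q) (c' : Fin n → Q) :
    (∑ k, ∑ l, a k * b k l * c l, ∑ k, ∑ l, a' k * b' k l * c' l)
      = ∑ k, ∑ l, (a k, a' k) * (b k l, b' k l) * (c l, c' l) := by
  refine Prod.ext ?_ ?_
  · simp [Prod.fst_sum]
  · simp [Prod.snd_sum]

theorem twistedMatrix_rotate (ζ : Circle) (d : Fin n → ℤ) (F : GL (Fin n) ℂ) {d' : Fin n → ℤ} {δ : ℤ}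
    (hF : ∀ i j, -d j + δ ≠ d' i → (F : Matrix (Fin n) (Fin n) ℂ) i j = 0
      ∧ ((F⁻¹ : GL (Fin n) ℂ) : Matrix (Fin n) (Fin n) ℂ) j i = 0)
    {w w' : Matrix (Fin n) (Fin n) X} (z : Circle)
    (h : ∀ i j, w' i j = ((z : ℂ) ^ (d j - d i)) • w i j) (i j : Fin n) :
    twistedMatrix ζ d F w' i j = ((z : ℂ) ^ (d' j - d' i)) • twistedMatrix ζ d F w i j := by
  simp only [twistedMatrix, Matrix.mul_apply, Finset.smul_sum, Finset.sum_mul]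
  refine Finset.sum_congr rfl fun β _ => Finset.sum_congr rfl fun α _ => ?_
  simp only [scalarMatrix, conjMatrix, Matrix.of_apply, Matrix.map_apply]
  by_cases h1 : -d α + δ = d' i
  · by_cases h2 : -d β + δ = d' j
    · rw [h, star_smul, star_zpow_circle, smul_comm, mul_smul_comm, smul_mul_assoc]
      congr 2
      omega
    · rw [(hF j β h2).2, map_zero, mul_zero, mul_zero, smul_zero]
  · rw [(hF i α h1).1, map_zero, zero_mul, zero_mul, zero_mul, zero_mul, smul_zero]

end

theorem spanProd_eq_top {Z : Type v} [CStarAlgebra Z] {X : Type u} [CStarAlgebra X]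
    (Δ p q : X →⋆ₐ[ℂ] Z) (S : Set X)
    (hX : ∀ T : StarSubalgebra ℂ X, IsClosed (T : Set X) → S ⊆ T → ∀ x, x ∈ T)
    (hZ : ∀ T : StarSubalgebra ℂ Z, IsClosed (T : Set Z) → (∀ x, p x ∈ T) → (∀ x, q x ∈ T) → ∀ t, t ∈ T)
    (h1 : ∀ y ∈ S, q y ∈ spanProd Δ p ∧ q (star y) ∈ spanProd Δ p)
    (h2 : ∀ y ∈ S, ∀ b, (∃ b', p b * q y = q y * p b') ∧ ∃ b', p b * q (star y) = q (star y) * p b') :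
    spanProd Δ p = ⊤ := by
  set M := spanProd Δ p with hM
  have hMcl : IsClosed (M : Set Z) := Submodule.isClosed_topologicalClosure _
  -- a closed condition that is preserved by sums and scalars holds on `M`
  have ind : ∀ (f : Z →L[ℂ] Z), (∀ a b, f (Δ a * p b) ∈ M) → ∀ m ∈ M, f m ∈ M := by
    intro f hf m hm
    have hle : spanProd Δ p ≤ M.comap (f : Z →ₗ[ℂ] Z) := by
      refine Submodule.topologicalClosure_minimal _ (Submodule.span_le.2 ?_)
        (hMcl.preimage f.continuous)
      rintro _ ⟨a, b, rfl⟩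
      exact hf a b
    exact hle hm
  have hmem : ∀ a b, Δ a * p b ∈ M := fun a b =>
    Submodule.le_topologicalClosure _ (Submodule.subset_span ⟨a, b, rfl⟩)
  have hl : ∀ a, ∀ m ∈ M, Δ a * m ∈ M := fun a m hm =>
    ind (ContinuousLinearMap.mul ℂ Z (Δ a)) (fun a' b => by
      change Δ a * (Δ a' * p b) ∈ M
      rw [← mul_assoc, ← map_mul]; exact hmem _ _) m hm
  have hr : ∀ b, ∀ m ∈ M, m * p b ∈ M := fun b m hm =>
    ind ((ContinuousLinearMap.mul ℂ Z).flip (p b)) (fun a b' => by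
      change Δ a * p b' * p b ∈ M
      rw [mul_assoc, ← map_mul]; exact hmem _ _) m hm
  have hq : ∀ y, q y ∈ M → (∀ b, ∃ b', p b * q y = q y * p b') → ∀ m ∈ M, m * q y ∈ M :=
    fun y hy hb m hm => ind ((ContinuousLinearMap.mul ℂ Z).flip (q y)) (fun a b => by
      change Δ a * p b * q y ∈ M
      obtain ⟨b', hb'⟩ := hb b
      rw [mul_assoc, hb', ← mul_assoc]
      exact hr _ _ (hl _ _ hy)) m hm
  let T : StarSubalgebra ℂ Z :=
    { carrier := {t | (∀ m ∈ M, m * t ∈ M) ∧ ∀ m ∈ M, m * star t ∈ M}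
      mul_mem' := fun {s t} hs ht => ⟨fun m hm => by
          rw [← mul_assoc]; exact ht.1 _ (hs.1 _ hm), fun m hm => by
          rw [star_mul, ← mul_assoc]; exact hs.2 _ (ht.2 _ hm)⟩
      one_mem' := ⟨fun m hm => by rwa [mul_one], fun m hm => by rwa [star_one, mul_one]⟩
      add_mem' := fun {s t} hs ht => ⟨fun m hm => by
          rw [mul_add]; exact add_mem (hs.1 _ hm) (ht.1 _ hm), fun m hm => by
          rw [star_add, mul_add]; exact add_mem (hs.2 _ hm) (ht.2 _ hm)⟩
      zero_mem' := ⟨fun m hm => by rw [mul_zero]; exact zero_mem _, fun m hm => by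
          rw [star_zero, mul_zero]; exact zero_mem _⟩
      algebraMap_mem' := fun c => ⟨fun m hm => by
          rw [← Algebra.commutes, ← Algebra.smul_def]; exact M.smul_mem _ hm, fun m hm => by
          rw [← algebraMap_star_comm, ← Algebra.commutes, ← Algebra.smul_def]; exact M.smul_mem _ hm⟩
      star_mem' := fun {t} ht => ⟨ht.2, fun m hm => by rw [star_star]; exact ht.1 m hm⟩ }
  have hTcl : IsClosed (T : Set Z) := by
    have e : (T : Set Z) = (⋂ m ∈ M, {t | m * t ∈ M}) ∩ ⋂ m ∈ M, {t | m * star t ∈ M} := by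
      ext t
      simp only [Set.mem_inter_iff, Set.mem_iInter]
      rfl
    rw [e]
    refine IsClosed.inter (isClosed_biInter fun m _ => ?_) (isClosed_biInter fun m _ => ?_)
    · exact hMcl.preimage (by fun_prop : Continuous fun t : Z => m * t)
    · exact hMcl.preimage (by fun_prop : Continuous fun t : Z => m * star t)
  have hTp : ∀ x, p x ∈ T := fun x => ⟨hr x, fun m hm => by rw [← map_star]; exact hr _ m hm⟩
  have hTq : ∀ x, q x ∈ T := fun x => by
    refine hX (T.comap q) (hTcl.preimage (starAlgHom_continuous q)) (fun y hy => ?_) x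
    refine ⟨hq y (h1 y hy).1 fun b => (h2 y hy b).1, fun m hm => ?_⟩
    have h := hq (star y) (h1 y hy).2 (fun b => (h2 y hy b).2) m hm
    rw [map_star] at h
    exact h
  rw [Submodule.eq_top_iff']
  intro t
  have ht := (hZ T hTcl hTp hTq t).1 (Δ 1 * p 1) (hmem 1 1)
  rwa [map_one, map_one, one_mul, one_mul] at ht

namespace UPlus
set_option linter.unusedSectionVars false
variable (ζ : Circle) {n : ℕ} (d : Fin n → ℤ) (F : GL (Fin n) ℂ)

/-- The matrix with entries `z ↦ z^{d_j - d_i} u_ij`. -/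
noncomputable def rotMatrix : Matrix (Fin n) (Fin n) C(Circle, UPlus.{u} ζ d F) :=
  Matrix.of fun i j => ⟨fun z => ((z : ℂ) ^ (d j - d i)) • fund ζ d F i j, by
    have h : Continuous fun z : Circle => (z : ℂ) ^ (d j - d i) :=
      continuous_subtype_val.zpow₀ _ fun z => Or.inl (Circle.coe_ne_zero z)
    exact h.smul continuous_const⟩

theorem rotMatrix_apply (i j : Fin n) (z : Circle) :
    rotMatrix ζ d F i j z = ((z : ℂ) ^ (d j - d i)) • fund ζ d F i j := rfl

theorem rotMatrix_mem : rotMatrix.{u} ζ d F ∈ unitary _ :=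
  unitary_of_eval fun z => diag_mem_unitary (fund_mem ζ d F) d z fun _ _ => rfl

variable [hF : Fact (IsAdmissible d F)]

theorem twisted_rotMatrix_mem : twistedMatrix ζ d F (rotMatrix.{u} ζ d F) ∈ unitary _ := by
  obtain ⟨d', δ, h⟩ := hF.out
  refine unitary_of_eval fun z => ?_
  rw [map_twistedMatrix]
  exact diag_mem_unitary (twisted_mem ζ d F) d' z
    (twistedMatrix_rotate ζ d F h z fun i j => rotMatrix_apply ζ d F i j z)

/-- The coaction, given by `ρ_z(u_ij) = z^{d_j - d_i} u_ij`. -/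
noncomputable def coactHom : UPlus.{u} ζ d F →⋆ₐ[ℂ] C(Circle, UPlus.{u} ζ d F) :=
  lift ζ d F (rotMatrix ζ d F) (rotMatrix_mem ζ d F) (twisted_rotMatrix_mem ζ d F)

theorem coactHom_fund (i j : Fin n) (z : Circle) :
    coactHom.{u} ζ d F (fund ζ d F i j) z = ((z : ℂ) ^ (d j - d i)) • fund ζ d F i j := by
  rw [coactHom, lift_fund, rotMatrix_apply]

noncomputable instance : CircleAction (UPlus.{u} ζ d F) :=
  ofCoact (coactHom ζ d F)
    (fun x z w => by
      have h : ((evalAt _ z).comp (coactHom ζ d F)).comp ((evalAt _ w).comp (coactHom ζ d F))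
          = (evalAt _ (z * w)).comp (coactHom.{u} ζ d F) := by
        refine hom_ext ζ d F fun i j => ?_
        change coactHom ζ d F (coactHom ζ d F (fund ζ d F i j) w) z
          = coactHom ζ d F (fund ζ d F i j) (z * w)
        have h1 : coactHom.{u} ζ d F (fund ζ d F i j) w = ((w : ℂ) ^ (d j - d i)) • fund ζ d F i j :=
          coactHom_fund ζ d F i j w
        rw [h1, map_smul, ContinuousMap.smul_apply, coactHom_fund, coactHom_fund, smul_smul,
          Circle.coe_mul, mul_zpow, mul_comm]
      exact DFunLike.congr_fun h x)
    (fun x => by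
      have h : (evalAt _ 1).comp (coactHom.{u} ζ d F) = StarAlgHom.id ℂ _ := by
        refine hom_ext ζ d F fun i j => ?_
        change coactHom ζ d F (fund ζ d F i j) 1 = fund ζ d F i j
        rw [coactHom_fund, Circle.coe_one, one_zpow, one_smul]
      exact DFunLike.congr_fun h x)

theorem isHomogeneous_fund (i j : Fin n) : IsHomogeneous (fund.{u} ζ d F i j) (d j - d i) :=
  fun z => coactHom_fund ζ d F i j z

/-- The matrix with entries `∑_k j₁(u_ik) j₂(u_kj)`. -/
noncomputable def comulMatrix : Matrix (Fin n) (Fin n)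
    (BraidedTensor ζ (UPlus.{u} ζ d F) (UPlus.{u} ζ d F)) :=
  Matrix.of fun i j => ∑ k, BraidedTensor.j₁ ζ _ (fund ζ d F i k) * BraidedTensor.j₂ ζ _ (fund ζ d F k j)

theorem comulMatrix_eq : comulMatrix.{u} ζ d F
    = (fund ζ d F).map (BraidedTensor.j₁ ζ _) * (fund ζ d F).map (BraidedTensor.j₂ ζ _) := by
  ext i j
  rw [Matrix.mul_apply]
  rfl

theorem twisted_comulMatrix : twistedMatrix ζ d F (comulMatrix.{u} ζ d F)
    = (twistedMatrix ζ d F (fund ζ d F)).map (BraidedTensor.j₁ ζ _)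
      * (twistedMatrix ζ d F (fund ζ d F)).map (BraidedTensor.j₂ ζ _) := by
  rw [comulMatrix_eq, twistedMatrix_mul ζ d F (isHomogeneous_fund ζ d F) (isHomogeneous_fund ζ d F)]

/-- The comultiplication, given by `Δ(u_ij) = ∑_k j₁(u_ik) j₂(u_kj)`. -/
noncomputable def comul : UPlus.{u} ζ d F →⋆ₐ[ℂ] BraidedTensor ζ (UPlus.{u} ζ d F) (UPlus.{u} ζ d F) :=
  lift ζ d F (comulMatrix ζ d F)
    (by
      rw [comulMatrix_eq]
      exact mul_mem (map_mem_unitary _ (fund_mem ζ d F)) (map_mem_unitary _ (fund_mem ζ d F)))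
    (by
      rw [twisted_comulMatrix]
      exact mul_mem (map_mem_unitary _ (twisted_mem ζ d F)) (map_mem_unitary _ (twisted_mem ζ d F)))

theorem comul_fund (i j : Fin n) : comul.{u} ζ d F (fund ζ d F i j)
    = ∑ k, BraidedTensor.j₁ ζ _ (fund ζ d F i k) * BraidedTensor.j₂ ζ _ (fund ζ d F k j) :=
  lift_fund ζ d F _ _ _ i j

theorem map_comul_fund : (fund.{u} ζ d F).map (comul ζ d F)
    = (fund ζ d F).map (BraidedTensor.j₁ ζ _) * (fund ζ d F).map (BraidedTensor.j₂ ζ _) := by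
  rw [← comulMatrix_eq]
  ext i j
  exact comul_fund ζ d F i j

theorem map_comul_twisted : (twistedMatrix ζ d F (fund.{u} ζ d F)).map (comul ζ d F)
    = (twistedMatrix ζ d F (fund ζ d F)).map (BraidedTensor.j₁ ζ _)
      * (twistedMatrix ζ d F (fund ζ d F)).map (BraidedTensor.j₂ ζ _) := by
  rw [map_twistedMatrix, map_comul_fund, ← comulMatrix_eq, twisted_comulMatrix]

theorem isEquivariant_comul : IsEquivariant (comul.{u} ζ d F) := fun z x => by
  have h : (act _ z).comp (comul.{u} ζ d F) = (comul ζ d F).comp (act _ z) := by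
    refine hom_ext ζ d F fun i j => ?_
    rw [StarAlgHom.comp_apply, StarAlgHom.comp_apply, isHomogeneous_fund ζ d F i j z, map_smul,
      comul_fund, map_sum, Finset.smul_sum]
    refine Finset.sum_congr rfl fun k _ => ?_
    rw [map_mul, BraidedTensor.isEquivariant_j₁, BraidedTensor.isEquivariant_j₂,
      isHomogeneous_fund ζ d F i k z, isHomogeneous_fund ζ d F k j z, map_smul, map_smul,
      smul_mul_smul_comm, ← zpow_add₀ (Circle.coe_ne_zero z)]
    congr 2; ring
  exact DFunLike.congr_fun h x

theorem coassociative (x : UPlus.{u} ζ d F) :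
    (BraidedTensor.map ζ (comul ζ d F) (StarAlgHom.id ℂ _) (isEquivariant_comul ζ d F)
        (isEquivariant_id _) (comul ζ d F x),
      BraidedTensor.map ζ (StarAlgHom.id ℂ _) (comul ζ d F) (isEquivariant_id _)
        (isEquivariant_comul ζ d F) (comul ζ d F x))
      ∈ associatorGraph ζ (UPlus.{u} ζ d F) (UPlus.{u} ζ d F) (UPlus.{u} ζ d F) := by
  let L := (BraidedTensor.map ζ (comul.{u} ζ d F) (StarAlgHom.id ℂ _) (isEquivariant_comul ζ d F)
        (isEquivariant_id _)).comp (comul ζ d F)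
  let R := (BraidedTensor.map ζ (StarAlgHom.id ℂ _) (comul.{u} ζ d F) (isEquivariant_id _)
        (isEquivariant_comul ζ d F)).comp (comul ζ d F)
  let T := L.prod R
  have hcl : IsClosed ((associatorGraph ζ (UPlus.{u} ζ d F) (UPlus.{u} ζ d F) (UPlus.{u} ζ d F)).comap T :
      Set (UPlus.{u} ζ d F)) :=
    IsClosed.preimage ((starAlgHom_continuous L).prodMk (starAlgHom_continuous R))
      (StarSubalgebra.isClosed_topologicalClosure _)
  refine mem_of_closed ζ d F _ hcl (fun i j => ?_) x
  change (L (fund ζ d F i j), R (fund ζ d F i j)) ∈ associatorGraph ζ _ _ _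
  have hL : L (fund ζ d F i j) = ∑ k, ∑ l, BraidedTensor.j₁ ζ _ (BraidedTensor.j₁ ζ _ (fund ζ d F i k))
      * BraidedTensor.j₁ ζ _ (BraidedTensor.j₂ ζ _ (fund ζ d F k l))
      * BraidedTensor.j₂ ζ _ (fund ζ d F l j) := by
    rw [Finset.sum_comm, StarAlgHom.comp_apply, comul_fund, map_sum]
    refine Finset.sum_congr rfl fun l _ => ?_
    rw [map_mul, BraidedTensor.map_j₁, BraidedTensor.map_j₂, comul_fund, map_sum, Finset.sum_mul]
    refine Finset.sum_congr rfl fun k _ => ?_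
    rw [map_mul]; rfl
  have hR : R (fund ζ d F i j) = ∑ k, ∑ l, BraidedTensor.j₁ ζ _ (fund ζ d F i k)
      * BraidedTensor.j₂ ζ _ (BraidedTensor.j₁ ζ _ (fund ζ d F k l))
      * BraidedTensor.j₂ ζ _ (BraidedTensor.j₂ ζ _ (fund ζ d F l j)) := by
    rw [StarAlgHom.comp_apply, comul_fund, map_sum]
    refine Finset.sum_congr rfl fun k _ => ?_
    rw [map_mul, BraidedTensor.map_j₁, BraidedTensor.map_j₂, comul_fund, map_sum, Finset.mul_sum]
    refine Finset.sum_congr rfl fun l _ => ?_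
    rw [map_mul, mul_assoc]; rfl
  rw [hL, hR]
  rw [pair_double_sum]
  exact sum_mem fun k _ => sum_mem fun l _ => mul_mem (mul_mem (associatorGraph_mem₁ ζ _ _ _ _)
    (associatorGraph_mem₂ ζ _ _ _ _)) (associatorGraph_mem₃ ζ _ _ _ _)

/-- The entries of `w*` are combinations of those of `F w̄_ζ F⁻¹`. -/
theorem star_entry_mem {X : Type u} {Z : Type v} [CStarAlgebra X] [CStarAlgebra Z]
    (w : Matrix (Fin n) (Fin n) X) (f : X →⋆ₐ[ℂ] Z) (M : Submodule ℂ Z)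
    (h : ∀ i j, f (twistedMatrix ζ d F w i j) ∈ M) (i j : Fin n) : f (star (w i j)) ∈ M := by
  have e : conjMatrix ζ d w = scalarMatrix X ((F⁻¹ : GL (Fin n) ℂ) : Matrix (Fin n) (Fin n) ℂ)
      * twistedMatrix ζ d F w * scalarMatrix X (F : Matrix (Fin n) (Fin n) ℂ) := by
    have h1 := scalarMatrix_inv_mul X F
    rw [twistedMatrix]
    set P := scalarMatrix X (F : Matrix (Fin n) (Fin n) ℂ)
    set Q := scalarMatrix X ((F⁻¹ : GL (Fin n) ℂ) : Matrix (Fin n) (Fin n) ℂ)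
    calc conjMatrix ζ d w = 1 * conjMatrix ζ d w * 1 := by rw [one_mul, mul_one]
      _ = (Q * P) * conjMatrix ζ d w * (Q * P) := by rw [h1]
      _ = _ := by simp only [mul_assoc]
  have h1 : f (conjMatrix ζ d w i j) ∈ M := by
    rw [e, Matrix.mul_apply, map_sum]
    refine sum_mem fun β _ => ?_
    rw [Matrix.mul_apply, Finset.sum_mul, map_sum]
    refine sum_mem fun α _ => ?_
    simp only [scalarMatrix, Matrix.map_apply]
    rw [← Algebra.commutes, ← Algebra.smul_def, ← Algebra.smul_def, map_smul, map_smul]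
    exact M.smul_mem _ (M.smul_mem _ (h α β))
  have h2 : f (star (w i j)) = ((ζ : ℂ) ^ (-(d i * (d j - d i)))) • f (conjMatrix ζ d w i j) := by
    rw [conjMatrix, Matrix.of_apply, map_smul, smul_smul, ← zpow_add₀ (Circle.coe_ne_zero ζ),
      neg_add_cancel, zpow_zero, one_smul]
  rw [h2]
  exact M.smul_mem _ h1

theorem spanProd_mem {X : Type u} {Z : Type v} [CStarAlgebra X] [CStarAlgebra Z] (f g : X →⋆ₐ[ℂ] Z)
    (a b : X) : f a * g b ∈ spanProd f g :=
  Submodule.le_topologicalClosure _ (Submodule.subset_span ⟨a, b, rfl⟩)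

theorem right_entry_mem {X : Type u} {Z : Type v} [CStarAlgebra X] [CStarAlgebra Z]
    {w : Matrix (Fin n) (Fin n) X} (hw : w ∈ unitary (Matrix (Fin n) (Fin n) X))
    {Δ j₁ j₂ : X →⋆ₐ[ℂ] Z} (h : w.map Δ = w.map j₁ * w.map j₂) (i j : Fin n) :
    j₁ (w i j) ∈ spanProd Δ j₂ := by
  have h1 : w.map j₁ = w.map Δ * (star w).map j₂ := by
    rw [h, mul_assoc, ← map_mul_matrix, (Unitary.mem_iff.1 hw).2, map_one_matrix, mul_one]
  have h2 := congrFun (congrFun h1 i) j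
  rw [Matrix.mul_apply] at h2
  rw [show j₁ (w i j) = _ from h2]
  exact sum_mem fun k _ => spanProd_mem _ _ _ _

theorem left_entry_mem {X : Type u} {Z : Type v} [CStarAlgebra X] [CStarAlgebra Z]
    {w : Matrix (Fin n) (Fin n) X} (hw : w ∈ unitary (Matrix (Fin n) (Fin n) X))
    {Δ j₁ j₂ : X →⋆ₐ[ℂ] Z} (h : w.map Δ = w.map j₁ * w.map j₂) (i j : Fin n) :
    j₂ (star (w i j)) ∈ spanProd Δ j₁ := by
  have h1 : w.map j₂ = (star w).map j₁ * w.map Δ := by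
    rw [h, ← mul_assoc, ← map_mul_matrix, (Unitary.mem_iff.1 hw).1, map_one_matrix, one_mul]
  have h2 := congrArg star (congrFun (congrFun h1 i) j)
  rw [Matrix.mul_apply, star_sum] at h2
  rw [map_star j₂, show star (j₂ (w i j)) = _ from h2]
  refine sum_mem fun k _ => ?_
  rw [star_mul]
  change star (Δ (w k j)) * star (j₁ (star (w k i))) ∈ _
  rw [← map_star, ← map_star]
  exact spanProd_mem _ _ _ _

theorem simplifiable_right : spanProd (comul.{u} ζ d F) (BraidedTensor.j₂ ζ _) = ⊤ := by
  refine spanProd_eq_top _ _ (BraidedTensor.j₁ ζ _) {x | ∃ i j, x = fund ζ d F i j}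
    (fun T hT hS x => mem_of_closed ζ d F T hT (fun i j => hS ⟨i, j, rfl⟩) x)
    (fun T hT h1 h2 t => BraidedTensor.mem_of_closed ζ T hT h2 h1 t) ?_ ?_
  · rintro _ ⟨i, j, rfl⟩
    exact ⟨right_entry_mem (fund_mem ζ d F) (map_comul_fund ζ d F) i j,
      star_entry_mem ζ d F _ _ _ (right_entry_mem (twisted_mem ζ d F) (map_comul_twisted ζ d F)) i j⟩
  · rintro _ ⟨i, j, rfl⟩ b
    exact ⟨⟨_, BraidedTensor.j₂_mul_j₁_act ζ (isHomogeneous_fund ζ d F i j) b⟩,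
      ⟨_, BraidedTensor.j₂_mul_j₁_act ζ (isHomogeneous_fund ζ d F i j).star b⟩⟩

/-- The elements whose adjoint belongs to `M`. -/
def starPreimage {Z : Type u} [CStarAlgebra Z] (M : Submodule ℂ Z) : Submodule ℂ Z where
  carrier := {t | star t ∈ M}
  add_mem' {a b} ha hb := by
    change star (a + b) ∈ M
    rw [star_add]; exact add_mem ha hb
  zero_mem' := by
    change star 0 ∈ M
    rw [star_zero]; exact zero_mem _
  smul_mem' c a ha := by
    change star (c • a) ∈ M
    rw [star_smul]; exact M.smul_mem _ ha

theorem simplifiable_left : spanProd (comul.{u} ζ d F) (BraidedTensor.j₁ ζ _) = ⊤ := by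
  refine spanProd_eq_top _ _ (BraidedTensor.j₂ ζ _) {x | ∃ i j, x = fund ζ d F i j}
    (fun T hT hS x => mem_of_closed ζ d F T hT (fun i j => hS ⟨i, j, rfl⟩) x)
    (fun T hT h1 h2 t => BraidedTensor.mem_of_closed ζ T hT h1 h2 t) ?_ ?_
  · rintro _ ⟨i, j, rfl⟩
    refine ⟨?_, left_entry_mem (fund_mem ζ d F) (map_comul_fund ζ d F) i j⟩
    have h := star_entry_mem ζ d F (fund.{u} ζ d F) (BraidedTensor.j₂ ζ _)
      (starPreimage (spanProd (comul.{u} ζ d F) (BraidedTensor.j₁ ζ _))) (fun i j => by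
      have := left_entry_mem (twisted_mem ζ d F) (map_comul_twisted ζ d F) i j
      rw [map_star] at this
      exact this) i j
    change star _ ∈ spanProd (comul.{u} ζ d F) (BraidedTensor.j₁ ζ _) at h
    rwa [← map_star, star_star] at h
  · rintro _ ⟨i, j, rfl⟩ b
    exact ⟨⟨_, BraidedTensor.j₁_mul_j₂_act ζ (isHomogeneous_fund ζ d F i j) b⟩,
      ⟨_, BraidedTensor.j₁_mul_j₂_act ζ (isHomogeneous_fund ζ d F i j).star b⟩⟩

end UPlus

/-- The braided free unitary quantum group `U_ζ^+(F)`. -/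
noncomputable def freeUnitary (ζ : Circle) {n : ℕ} (d : Fin n → ℤ) (F : GL (Fin n) ℂ)
    (hF : IsAdmissible d F) : BraidedCQG.{u} ζ :=
  haveI : Fact (IsAdmissible d F) := ⟨hF⟩
  { Alg := UPlus.{u} ζ d F
    Δ := UPlus.comul ζ d F
    equivariant := UPlus.isEquivariant_comul ζ d F
    coassociative := UPlus.coassociative ζ d F
    simplifiable_right := UPlus.simplifiable_right ζ d F
    simplifiable_left := UPlus.simplifiable_left ζ d F }

/-! ### Matrix entries of representations and the conjugate representation -/

section
variable {H : Type v} [NormedAddCommGroup H] [InnerProductSpace ℂ H] {X : Type u} [CStarAlgebra X]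
  {n : ℕ} (b : Module.Basis (Fin n) ℂ H)

/-- The matrix units `e_ij`. -/
noncomputable def matUnit (i j : Fin n) : Module.End ℂ H := (b.coord j).smulRight (b i)

/-- The matrix `(a_ij)` of `a = ∑ e_ij ⊗ a_ij ∈ L(H) ⊗ X`. -/
noncomputable def toMat (a : Module.End ℂ H ⊗[ℂ] X) : Matrix (Fin n) (Fin n) X :=
  Matrix.of fun i j => TensorProduct.lid ℂ X (LinearMap.rTensor X
    ((b.coord i).comp (LinearMap.applyₗ (b j)) : Module.End ℂ H →ₗ[ℂ] ℂ) a)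

/-- The element `∑ e_ij ⊗ a_ij` of `L(H) ⊗ X`. -/
noncomputable def ofMat (m : Matrix (Fin n) (Fin n) X) : Module.End ℂ H ⊗[ℂ] X :=
  ∑ i, ∑ j, matUnit b i j ⊗ₜ m i j

theorem toMat_tmul (T : Module.End ℂ H) (x : X) (i j : Fin n) :
    toMat b (T ⊗ₜ x) i j = (b.repr (T (b j)) i) • x := by
  simp [toMat]

theorem sum_matUnit (T : Module.End ℂ H) : ∑ i, ∑ j, (b.repr (T (b j)) i) • matUnit b i j = T := by
  refine b.ext fun k => ?_
  simp only [LinearMap.sum_apply, LinearMap.smul_apply, matUnit, LinearMap.smulRight_apply,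
    Module.Basis.coord_apply, Module.Basis.repr_self, Finsupp.single_apply, ite_smul, one_smul, zero_smul,
    smul_ite, smul_zero, Finset.sum_ite_eq, Finset.mem_univ, if_true]
  exact b.sum_repr (T (b k))

theorem toMat_add (a a' : Module.End ℂ H ⊗[ℂ] X) : toMat b (a + a') = toMat b a + toMat b a' := by
  ext i j; simp [toMat]

theorem ofMat_add (m m' : Matrix (Fin n) (Fin n) X) : ofMat b (m + m') = ofMat b m + ofMat b m' := by
  simp [ofMat, TensorProduct.tmul_add, Finset.sum_add_distrib]

theorem ofMat_toMat (a : Module.End ℂ H ⊗[ℂ] X) : ofMat b (toMat b a) = a := by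
  induction a with
  | zero => simp [ofMat, toMat]
  | add a a' h h' => rw [toMat_add, ofMat_add, h, h']
  | tmul T x =>
    conv_rhs => rw [← sum_matUnit b T]
    simp only [ofMat, toMat_tmul, TensorProduct.sum_tmul]
    exact Finset.sum_congr rfl fun i _ => Finset.sum_congr rfl fun j _ =>
      (TensorProduct.smul_tmul _ _ _).symm

theorem toMat_ofMat (m : Matrix (Fin n) (Fin n) X) : toMat b (ofMat b m) = m := by
  ext i j
  have h : toMat b (ofMat b m) i j = ∑ k, ∑ l, toMat b (matUnit b k l ⊗ₜ m k l) i j := by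
    simp only [ofMat, toMat, Matrix.of_apply, map_sum]
  rw [h]
  simp only [toMat_tmul, matUnit, LinearMap.smulRight_apply, Module.Basis.coord_apply,
    Module.Basis.repr_self, map_smul, Finsupp.smul_apply, Finsupp.single_apply]
  rw [Finset.sum_eq_single i, Finset.sum_eq_single j]
  · simp
  · intro l _ hl
    rw [if_neg (Ne.symm hl)]; simp
  · simp
  · intro k _ hk
    refine Finset.sum_eq_zero fun l _ => ?_
    rw [if_neg hk]; simp
  · simp

theorem ofMat_injective {m m' : Matrix (Fin n) (Fin n) X} (h : ofMat b m = ofMat b m') : m = m' := by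
  rw [← toMat_ofMat b m, h, toMat_ofMat]

theorem matUnit_mul (i j k l : Fin n) :
    matUnit b i j * matUnit b k l = if j = k then matUnit b i l else 0 := by
  refine b.ext fun p => ?_
  rw [Module.End.mul_apply]
  simp only [matUnit, LinearMap.smulRight_apply, map_smul, Module.Basis.coord_apply,
    Module.Basis.repr_self, Finsupp.single_apply]
  by_cases h : j = k
  · subst h; simp [Finsupp.single_apply]
  · rw [if_neg h, if_neg (Ne.symm h)]; simp

theorem ofMat_mul (m m' : Matrix (Fin n) (Fin n) X) : ofMat b m * ofMat b m' = ofMat b (m * m') := by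
  have key : ∀ i j, (matUnit b i j ⊗ₜ[ℂ] m i j) * ofMat b m'
      = ∑ l, matUnit b i l ⊗ₜ[ℂ] (m i j * m' j l) := fun i j => by
    rw [ofMat, Finset.mul_sum, Finset.sum_eq_single j]
    · rw [Finset.mul_sum]
      refine Finset.sum_congr rfl fun l _ => ?_
      rw [Algebra.TensorProduct.tmul_mul_tmul, matUnit_mul, if_pos rfl]
    · intro k _ hk
      rw [Finset.mul_sum]
      refine Finset.sum_eq_zero fun l _ => ?_
      rw [Algebra.TensorProduct.tmul_mul_tmul, matUnit_mul, if_neg (Ne.symm hk),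
        TensorProduct.zero_tmul]
    · simp
  rw [ofMat, ofMat, Finset.sum_mul]
  refine Finset.sum_congr rfl fun i _ => ?_
  rw [Finset.sum_mul]
  change ∑ j, (matUnit b i j ⊗ₜ[ℂ] m i j) * ofMat b m' = _
  simp only [key]
  rw [Finset.sum_comm]
  refine Finset.sum_congr rfl fun l _ => ?_
  rw [Matrix.mul_apply, TensorProduct.tmul_sum]

theorem legMap_ofMat {Z : Type w} [CStarAlgebra Z] (f : X →⋆ₐ[ℂ] Z) (m : Matrix (Fin n) (Fin n) X) :
    legMap H f (ofMat b m) = ofMat b (m.map f) := by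
  simp only [legMap, ofMat, map_sum, LinearMap.lTensor_tmul]
  rfl

theorem ad_matUnit (U : CircleRep H) {d : Fin n → ℤ}
    (hd : ∀ z i, U.op z (b i) = ((z : ℂ) ^ d i) • b i) (z : Circle) (i j : Fin n) :
    U.ad z (matUnit b i j) = ((z : ℂ) ^ (d i - d j)) • matUnit b i j := by
  have hz : (z : ℂ) ≠ 0 := Circle.coe_ne_zero z
  refine b.ext fun k => ?_
  change U.op z (matUnit b i j ((U.op z).symm (b k))) = _
  have hs : (U.op z).symm (b k) = ((z : ℂ) ^ (-d k)) • b k := by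
    rw [LinearIsometryEquiv.symm_apply_eq, map_smul, hd, smul_smul, ← zpow_add₀ hz, neg_add_cancel,
      zpow_zero, one_smul]
  rw [hs, map_smul, map_smul, LinearMap.smul_apply]
  simp only [matUnit, LinearMap.smulRight_apply, Module.Basis.coord_apply, Module.Basis.repr_self,
    Finsupp.single_apply]
  by_cases h : k = j
  · subst h
    rw [if_pos rfl, one_smul, hd, smul_smul, ← zpow_add₀ hz]
    congr 2; ring
  · rw [if_neg h]; simp

theorem invariant_ofMat [CircleAction X] (U : CircleRep H) {d : Fin n → ℤ}
    (hd : ∀ z i, U.op z (b i) = ((z : ℂ) ^ d i) • b i) (m : Matrix (Fin n) (Fin n) X) :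
    (∀ z, TensorProduct.map (U.ad z) (act X z).toAlgHom.toLinearMap (ofMat b m) = ofMat b m)
      ↔ ∀ i j, IsHomogeneous (m i j) (d j - d i) := by
  have h : ∀ z, TensorProduct.map (U.ad z) (act X z).toAlgHom.toLinearMap (ofMat b m)
      = ofMat b (Matrix.of fun i j => ((z : ℂ) ^ (d i - d j)) • act X z (m i j)) := fun z => by
    simp only [ofMat, map_sum, TensorProduct.map_tmul, ad_matUnit b U hd, Matrix.of_apply]
    refine Finset.sum_congr rfl fun i _ => Finset.sum_congr rfl fun j _ => ?_
    rw [TensorProduct.smul_tmul]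
    rfl
  have hinv : ∀ (z : Circle) (i j : Fin n), (z : ℂ) ^ (d j - d i) * (z : ℂ) ^ (d i - d j) = 1 :=
    fun z i j => by
      rw [← zpow_add₀ (Circle.coe_ne_zero z)]
      simp
  constructor
  · intro hm i j z
    have h1 := ofMat_injective b ((h z).symm.trans (hm z))
    have h2 := congrFun (congrFun h1 i) j
    rw [Matrix.of_apply] at h2
    rw [← h2, smul_smul, hinv, one_smul, h2]
  · intro hm z
    rw [h]
    congr 1
    ext i j
    rw [Matrix.of_apply, hm i j z, smul_smul, mul_comm, hinv, one_smul]

end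

section
variable {ζ : Circle} {G : BraidedCQG.{u} ζ} {H : Type v} [NormedAddCommGroup H] [InnerProductSpace ℂ H]
  [FiniteDimensional ℂ H] {n : ℕ}

/-- The matrix `(v_ij)` of a representation in an orthonormal basis. -/
noncomputable def FinRep.mat (v : FinRep G H) (e : OrthonormalBasis (Fin n) ℂ H) :
    Matrix (Fin n) (Fin n) G.Alg := toMat e.toBasis v.u

/-- `(e_i)` is an eigenbasis of the representation of the circle, with `U(z) e_i = z^{d_i} e_i`. -/
def FinRep.IsEigenbasis (v : FinRep G H) (e : OrthonormalBasis (Fin n) ℂ H) (d : Fin n → ℤ) : Prop :=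
  ∀ (z : Circle) (i : Fin n), v.U.op z (e i) = ((z : ℂ) ^ d i) • e i

theorem FinRep.mat_homogeneous {v : FinRep G H} {e : OrthonormalBasis (Fin n) ℂ H} {d : Fin n → ℤ}
    (he : v.IsEigenbasis e d) (i j : Fin n) : IsHomogeneous (v.mat e i j) (d j - d i) := by
  refine (invariant_ofMat e.toBasis v.U (fun z i => ?_) _).1 (fun z => ?_) i j
  · rw [OrthonormalBasis.coe_toBasis]; exact he z i
  · rw [FinRep.mat, ofMat_toMat]; exact v.invariant z

theorem FinRep.mat_comul (v : FinRep G H) (e : OrthonormalBasis (Fin n) ℂ H) :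
    (v.mat e).map G.Δ = (v.mat e).map (BraidedTensor.j₁ ζ G.Alg)
      * (v.mat e).map (BraidedTensor.j₂ ζ G.Alg) := by
  refine ofMat_injective e.toBasis ?_
  rw [← ofMat_mul, ← legMap_ofMat, ← legMap_ofMat, ← legMap_ofMat, FinRep.mat, ofMat_toMat]
  exact v.corep

/-- The conjugate representation `(H̄, Ū, v̄_ζ)`: in the conjugate of an orthonormal eigenbasis, its
matrix has the entries `ζ^{d_i (d_j - d_i)} v_ij^*`. -/
noncomputable def FinRep.conj (v : FinRep G H) (e : OrthonormalBasis (Fin n) ℂ H) (d : Fin n → ℤ)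
    (he : v.IsEigenbasis e d) : FinRep G (ConjSpace H) where
  U := v.U.bar
  u := ofMat (ConjSpace.basis e.toBasis) (conjMatrix ζ d (v.mat e))
  invariant := by
    have hbar : ∀ z i, v.U.bar.op z (ConjSpace.basis e.toBasis i)
        = ((z : ℂ) ^ (-d i)) • ConjSpace.basis e.toBasis i := fun z i => by
      rw [ConjSpace.basis_apply, ConjSpace.smul_bar]
      change ConjSpace.bar (v.U.op z (e.toBasis i)) = _
      rw [OrthonormalBasis.coe_toBasis, he z i]
      congr 2
      exact ((star_zpow_circle z (-d i)).trans (by rw [neg_neg])).symm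
    refine (invariant_ofMat (ConjSpace.basis e.toBasis) v.U.bar (d := fun i => -d i) hbar _).2
      fun i j z => ?_
    have h := (v.mat_homogeneous he i j).star z
    rw [conjMatrix, Matrix.of_apply, map_smul, h, smul_comm]
    congr 2
    ring
  corep := by
    rw [legMap_ofMat, legMap_ofMat, legMap_ofMat, ofMat_mul, map_conjMatrix, v.mat_comul,
      conjMatrix_mul ζ d (v.mat_homogeneous he) (v.mat_homogeneous he)]

end

/-- The fundamental matrix `u` of `U_ζ^+(F)`, with entries in `C(U_ζ^+(F))`. -/
noncomputable def freeUnitary.mat (ζ : Circle) {n : ℕ} (d : Fin n → ℤ) (F : GL (Fin n) ℂ)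
    (hF : IsAdmissible d F) : Matrix (Fin n) (Fin n) (freeUnitary.{u} ζ d F hF).Alg := UPlus.fund ζ d F

/-! In orthonormal bases the hypothesis says that `w' = M w M⁻¹` is unitary, where `w = v̄_ζ` and
`M` is the matrix of the equivalence `T`. If `M` were admissible, `F = M` would do: both `v` and `F
w F⁻¹` would be unitary, and the universal property of `C(U_ζ^+(F))` would give the morphism. But an
equivalence of representations is only assumed invertible. Nothing forces `T` to intertwine the
circle representations, so `M` may mix different degrees, and then the relations defined by `M` need
not be compatible with the coaction. The point of the proof is to replace `M` by a matrix that
respects the grading.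

Unitarity of `M w M⁻¹` means that `w` is invertible and preserves the positive definite form `P₀ =
M* M`, that is, `w* P₀ w = P₀`. The forms preserved by `w` make up a linear space, `invariantForms
w`. Since the entry `w_ij` has degree `d_i - d_j`, the automorphism `ρ_z` acts on `w` as conjugation
by the diagonal unitary `D_z` with entries `z^{d_i}`. Applying `ρ_z` to the equation shows that
`D_z* P₀ D_z` is again preserved (`rotate_mem_invariantForms`). Averaging these forms over the
circle keeps invariance and positive definiteness and kills every entry that joins two different
degrees. As only finitely many degrees occur, a sum over a finite group of roots of unity suffices,
and no Haar integral is needed (`exists_circle_sum_zpow`, `exists_graded_posDef`).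

Let `P` be the form so obtained and `F = P^{1/2}`. Since `P` commutes with `diag(d_i)`, so does its
functional calculus, hence `F` is block diagonal and therefore admissible (`exists_admissible_sqrt`,
`isAdmissible_of_commute`). As `F* F = P` is preserved by the invertible matrix `w`, the matrix `F w
F⁻¹` is unitary (`conj_mem_unitary`). These steps are assembled in `exists_admissible_unitary`.

It remains to apply the universal property (`existsUnique_hopfHom`). Equivariance and compatibility
with the comultiplications are identities between ⋆-homomorphisms, so they need only be checked on
the generators, where they express the homogeneity of the `v_ij` and the corepresentation property
of `v`. Uniqueness holds because the `u_ij` generate. -/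

/-! ### Admissible matrices and graded square roots -/

section
variable {n : ℕ}

/-- Commuting with `diag(d_i)` means being block diagonal for the decomposition into degrees, and
the inverse of a block diagonal matrix has the same blocks. Commutation is a convenient form of this
condition because it passes to inverses and through functional calculus. -/
theorem isAdmissible_of_commute {d : Fin n → ℤ} {F : GL (Fin n) ℂ}
    (h : Commute (F : Matrix (Fin n) (Fin n) ℂ) (Matrix.diagonal fun i => (d i : ℂ))) :
    IsAdmissible d F := by
  have key : ∀ A : Matrix (Fin n) (Fin n) ℂ, Commute A (Matrix.diagonal fun i => (d i : ℂ)) →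
      ∀ i j, d i ≠ d j → A i j = 0 := fun A hA i j hij => by
    -- The `(i, j)` entry of the commutator is `(d_j - d_i) A_ij`, and distinct integers remain
    -- distinct in `ℂ`.
    have h1 := congrFun (congrFun hA.eq i) j
    rw [Matrix.mul_diagonal, Matrix.diagonal_mul, mul_comm, ← sub_eq_zero, ← sub_mul,
      mul_eq_zero, sub_eq_zero, Int.cast_inj] at h1
    exact h1.resolve_left (Ne.symm hij)
  -- With `d' = -d` and `δ = 0`, the condition `-d_j + δ ≠ d'_i` becomes `d_i ≠ d_j`: the conjugate
  -- space keeps its own degrees.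
  refine ⟨fun i => -d i, 0, fun i j hij => ?_⟩
  have hij' : d i ≠ d j := fun e => hij (by simp [e])
  exact ⟨key _ h i j hij', key _ h.units_inv_left j i (Ne.symm hij')⟩

open scoped MatrixOrder ComplexOrder in
/-- A positive definite matrix respecting the grading has a square root respecting the grading. -/
theorem exists_admissible_sqrt {d : Fin n → ℤ} {P : Matrix (Fin n) (Fin n) ℂ} (hP : P.PosDef)
    (hd : ∀ i j, d i ≠ d j → P i j = 0) :
    ∃ F : GL (Fin n) ℂ, IsAdmissible d F ∧
      star (F : Matrix (Fin n) (Fin n) ℂ) * (F : Matrix (Fin n) (Fin n) ℂ) = P := by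
  have h0 : 0 ≤ P := hP.posSemidef.nonneg
  have hsq : CFC.sqrt P * CFC.sqrt P = P := CFC.sqrt_mul_sqrt_self P h0
  have hunit : IsUnit (CFC.sqrt P) := by
    -- A factor of an invertible matrix is invertible, so the square root inherits invertibility
    -- from `P = P^{1/2} P^{1/2}`.
    have h := hP.isUnit
    rw [← hsq] at h
    exact isUnit_of_mul_isUnit_left h
  obtain ⟨F, hF⟩ := hunit
  refine ⟨F, isAdmissible_of_commute ?_, ?_⟩
  -- Whatever commutes with `P` commutes with its functional calculus. It is therefore enough that
  -- `P` itself commutes with `diag(d_i)`, which is the vanishing assumption read entry by entry.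
  · rw [hF, CFC.sqrt_eq_cfc]
    refine Commute.cfc_nnreal ?_ _
    ext i j
    rw [Matrix.mul_diagonal, Matrix.diagonal_mul]
    by_cases h : d i = d j
    · rw [h, mul_comm]
    · rw [hd i j h, mul_zero, zero_mul]
  -- The positive square root is self-adjoint, so `F* F` is the same as `F²`.
  · have hsa : star (CFC.sqrt P) = CFC.sqrt P := 
      (Matrix.nonneg_iff_posSemidef.1 (CFC.sqrt_nonneg P)).isHermitian
    rw [hF, hsa, hsq]

/-! ### Averaging over the circle -/

/-- The average over a sufficiently fine group of roots of unity separates the degrees. -/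
theorem exists_circle_sum_zpow (K : ℕ) : ∃ (N : ℕ) (z : ℕ → Circle), N ≠ 0 ∧
    ∀ m : ℤ, |m| ≤ K → m ≠ 0 → ∑ k ∈ Finset.range N, ((z k : Circle) : ℂ) ^ m = 0 := by
  -- The order `K + 1` is the least one that works for every `K`: no nonzero integer of absolute
  -- value at most `K` is a multiple of it.
  have hω := Complex.isPrimitiveRoot_exp (K + 1) (Nat.succ_ne_zero K)
  set ω := Complex.exp (2 * Real.pi * Complex.I / ((K + 1 : ℕ) : ℂ))
  have hn : ‖ω‖ = 1 := Complex.norm_eq_one_of_pow_eq_one hω.pow_eq_one (Nat.succ_ne_zero K)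
  let c : Circle := ⟨ω, by simpa [Submonoid.unitSphere] using hn⟩
  refine ⟨K + 1, fun k => c ^ k, Nat.succ_ne_zero K, fun m hm hm0 => ?_⟩
  -- If `ω^m = 1`, then `K + 1` divides the nonzero integer `m`, which contradicts `|m| ≤ K`.
  have hne : ω ^ m ≠ 1 := fun h => by
    have h1 := Int.le_of_dvd (abs_pos.2 hm0) ((dvd_abs _ _).2 ((hω.zpow_eq_one_iff_dvd m).1 h))
    push_cast at h1
    omega
  -- The geometric sum times `ω^m - 1` is `(ω^m)^{K+1} - 1 = 0`, and the factor `ω^m - 1` does not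
  -- vanish.
  have hg := geom_sum_mul (ω ^ m) (K + 1)
  have hpow : (ω ^ m) ^ (K + 1) = 1 := by
    rw [← zpow_natCast, ← zpow_mul, mul_comm, zpow_mul, zpow_natCast, hω.pow_eq_one, one_zpow]
  rw [hpow, sub_self] at hg
  have h0 := (mul_eq_zero.1 hg).resolve_right (sub_ne_zero.2 hne)
  rw [← h0]
  refine Finset.sum_congr rfl fun k _ => ?_
  rw [Circle.coe_pow]
  change (ω ^ k) ^ m = (ω ^ m) ^ k
  rw [← zpow_natCast, ← zpow_mul, mul_comm, zpow_mul, zpow_natCast]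

/-- The diagonal matrix of the unitary representation of the circle with degrees `d_i`. -/
noncomputable def circleDiag (d : Fin n → ℤ) (z : Circle) : Matrix (Fin n) (Fin n) ℂ :=
  Matrix.diagonal fun i => (z : ℂ) ^ d i

theorem star_circleDiag (d : Fin n → ℤ) (z : Circle) :
    star (circleDiag d z) = Matrix.diagonal fun i => (z : ℂ) ^ (-d i) := by
  rw [circleDiag, Matrix.star_eq_conjTranspose, Matrix.diagonal_conjTranspose]
  congr 1
  funext i
  exact star_zpow_circle z (d i)

theorem circleDiag_mem_unitary (d : Fin n → ℤ) (z : Circle) :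
    circleDiag d z ∈ unitary (Matrix (Fin n) (Fin n) ℂ) := by
  rw [Unitary.mem_iff, star_circleDiag, circleDiag, Matrix.diagonal_mul_diagonal,
    Matrix.diagonal_mul_diagonal]
  have h : ∀ k : ℤ, (z : ℂ) ^ k ≠ 0 := fun k => zpow_ne_zero k (Circle.coe_ne_zero z)
  simp only [zpow_neg, inv_mul_cancel₀ (h _), mul_inv_cancel₀ (h _), Matrix.diagonal_one, and_self]

open scoped ComplexOrder in
/-- Averaging a positive definite matrix over the circle. -/
theorem exists_graded_posDef (d : Fin n → ℤ) (S : Submodule ℂ (Matrix (Fin n) (Fin n) ℂ))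
    (M : GL (Fin n) ℂ) (hS : ∀ z, star (circleDiag d z)
      * (star (M : Matrix (Fin n) (Fin n) ℂ) * (M : Matrix (Fin n) (Fin n) ℂ)) * circleDiag d z ∈ S) :
    ∃ P ∈ S, P.PosDef ∧ ∀ i j, d i ≠ d j → P i j = 0 := by
  -- The sum of all the `|d_i - d_j|` is a crude bound for each single one of them. Any common bound
  -- would serve.
  obtain ⟨N, z, hN, hz⟩ := exists_circle_sum_zpow (∑ i, ∑ j, (d i - d j).natAbs)
  -- The form is the plain sum of the rotated forms. The factor `1 / N` is omitted, since a positive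
  -- multiple serves equally well.
  refine ⟨_, S.sum_mem (t := Finset.range N) fun k _ => hS (z k), ?_, fun i j hij => ?_⟩
  · refine Matrix.posDef_sum (Finset.nonempty_range_iff.2 hN) fun k _ => ?_
    -- Each rotated form is `A* A` with `A = M D_z` invertible, hence positive definite. A nonempty
    -- sum of such forms is positive definite, and nonemptiness is where `N ≠ 0` enters.
    have e : star (circleDiag d (z k))
        * (star (M : Matrix (Fin n) (Fin n) ℂ) * (M : Matrix (Fin n) (Fin n) ℂ)) * circleDiag d (z k)
        = ((M : Matrix (Fin n) (Fin n) ℂ) * circleDiag d (z k)).conjTranspose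
          * ((M : Matrix (Fin n) (Fin n) ℂ) * circleDiag d (z k)) := by
      rw [Matrix.conjTranspose_mul]
      simp only [mul_assoc, Matrix.star_eq_conjTranspose]
    rw [e]
    refine Matrix.PosDef.conjTranspose_mul_self _ (Matrix.mulVec_injective_of_isUnit ?_)
    exact M.isUnit.mul (Unitary.toUnits ⟨_, circleDiag_mem_unitary d (z k)⟩).isUnit
  -- Rotation multiplies the `(i, j)` entry by `z^{d_j - d_i}`, so the sum over the roots of unity
  -- annihilates this entry as soon as `d_i ≠ d_j`.
  · have hk : ∀ k, (star (circleDiag d (z k))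
        * (star (M : Matrix (Fin n) (Fin n) ℂ) * (M : Matrix (Fin n) (Fin n) ℂ))
          * circleDiag d (z k)) i j = ((z k : ℂ) ^ (d j - d i))
          * (star (M : Matrix (Fin n) (Fin n) ℂ) * (M : Matrix (Fin n) (Fin n) ℂ)) i j := fun k => by
      rw [star_circleDiag, circleDiag, Matrix.mul_diagonal, Matrix.diagonal_mul, mul_right_comm,
        ← zpow_add₀ (Circle.coe_ne_zero _)]
      congr 2; ring
    rw [Matrix.sum_apply]
    simp only [hk]
    rw [← Finset.sum_mul, hz _ _ (sub_ne_zero.2 (Ne.symm hij)), zero_mul]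
    -- The exponent is `d_j - d_i`, so the relevant summand is the one with outer index `j` and
    -- inner index `i`.
    have h1 : (d j - d i).natAbs ≤ ∑ i, ∑ j, (d i - d j).natAbs :=
      (Finset.single_le_sum (f := fun i => (d j - d i).natAbs) (fun _ _ => Nat.zero_le _)
        (Finset.mem_univ i)).trans
      (Finset.single_le_sum (f := fun i => ∑ j, (d i - d j).natAbs) (fun _ _ => Nat.zero_le _)
        (Finset.mem_univ j))
    rw [Int.abs_eq_natAbs]
    exact_mod_cast h1

/-! ### Sesquilinear forms preserved by a matrix over a C⋆-algebra -/

section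
variable (B : Type u) [CStarAlgebra B]

theorem scalarMatrix_mul (P Q : Matrix (Fin n) (Fin n) ℂ) :
    scalarMatrix B (P * Q) = scalarMatrix B P * scalarMatrix B Q := Matrix.map_mul

theorem scalarMatrix_one : scalarMatrix B (1 : Matrix (Fin n) (Fin n) ℂ) = 1 :=
  Matrix.map_one _ (map_zero _) (map_one _)

theorem scalarMatrix_star (P : Matrix (Fin n) (Fin n) ℂ) :
    scalarMatrix B (star P) = star (scalarMatrix B P) := by
  ext i j
  exact algebraMap_star_comm (A := B) (P j i)

variable {B}

/-- The sesquilinear forms that are invariant under the matrix `w`. -/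
noncomputable def invariantForms (w : Matrix (Fin n) (Fin n) B) :
    Submodule ℂ (Matrix (Fin n) (Fin n) ℂ) where
  carrier := {P | star w * scalarMatrix B P * w = scalarMatrix B P}
  add_mem' {P Q} hP hQ := by
    have e : scalarMatrix B (P + Q) = scalarMatrix B P + scalarMatrix B Q :=
      Matrix.map_add _ (map_add _) P Q
    change _ = _ at hP
    change _ = _ at hQ
    change _ = _
    rw [e, mul_add, add_mul, hP, hQ]
  zero_mem' := by
    have e : scalarMatrix B (0 : Matrix (Fin n) (Fin n) ℂ) = 0 := Matrix.map_zero _ (map_zero _)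
    change _ = _
    rw [e, mul_zero, zero_mul]
  smul_mem' c P hP := by
    have e : scalarMatrix B (c • P) = c • scalarMatrix B P := by
      ext i j
      rw [Matrix.smul_apply, scalarMatrix, scalarMatrix, Matrix.map_apply, Matrix.map_apply,
        Matrix.smul_apply, smul_eq_mul, map_mul, ← Algebra.smul_def]
    change _ = _ at hP
    change _ = _
    rw [e, mul_smul_comm, smul_mul_assoc, hP]

theorem mem_invariantForms {w : Matrix (Fin n) (Fin n) B} {P : Matrix (Fin n) (Fin n) ℂ} :
    P ∈ invariantForms w ↔ star w * scalarMatrix B P * w = scalarMatrix B P := Iff.rfl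

/-- If `w` is homogeneous, its invariant forms are permuted by the circle. -/
theorem rotate_mem_invariantForms [CircleAction B] {w : Matrix (Fin n) (Fin n) B} {d : Fin n → ℤ}
    (hw : ∀ i j, IsHomogeneous (w i j) (d i - d j)) {P : Matrix (Fin n) (Fin n) ℂ}
    (hP : P ∈ invariantForms w) (z : Circle) :
    star (circleDiag d z) * P * circleDiag d z ∈ invariantForms w := by
  rw [mem_invariantForms] at hP ⊢
  have hD := circleDiag_mem_unitary d z
  rw [Unitary.mem_iff] at hD
  -- Entrywise, `z^{d_i - d_j} w_ij = z^{d_i} w_ij z^{-d_j}`: the action of `z` on the entries is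
  -- conjugation by the scalar diagonal matrix `D_z`.
  have hmap : w.map (CircleAction.act B z)
      = scalarMatrix B (circleDiag d z) * w * star (scalarMatrix B (circleDiag d z)) := by
    rw [← scalarMatrix_star, star_circleDiag, circleDiag]
    simp only [scalarMatrix]
    rw [Matrix.diagonal_map (map_zero _), Matrix.diagonal_map (map_zero _)]
    ext i j
    rw [Matrix.mul_diagonal, Matrix.diagonal_mul, Matrix.map_apply, hw i j z, ← Algebra.smul_def,
      ← Algebra.commutes, ← Algebra.smul_def, smul_smul, ← zpow_add₀ (Circle.coe_ne_zero z)]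
    congr 2; ring
  -- The action fixes scalars, so it turns `w* P w = P` into `(D w D*)* P (D w D*) = P`. Conjugating
  -- this equation by `D` is all that remains.
  have h1 := congrArg (fun A : Matrix (Fin n) (Fin n) B => A.map (CircleAction.act B z)) hP
  simp only [map_mul_matrix, map_star_matrix, map_scalarMatrix, hmap] at h1
  rw [scalarMatrix_mul, scalarMatrix_mul, scalarMatrix_star]
  have hs : star (scalarMatrix B (circleDiag d z)) * scalarMatrix B (circleDiag d z) = 1 := by
    rw [← scalarMatrix_star, ← scalarMatrix_mul, hD.1, scalarMatrix_one]
  set D := scalarMatrix B (circleDiag d z)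
  set Q := scalarMatrix B P
  -- Inserting `D* D = 1` at both ends exposes the rotated matrix `D w D*` and its adjoint on the
  -- two sides of the form.
  calc star w * (star D * Q * D) * w
      = (star D * D) * star w * (star D * Q * D) * w * (star D * D) := by rw [hs, one_mul, mul_one]
    _ = star D * (star (D * w * star D) * Q * (D * w * star D)) * D := by
        simp only [star_mul, star_star, mul_assoc]
    _ = _ := by rw [h1]

/-- An invertible matrix that preserves `F* F` is unitary after conjugation by `F`. -/
theorem conj_mem_unitary {w w' : Matrix (Fin n) (Fin n) B} (hw : w * w' = 1) (F : GL (Fin n) ℂ)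
    (hF : star (F : Matrix (Fin n) (Fin n) ℂ) * (F : Matrix (Fin n) (Fin n) ℂ) ∈ invariantForms w) :
    scalarMatrix B (F : Matrix (Fin n) (Fin n) ℂ) * w
      * scalarMatrix B ((F⁻¹ : GL (Fin n) ℂ) : Matrix (Fin n) (Fin n) ℂ)
      ∈ unitary (Matrix (Fin n) (Fin n) B) := by
  rw [mem_invariantForms, scalarMatrix_mul, scalarMatrix_star] at hF
  have h1 := scalarMatrix_mul_inv B F
  have h2 := scalarMatrix_inv_mul B F
  set P := scalarMatrix B (F : Matrix (Fin n) (Fin n) ℂ)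
  set Q := scalarMatrix B ((F⁻¹ : GL (Fin n) ℂ) : Matrix (Fin n) (Fin n) ℂ)
  -- Preservation of `F* F` gives only that `F w F⁻¹` is an isometry.
  have hl : star (P * w * Q) * (P * w * Q) = 1 := by
    calc star (P * w * Q) * (P * w * Q) = star Q * (star w * (star P * P) * w) * Q := by
          simp only [star_mul, mul_assoc]
      _ = star (P * Q) * (P * Q) := by
          rw [hF]; simp only [star_mul, mul_assoc]
      _ = 1 := by rw [h1, star_one, one_mul]
  -- An isometry over a general C⋆-algebra need not be unitary, because a left inverse of a matrix
  -- need not be a right inverse. This is why a right inverse of `w` is assumed. Once both one-sided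
  -- inverses exist they coincide, so the adjoint is a two-sided inverse.
  have hr : P * w * Q * (P * w' * Q) = 1 := by
    calc P * w * Q * (P * w' * Q) = P * (w * (Q * P) * w') * Q := by simp only [mul_assoc]
      _ = 1 := by rw [h2, mul_one, hw, mul_one, h1]
  rw [Unitary.mem_iff]
  refine ⟨hl, ?_⟩
  rwa [left_inv_eq_right_inv hl hr]

end

/-! ### From elements of `L(H) ⊗ X` to matrices: unitarity and change of basis -/

theorem ofMat_one {H : Type v} [NormedAddCommGroup H] [InnerProductSpace ℂ H] {X : Type u}
    [CStarAlgebra X] (b : Module.Basis (Fin n) ℂ H) :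
    ofMat b (1 : Matrix (Fin n) (Fin n) X) = 1 := by
  have h : (1 : Matrix (Fin n) (Fin n) X) = toMat b (1 : Module.End ℂ H ⊗[ℂ] X) := by
    ext i j
    rw [Algebra.TensorProduct.one_def, toMat_tmul, Module.End.one_apply, Module.Basis.repr_self,
      Finsupp.single_apply, Matrix.one_apply]
    by_cases hij : i = j
    · subst hij; simp
    · rw [if_neg hij, if_neg (Ne.symm hij), zero_smul]
  rw [h, ofMat_toMat]

section
variable {H : Type v} [NormedAddCommGroup H] [InnerProductSpace ℂ H] [FiniteDimensional ℂ H]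
  {X : Type u} [CStarAlgebra X]

/-- This is where orthonormality is used: the coordinates are then inner products with the basis
vectors, so `e_ij` is the rank-one operator `y ↦ ⟪e_j, y⟫ e_i`. For a general basis the coordinate
functionals belong to the dual basis, and taking adjoints would not merely swap the indices. -/
theorem star_matUnit (e : OrthonormalBasis (Fin n) ℂ H) (i j : Fin n) :
    star (matUnit e.toBasis i j) = matUnit e.toBasis j i := by
  rw [LinearMap.star_eq_adjoint]
  symm
  rw [LinearMap.eq_adjoint_iff]
  -- Both inner products reduce to `⟪x, e_i⟫ ⟪e_j, y⟫`.
  intro x y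
  simp only [matUnit, LinearMap.smulRight_apply, Module.Basis.coord_apply,
    OrthonormalBasis.coe_toBasis_repr_apply, OrthonormalBasis.coe_toBasis, inner_smul_left,
    inner_smul_right, e.repr_apply_apply, inner_conj_symm]
  rw [mul_comm]

theorem star_ofMat (e : OrthonormalBasis (Fin n) ℂ H) (m : Matrix (Fin n) (Fin n) X) :
    star (ofMat e.toBasis m) = ofMat e.toBasis (star m) := by
  simp only [ofMat, star_sum, TensorProduct.star_tmul, star_matUnit]
  exact Finset.sum_comm

/-- In an orthonormal basis, passing between `L(H) ⊗ X` and matrices respects products, units and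
adjoints, hence unitarity. It is needed twice: for `v` itself and for the unitary representation
equivalent to its conjugate. -/
theorem toMat_mem_unitary (e : OrthonormalBasis (Fin n) ℂ H) {a : Module.End ℂ H ⊗[ℂ] X}
    (ha : a ∈ unitary (Module.End ℂ H ⊗[ℂ] X)) :
    toMat e.toBasis a ∈ unitary (Matrix (Fin n) (Fin n) X) := by
  rw [Unitary.mem_iff] at ha ⊢
  rw [← ofMat_toMat e.toBasis a, star_ofMat, ofMat_mul, ofMat_mul, ← ofMat_one e.toBasis] at ha
  exact ⟨ofMat_injective _ ha.1, ofMat_injective _ ha.2⟩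

end

/-- The matrix of `(T ⊗ 1) a (T⁻¹ ⊗ 1)`. -/
theorem toMat_conj {H : Type v} [NormedAddCommGroup H] [InnerProductSpace ℂ H] {K : Type w}
    [NormedAddCommGroup K] [InnerProductSpace ℂ K] {X : Type u} [CStarAlgebra X]
    (b : Module.Basis (Fin n) ℂ H) (b' : Module.Basis (Fin n) ℂ K) (T : H ≃ₗ[ℂ] K)
    (a : Module.End ℂ H ⊗[ℂ] X) :
    toMat b' (LinearMap.rTensor X (T.conj : Module.End ℂ H ≃ₗ[ℂ] Module.End ℂ K).toLinearMap a)
      = scalarMatrix X (LinearMap.toMatrix b b' T) * toMat b a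
        * scalarMatrix X (LinearMap.toMatrix b' b T.symm) := by
  induction a with
  | zero =>
    have h : toMat b (0 : Module.End ℂ H ⊗[ℂ] X) = 0 := by
      ext i j; simp [toMat]
    have h' : toMat b' (0 : Module.End ℂ K ⊗[ℂ] X) = 0 := by
      ext i j; simp [toMat]
    rw [map_zero, h, h', mul_zero, zero_mul]
  | add a a' h h' => rw [map_add, toMat_add, toMat_add, h, h', mul_add, add_mul]
  | tmul S x =>
    rw [LinearMap.rTensor_tmul]
    -- An elementary tensor `S ⊗ x` is the scalar matrix of `S` times the constant diagonal matrix
    -- `x`. This separates the two legs, and only the first leg is conjugated by `T`.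
    have e1 : toMat b (S ⊗ₜ[ℂ] x) = scalarMatrix X (LinearMap.toMatrix b b S)
        * Matrix.diagonal fun _ => x := by
      ext i j
      rw [toMat_tmul, Matrix.mul_diagonal, Algebra.smul_def, scalarMatrix, Matrix.map_apply,
        LinearMap.toMatrix_apply]
    have e2 : ∀ S' : Module.End ℂ K, toMat b' (S' ⊗ₜ[ℂ] x)
        = scalarMatrix X (LinearMap.toMatrix b' b' S') * Matrix.diagonal fun _ => x := fun S' => by
      ext i j
      rw [toMat_tmul, Matrix.mul_diagonal, Algebra.smul_def, scalarMatrix, Matrix.map_apply,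
        LinearMap.toMatrix_apply]
    -- Scalars are central in `X`, so the constant diagonal matrix `x` moves past the matrix of
    -- `T⁻¹`. What is left is the usual change of basis formula for `T S T⁻¹`.
    have hc : ∀ A : Matrix (Fin n) (Fin n) ℂ, Matrix.diagonal (fun _ => x) * scalarMatrix X A
        = scalarMatrix X A * Matrix.diagonal fun _ => x := fun A => by
      ext i j
      rw [Matrix.mul_diagonal, Matrix.diagonal_mul, scalarMatrix, Matrix.map_apply,
        Algebra.commutes]
    rw [e1, e2, ← mul_assoc, mul_assoc, mul_assoc, hc, ← mul_assoc, ← mul_assoc,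
      ← scalarMatrix_mul, ← scalarMatrix_mul]
    congr 2
    change LinearMap.toMatrix b' b' ((T : H →ₗ[ℂ] K) ∘ₗ S ∘ₗ (T.symm : K →ₗ[ℂ] H)) = _
    rw [LinearMap.toMatrix_comp b' b b', LinearMap.toMatrix_comp b' b b, mul_assoc]

end

/-! ### Construction of `F` and of the morphism -/

section
variable {ζ : Circle} {G : BraidedCQG.{u} ζ} {n : ℕ} {d : Fin n → ℤ}

/-- Adjoints have the opposite degree, and the scalar powers of `ζ` do not affect degrees. The order
of `d_i` and `d_j` is therefore the one for which `ρ_z` acts as conjugation by `diag(z^{d_i})`, as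
`rotate_mem_invariantForms` requires. -/
theorem isHomogeneous_conjMatrix {X : Type u} [CStarAlgebra X] [CircleAction X] (ζ : Circle)
    {w : Matrix (Fin n) (Fin n) X} (hw : ∀ i j, IsHomogeneous (w i j) (d j - d i)) (i j : Fin n) :
    IsHomogeneous (conjMatrix ζ d w i j) (d i - d j) := fun z => by
  have h := (hw i j).star z
  rw [conjMatrix, Matrix.of_apply, map_smul, h, smul_comm, neg_sub]

/-- A matrix similar to a unitary one, with homogeneous entries, can be made unitary by an admissible
conjugation. -/
theorem exists_admissible_unitary {X : Type u} [CStarAlgebra X] [CircleAction X] (ζ : Circle)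
    {m w' : Matrix (Fin n) (Fin n) X} (hm : ∀ i j, IsHomogeneous (m i j) (d j - d i))
    (hw' : w' ∈ unitary (Matrix (Fin n) (Fin n) X)) (M : GL (Fin n) ℂ)
    (h : w' = twistedMatrix ζ d M m) :
    ∃ F : GL (Fin n) ℂ, IsAdmissible d F ∧
      twistedMatrix ζ d F m ∈ unitary (Matrix (Fin n) (Fin n) X) := by
  set w := conjMatrix ζ d m with hwdef
  have h1 := scalarMatrix_mul_inv X M
  have h2 := scalarMatrix_inv_mul X M
  rw [twistedMatrix] at h
  rw [Unitary.mem_iff] at hw'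
  -- `M` intertwines `w` with the unitary `w'`. Pulling the standard form, which `w'` preserves,
  -- back along `M` gives the form `M* M`, which `w` preserves.
  have hPM : w' * scalarMatrix X (M : Matrix (Fin n) (Fin n) ℂ)
      = scalarMatrix X (M : Matrix (Fin n) (Fin n) ℂ) * w := by
    rw [h, mul_assoc, h2, mul_one]
  have hinv : star (M : Matrix (Fin n) (Fin n) ℂ) * (M : Matrix (Fin n) (Fin n) ℂ)
      ∈ invariantForms w := by
    rw [mem_invariantForms, scalarMatrix_mul, scalarMatrix_star]
    set A := scalarMatrix X (M : Matrix (Fin n) (Fin n) ℂ)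
    calc star w * (star A * A) * w = star (A * w) * (A * w) := by simp only [star_mul, mul_assoc]
      _ = star A * (star w' * w') * A := by rw [← hPM]; simp only [star_mul, mul_assoc]
      _ = _ := by rw [hw'.1, mul_one]
  -- As `w = M⁻¹ w' M`, a right inverse of `w` is `M⁻¹ w'* M`. Here the relation `w' w'* = 1`
  -- enters, whereas invariance of the form used only `w'* w' = 1`.
  have hright : w * (scalarMatrix X ((M⁻¹ : GL (Fin n) ℂ) : Matrix (Fin n) (Fin n) ℂ) * star w'
      * scalarMatrix X (M : Matrix (Fin n) (Fin n) ℂ)) = 1 := by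
    set A := scalarMatrix X (M : Matrix (Fin n) (Fin n) ℂ)
    set A' := scalarMatrix X ((M⁻¹ : GL (Fin n) ℂ) : Matrix (Fin n) (Fin n) ℂ)
    calc w * (A' * star w' * A) = (A' * A) * w * A' * star w' * A := by
          rw [h2, one_mul]; simp only [mul_assoc]
      _ = A' * ((A * w * A') * star w') * A := by simp only [mul_assoc]
      _ = 1 := by rw [← h, hw'.2, mul_one, h2]
  -- All rotations of `M* M` lie in the linear space of invariant forms, so their sum does too. This
  -- is the passage from the arbitrary `M` to a form compatible with the degrees.
  obtain ⟨P, hP, hpos, hgr⟩ := exists_graded_posDef d (invariantForms w) M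
    (rotate_mem_invariantForms (isHomogeneous_conjMatrix ζ hm) hinv)
  -- From here on `P` is literally `F* F`, so its invariance is the hypothesis needed to make `F w
  -- F⁻¹` unitary.
  obtain ⟨F, hF, rfl⟩ := exists_admissible_sqrt hpos hgr
  exact ⟨F, hF, conj_mem_unitary hright F hP⟩

/-- The morphism `C(U_ζ^+(F)) → C(G)` given by a representation. -/
theorem existsUnique_hopfHom (F : GL (Fin n) ℂ) (hF : IsAdmissible d F)
    {m : Matrix (Fin n) (Fin n) G.Alg} (hm : ∀ i j, IsHomogeneous (m i j) (d j - d i))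
    (hΔ : m.map G.Δ = m.map (BraidedTensor.j₁ ζ G.Alg) * m.map (BraidedTensor.j₂ ζ G.Alg))
    (h1 : m ∈ unitary (Matrix (Fin n) (Fin n) G.Alg))
    (h2 : twistedMatrix ζ d F m ∈ unitary (Matrix (Fin n) (Fin n) G.Alg)) :
    ∃! φ : (freeUnitary.{u} ζ d F hF).Alg →⋆ₐ[ℂ] G.Alg,
      IsHopfHom φ ∧ ∀ i j, φ (freeUnitary.mat ζ d F hF i j) = m i j := by
  have : Fact (IsAdmissible d F) := ⟨hF⟩
  let φ : UPlus.{u} ζ d F →⋆ₐ[ℂ] G.Alg := UPlus.lift ζ d F m h1 h2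
  have hφ : ∀ i j, φ (UPlus.fund ζ d F i j) = m i j := UPlus.lift_fund ζ d F m h1 h2
  -- Two ⋆-homomorphisms that agree on the `u_ij` are equal. On these, equivariance says that `u_ij`
  -- and `v_ij` have the same degree `d_j - d_i`. It must be settled first, since `φ ⊠ φ` is formed
  -- only for equivariant maps.
  have heq : IsEquivariant φ := fun z x => by
    have h : (CircleAction.act _ z).comp φ = φ.comp (CircleAction.act _ z) := by
      refine UPlus.hom_ext ζ d F fun i j => ?_
      rw [StarAlgHom.comp_apply, StarAlgHom.comp_apply, UPlus.isHomogeneous_fund ζ d F i j z,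
        map_smul, hφ, hm i j z]
    exact DFunLike.congr_fun h x
  have hcomul : ∀ x, G.Δ (φ x) = BraidedTensor.map ζ φ φ heq heq (UPlus.comul ζ d F x) := fun x => by
    have h : G.Δ.comp φ = (BraidedTensor.map ζ φ φ heq heq).comp (UPlus.comul ζ d F) := by
      refine UPlus.hom_ext ζ d F fun i j => ?_
      rw [StarAlgHom.comp_apply, StarAlgHom.comp_apply, UPlus.comul_fund, map_sum, hφ]
      -- Both sides are now `∑_k j₁(m_ik) j₂(m_kj)`: one by the assumption on `m`, the other by the
      -- definition of the comultiplication on the generators.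
      refine (congrFun (congrFun hΔ i) j).trans ?_
      rw [Matrix.mul_apply]
      refine Finset.sum_congr rfl fun k _ => ?_
      rw [map_mul, BraidedTensor.map_j₁, BraidedTensor.map_j₂, hφ, hφ]
      rfl
    exact DFunLike.congr_fun h x
  -- Uniqueness already holds among all unital ⋆-homomorphisms with the prescribed values on the
  -- generators.
  refine ⟨φ, ⟨⟨heq, hcomul⟩, hφ⟩, fun ψ hψ => ?_⟩
  exact UPlus.hom_ext ζ d F fun i j => (hψ.2 i j).trans (hφ i j).symm

end

/-- What remains is to translate the equivalence of the conjugate with a unitary representation into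
a matrix identity `w' = M w M⁻¹` over `C(G)`. `exists_admissible_unitary` then provides `F`, and
`existsUnique_hopfHom` the morphism. -/
theorem mainTheorem3 {ζ : Circle} (G : BraidedCQG.{u} ζ) {H : Type v} [NormedAddCommGroup H]
    [InnerProductSpace ℂ H] [FiniteDimensional ℂ H] (v : FinRep G H) (hv : v.IsUnitary) {n : ℕ}
    (e : OrthonormalBasis (Fin n) ℂ H) (d : Fin n → ℤ) (he : v.IsEigenbasis e d)
    {H' : Type w} [NormedAddCommGroup H'] [InnerProductSpace ℂ H'] [FiniteDimensional ℂ H']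
    (v' : FinRep G H') (hv' : v'.IsUnitary) (hequiv : (v.conj e d he).Equivalent v') :
    ∃ (F : GL (Fin n) ℂ) (hF : IsAdmissible d F),
      ∃! φ : (freeUnitary.{u} ζ d F hF).Alg →⋆ₐ[ℂ] G.Alg,
        IsHopfHom φ ∧ ∀ i j, φ (freeUnitary.mat ζ d F hF i j) = v.mat e i j := by
  obtain ⟨T, hT⟩ := hequiv
  let b := ConjSpace.basis e.toBasis
  -- The equivalence is a linear isomorphism, so `H'` has the dimension of the conjugate space, and
  -- its orthonormal bases can be indexed by `Fin n`.
  have hdim : Module.finrank ℂ H' = n := by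
    rw [← T.finrank_eq, Module.finrank_eq_card_basis b, Fintype.card_fin]
  -- Any orthonormal basis of `H'` will do, as it serves only to turn `v'` into a unitary matrix. It
  -- need not diagonalize the circle representation on `H'`.
  let e' : OrthonormalBasis (Fin n) ℂ H' :=
    (stdOrthonormalBasis ℂ H').reindex (finCongr hdim)
  -- `M` is the matrix of `T` from the conjugate eigenbasis to `e'`. It is invertible because `T`
  -- is, but in general neither unitary nor admissible.
  let M : GL (Fin n) ℂ :=
    { val := LinearMap.toMatrix b e'.toBasis T
      inv := LinearMap.toMatrix e'.toBasis b T.symm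
      val_inv := by
        rw [← LinearMap.toMatrix_comp, LinearEquiv.comp_symm, LinearMap.toMatrix_id]
      inv_val := by
        rw [← LinearMap.toMatrix_comp, LinearEquiv.symm_comp, LinearMap.toMatrix_id] }
  -- The equivalence relation in coordinates: the matrix of `v'` is `M v̄_ζ M⁻¹`, because `v̄_ζ` is
  -- by construction the matrix of the conjugate representation in the conjugate basis.
  have hM : toMat e'.toBasis v'.u = twistedMatrix ζ d M (v.mat e) := by
    rw [hT, toMat_conj b e'.toBasis]
    change scalarMatrix G.Alg _ * toMat b (ofMat b (conjMatrix ζ d (v.mat e))) * _ = _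
    rw [toMat_ofMat]
    rfl
  obtain ⟨F, hF, hu⟩ := exists_admissible_unitary ζ (v.mat_homogeneous he)
    (toMat_mem_unitary e' hv') M hM
  exact ⟨F, hF, existsUnique_hopfHom F hF (v.mat_homogeneous he) (v.mat_comul e)
    (toMat_mem_unitary e hv) hu⟩
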